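/- **Setting.** Let $p,d,n\ge 1$, let $\Sigma\in\mathbb R^{p\times p}$ be symmetric positive definite with $\Sigma_{ii}=1$ for all $i$, put $\Theta=\Sigma^{-1}$, and let $\sigma\ge 0$. Let $\tilde A\in\mathbb R^{d\times p}$ have i.i.d. $N(0,1/d)$ entries, let $X^{(1)},\dots,X^{(n)}$ be i.i.d. $N(0,\Sigma)$, let $W^{(1)},\dots,W^{(n)}$ be i.i.d. $N(0,\sigma^2 I_d)$, with $\tilde A$, $(X^{(s)})_s$, $(W^{(s)})_s$ independent. One observes $\tilde A$ and $Y^{(s)}=\tilde A X^{(s)}+W^{(s)}$. Put $$\hat\Sigma=I+\frac{d}{d+1}\Big[\tilde A^{\top}\Big(\frac1n\sum_{s=1}^nY^{(s)}Y^{(s)\top}\Big)\tilde A\Big]_{\rm off},$$ where $[\cdot]_{\rm off}$ replaces the diagonal by zero, and for $\lambda>0$ let $\hat\Theta$ be a minimizer, over symmetric positive definite matrices $T$, of $$-\log\det T+\operatorname{tr}(T\hat\Sigma)+\lambda\sum_{i\ne j}|T_{ij}|.$$ **Parameters.** $S=\{(i,j):\Theta_{ij}\neq0\}$ (it contains the diagonal),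 $S^c$ is its complement; $\deg=\max_j\#\{i:\Theta_{ij}\ne0\}$; $\kappa_\Sigma=\max_i\sum_j|\Sigma_{ij}|$; $\Gamma=\Sigma\otimes\Sigma$; $\kappa_\Gamma$ is the maximal absolute row sum of $(\Gamma_{SS})^{-1}$; $\|M\|_\infty=\max_{i,j}|M_{ij}|$. For $C>0$ put $$\begin{aligned}\tau_\infty=C\Big[&\sqrt{\tfrac{\log p}{d}}\max_j\|\Sigma_j\|_2+\tfrac{\log p}{d}\big(1+\tfrac pd\big)\Big(\sum_{i\neq j}\Sigma_{ij}^2\Big)^{1/2}+\tfrac{\sqrt p\,\log p}{\sqrt{nd}}+\tfrac{p(\log p)^{3/2}}{\sqrt n\,d}\big(1+\tfrac pd\big)\\&+\tfrac{\sqrt{p\log p}}{d}+\tfrac{p\sqrt{\log p}}{d^{3/2}}+\sqrt{\tfrac{\log p}{n}}+\sigma^2\Big(1+\sqrt{\tfrac{\log p}{d}}\Big)\sqrt{\tfrac{\log p}{d}}\Big(1+\max\big\{\sqrt{\tfrac dn},\tfrac dn\big\}\Big)\Big],\end{aligned}$$ where $\Sigma_j$ is the $j$-th column of $\Sigma$.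 **Theorem.** There are absolute constants $C,a_0,a_1,a_2,a_3,a_4>0$ such that the following two statements hold. (1) Let $0<\theta\le1$, assume the irrepresentability condition $\max_{e\in S^c}\|\Gamma_{eS}(\Gamma_{SS})^{-1}\|_1\le1-\theta$, put $r=2\kappa_\Gamma(1+8/\theta)\tau_\infty$, and assume $$r\le\frac{1}{3\kappa_\Sigma\deg}\min\Big\{1,\frac1{\kappa_\Sigma^2\kappa_\Gamma}\Big\},\qquad \tfrac32\deg\,\kappa_\Sigma^3\,r^2\le\tau_\infty .$$ Then, with $\lambda=8\tau_\infty/\theta$, with probability at least $1-a_0p^{-1}-a_1p^2e^{-a_2d}-a_3p^2e^{-a_4p}$ the minimizer $\hat\Theta$ exists and is unique, $\hat\Theta_{ij}=0$ for all $(i,j)\in S^c$, $\|\hat\Theta-\Theta\|_\infty\le 2\kappa_\Gamma(1+8/\theta)\tau_\infty$, and, if $|\Theta_{ij}|\ge2\kappa_\Gamma(1+8/\theta)\tau_\infty$ for all $(i,j)\in S$ with $i\neq j$, then $\operatorname{sign}(\hat\Theta)=\operatorname{sign}(\Theta)$ entrywise. (2) For all $\theta\in(0,1]$, $b>0$ and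 bounds $\kappa_1,\kappa_2,\sigma_0,D$ there is $K>0$ such that, whenever $\Sigma$ satisfies the irrepresentability condition with $\theta$, $\kappa_\Sigma\le\kappa_1$, $\kappa_\Gamma\le\kappa_2$, $\deg\le D$, $\sigma\le\sigma_0$, $|\Theta_{ij}|\ge b$ for all $(i,j)\in S$ with $i\ne j$, and $$d\ge Kp^{0.8},\qquad n\ge Kp^{0.8}\log^3p,\qquad d\le\max\{p,n\},$$ then, with $\lambda=8\tau_\infty/\theta$, with probability at least $1-a_0p^{-1}-a_1p^2e^{-a_2d}-a_3p^2e^{-a_4p}$ the minimizer $\hat\Theta$ exists and is unique and $\operatorname{sign}(\hat\Theta)=\operatorname{sign}(\Theta)$ entrywise. -/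

import Mathlib

open MeasureTheory ProbabilityTheory Matrix
open scoped NNReal ENNReal Kronecker

universe u

noncomputable section

namespace IndirectGGM

/-! ### Matrix quantities -/

/-- `max_{i,j} |M i j|`. -/
def entryMax {p : ℕ} (M : Matrix (Fin p) (Fin p) ℝ) : ℝ :=
  ⨆ q : Fin p × Fin p, |M q.1 q.2|

/-- `max_i ∑_j |M i j|`, the operator norm from `ℓ_∞` to `ℓ_∞`. -/
def maxRowSum {ι : Type*} [Fintype ι] (M : Matrix ι ι ℝ) : ℝ :=
  ⨆ i, ∑ j, |M i j|

/-- The largest Euclidean norm of a column. -/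
def maxColNorm {p : ℕ} (M : Matrix (Fin p) (Fin p) ℝ) : ℝ :=
  ⨆ j, Real.sqrt (∑ i, M i j ^ 2)

/-- The matrix with the diagonal entries replaced by zero. -/
def offPart {p : ℕ} (M : Matrix (Fin p) (Fin p) ℝ) : Matrix (Fin p) (Fin p) ℝ :=
  Matrix.of fun i j => if i = j then 0 else M i j

/-- `∑_{i ≠ j} |M i j|`. -/
def offL1 {p : ℕ} (M : Matrix (Fin p) (Fin p) ℝ) : ℝ :=
  ∑ i, ∑ j, |offPart M i j|

/-- `(∑_{i ≠ j} (M i j)^2)^{1/2}`. -/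
def offFrobenius {p : ℕ} (M : Matrix (Fin p) (Fin p) ℝ) : ℝ :=
  Real.sqrt (∑ i, ∑ j, offPart M i j ^ 2)

/-! ### Parameters of the Gaussian graphical model with covariance `Sig` -/

/-- The support of the precision matrix. It contains the diagonal (a positive definite matrix has
nonzero diagonal), so its complement consists of the off-diagonal zeros. -/
def precSupport {p : ℕ} (Sig : Matrix (Fin p) (Fin p) ℝ) : Set (Fin p × Fin p) :=
  {q | Sig⁻¹ q.1 q.2 ≠ 0}

instance {p : ℕ} (Sig : Matrix (Fin p) (Fin p) ℝ) : Fintype (precSupport Sig) :=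
  Fintype.ofFinite _

/-- The largest number of nonzero entries in a column of the precision matrix. -/
def maxDeg {p : ℕ} (Sig : Matrix (Fin p) (Fin p) ℝ) : ℕ :=
  ⨆ j : Fin p, Set.ncard {i : Fin p | Sig⁻¹ i j ≠ 0}

/-- `κ_Σ`. -/
def kappaSigma {p : ℕ} (Sig : Matrix (Fin p) (Fin p) ℝ) : ℝ := maxRowSum Sig

/-- `Γ = Σ ⊗ Σ`. -/
def fisher {p : ℕ} (Sig : Matrix (Fin p) (Fin p) ℝ) :
    Matrix (Fin p × Fin p) (Fin p × Fin p) ℝ :=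
  Sig ⊗ₖ Sig

/-- `Γ_{SS}`. -/
def fisherSS {p : ℕ} (Sig : Matrix (Fin p) (Fin p) ℝ) :
    Matrix (precSupport Sig) (precSupport Sig) ℝ :=
  (fisher Sig).submatrix Subtype.val Subtype.val

open Classical in
/-- `(Γ_{SS})⁻¹`. -/
def fisherSSInv {p : ℕ} (Sig : Matrix (Fin p) (Fin p) ℝ) :
    Matrix (precSupport Sig) (precSupport Sig) ℝ :=
  (fisherSS Sig)⁻¹

/-- `κ_Γ`, the `ℓ_∞` operator norm of `(Γ_{SS})⁻¹`. -/
def kappaGamma {p : ℕ} (Sig : Matrix (Fin p) (Fin p) ℝ) : ℝ := maxRowSum (fisherSSInv Sig)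

/-- The irrepresentability condition
`max_{e ∉ S} ‖Γ_{eS} (Γ_{SS})⁻¹‖_1 ≤ 1 - θ`. -/
def Irrepresentable {p : ℕ} (Sig : Matrix (Fin p) (Fin p) ℝ) (θ : ℝ) : Prop :=
  ∀ e : Fin p × Fin p, e ∉ precSupport Sig →
    ∑ t : precSupport Sig,
      |((fun s : precSupport Sig => fisher Sig e s) ᵥ* fisherSSInv Sig) t| ≤ 1 - θ

/-! ### Observations, covariance estimator, graphical lasso -/

/-- The random inputs: a sensing matrix `A` with i.i.d. `N(0, 1/d)` entries, i.i.d. signals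
`X s ∼ N(0, Sig)`, i.i.d. noise entries `W s k ∼ N(0, σ²)`, and `A`, `X`, `W` independent. -/
structure IsSensingModel {p d n : ℕ} {Ω : Type*} [MeasurableSpace Ω] (P : Measure Ω)
    (Sig : Matrix (Fin p) (Fin p) ℝ) (σ : ℝ≥0)
    (A : Ω → Matrix (Fin d) (Fin p) ℝ) (X : Fin n → Ω → EuclideanSpace ℝ (Fin p))
    (W : Fin n → Ω → Fin d → ℝ) : Prop where
  law_A : ∀ k j, HasLaw (fun ω => A ω k j) (gaussianReal 0 (d : ℝ≥0)⁻¹) P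
  law_X : ∀ s, HasLaw (X s) (multivariateGaussian 0 Sig) P
  law_W : ∀ s k, HasLaw (fun ω => W s ω k) (gaussianReal 0 (σ ^ 2)) P
  indep_A : iIndepFun (fun (q : Fin d × Fin p) ω => A ω q.1 q.2) P
  indep_X : iIndepFun X P
  indep_W : iIndepFun (fun (q : Fin n × Fin d) ω => W q.1 ω q.2) P
  indep_A_XW : IndepFun (fun ω (q : Fin d × Fin p) => A ω q.1 q.2)
    (fun ω => ((fun s => X s ω), (fun (q : Fin n × Fin d) => W q.1 ω q.2))) P
  indep_X_W : IndepFun (fun ω s => X s ω) (fun ω (q : Fin n × Fin d) => W q.1 ω q.2) P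

/-- One observation `y = A x + w`. -/
def observe {p d : ℕ} (A : Matrix (Fin d) (Fin p) ℝ) (x : EuclideanSpace ℝ (Fin p))
    (w : Fin d → ℝ) : Fin d → ℝ :=
  (A *ᵥ fun j => x j) + w

/-- The covariance estimator `I + d/(d+1) [Aᵀ (n⁻¹ ∑ y yᵀ) A]_off`. -/
def covEstimator {p d n : ℕ} (A : Matrix (Fin d) (Fin p) ℝ) (y : Fin n → Fin d → ℝ) :
    Matrix (Fin p) (Fin p) ℝ :=
  1 + ((d : ℝ) / ((d : ℝ) + 1)) •
    offPart (Aᵀ * ((n : ℝ)⁻¹ • ∑ s, vecMulVec (y s) (y s)) * A)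

/-- `-log det T + tr(T R) + lam ∑_{i ≠ j} |T i j|`. -/
def glassoObjective {p : ℕ} (R : Matrix (Fin p) (Fin p) ℝ) (lam : ℝ)
    (T : Matrix (Fin p) (Fin p) ℝ) : ℝ :=
  -Real.log T.det + (T * R).trace + lam * offL1 T

/-- `T` minimizes the graphical lasso objective over the positive definite matrices. -/
def IsGraphicalLasso {p : ℕ} (R : Matrix (Fin p) (Fin p) ℝ) (lam : ℝ)
    (T : Matrix (Fin p) (Fin p) ℝ) : Prop :=
  T.PosDef ∧ IsMinOn (glassoObjective R lam) {T' | T'.PosDef} T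

/-! ### Error level and failure probability -/

/-- The error level `τ_∞`, with one constant `C` in front of all its terms. -/
def tauInf (C : ℝ) {p : ℕ} (d n : ℕ) (Sig : Matrix (Fin p) (Fin p) ℝ) (σ : ℝ) : ℝ :=
  C * (Real.sqrt (Real.log p / d) * maxColNorm Sig
    + Real.log p / d * (1 + (p : ℝ) / d) * offFrobenius Sig
    + Real.sqrt p * Real.log p / Real.sqrt ((n : ℝ) * d)
    + (p : ℝ) * Real.sqrt (Real.log p) ^ 3 / (Real.sqrt n * d) * (1 + (p : ℝ) / d)
    + Real.sqrt ((p : ℝ) * Real.log p) / d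
    + (p : ℝ) * Real.sqrt (Real.log p) / Real.sqrt d ^ 3
    + Real.sqrt (Real.log p / n)
    + σ ^ 2 * (1 + Real.sqrt (Real.log p / d)) * Real.sqrt (Real.log p / d)
        * (1 + max (Real.sqrt ((d : ℝ) / n)) ((d : ℝ) / n)))

/-- `a₀ p⁻¹ + a₁ p² e^{-a₂ d} + a₃ p² e^{-a₄ p}`. -/
def failureBound (a₀ a₁ a₂ a₃ a₄ : ℝ) (p d : ℕ) : ℝ :=
  a₀ / p + a₁ * (p : ℝ) ^ 2 * Real.exp (-a₂ * d) + a₃ * (p : ℝ) ^ 2 * Real.exp (-a₄ * p)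

/-- `2 κ_Γ (1 + 8/θ) τ`, the error bound of the estimate of the precision matrix. -/
def precError {p : ℕ} (Sig : Matrix (Fin p) (Fin p) ℝ) (θ τ : ℝ) : ℝ :=
  2 * kappaGamma Sig * (1 + 8 / θ) * τ

end IndirectGGM

end

namespace IndirectGGM

/-! ### The logarithm of the determinant -/

/-! The proof separates a deterministic statement about the graphical lasso from an entrywise
concentration bound for the covariance estimator `R`.

Deterministic part (`exists_glasso_of_abs_sub_le`). Suppose every entry of `R - Sig` is at most
`τ/2`. This is the primal-dual witness method. Let `T` minimize the objective among positive
definite matrices supported in `S`. Stationarity on `S` (`stationary_of_isMinOn_support`) puts `T⁻¹`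
within `τ/2 + lam` of `Sig` there. Since `Γ_SS` is the derivative of inversion restricted to `S`, up
to sign, a contraction argument (`exists_perturbation_inv_eq`) yields a small symmetric `Δ`
supported in `S` such that `(Sig⁻¹ + Δ)⁻¹` and `T⁻¹` agree on `S`. Inversion is strictly monotone,
by strict concavity of `log det`, so `T = Sig⁻¹ + Δ`; this is the entrywise error bound. Off `S`,
irrepresentability and the quadratic size of the Taylor remainder of the inverse give the missing
optimality conditions, and convexity makes `T` the unique unrestricted minimizer
(`isGraphicalLasso_iff_of_stationary`).

Probabilistic part (`IsSensingModel.measure_covEstimator_error_le`). Let `a_i` be the columns of `A`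
and `G = AᵀA`. Up to the factor `d/(d+1)`, an off-diagonal entry of `R` is the empirical mean of
`⟨a_i, Y⟩⟨a_j, Y⟩`. By polarization it is a difference of second moments in the directions `a_i ±
a_j`. Conditionally on `A` these are multiples of chi-square variables, concentrated around their
means. The conditional mean of the product is `G_i Sig G_j + σ² G_ij`, and it remains to compare
this with `Sig_ij` (`IsGoodGram.abs_form_sub_le`). Separating the indices `i, j` from the others
leaves the main term `G_ii G_jj Sig_ij`, terms linear in the other entries of the rows `G_i` and
`G_j`, and one bilinear form in both rows. Given column `i`, the linear terms are Gaussian. In the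
bilinear form `a_j` is replaced by its component orthogonal to `a_i`: given both columns, the inner
products of the remaining columns with `a_i` and with that component are independent, so the form is
again conditionally a linear Gaussian form (`measure_gram_bilinear_le`). Union bounds finish this
part.

For the second statement, each term of `τ_∞` is estimated in powers of `z = p^{1/10}`
(`tauInf_le_of_orders`). With `d` and `n` of the stated orders `τ_∞` becomes as small as desired, so
the conditions of the first statement and the signal bound hold. -/

theorem exists_transpose_mul_self {ι : Type*} [Fintype ι] [DecidableEq ι] {M : Matrix ι ι ℝ}
    (hM : M.PosSemidef) : ∃ B : Matrix ι ι ℝ, M = Bᵀ * B := by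
  open scoped MatrixOrder Matrix.Norms.L2Operator in
  obtain ⟨B, hB⟩ := CStarAlgebra.nonneg_iff_eq_star_mul_self.mp hM.nonneg
  exact ⟨B, by simpa [star_eq_conjTranspose, conjTranspose_eq_transpose_of_trivial] using hB⟩

theorem log_det_eq_sum {ι : Type*} [Fintype ι] [DecidableEq ι] {M : Matrix ι ι ℝ}
    (hM : M.PosDef) : Real.log M.det = ∑ i, Real.log (hM.1.eigenvalues i) := by
  rw [hM.1.det_eq_prod_eigenvalues]
  simp only [RCLike.ofReal_real_eq_id, id_eq]
  exact Real.log_prod fun i _ => (hM.eigenvalues_pos i).ne'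

theorem trace_eq_sum {ι : Type*} [Fintype ι] [DecidableEq ι] {M : Matrix ι ι ℝ}
    (hM : M.IsHermitian) : M.trace = ∑ i, hM.eigenvalues i := by
  rw [hM.trace_eq_sum_eigenvalues]; simp

theorem log_det_le_trace_sub_card {ι : Type*} [Fintype ι] [DecidableEq ι] {M : Matrix ι ι ℝ}
    (hM : M.PosDef) : Real.log M.det ≤ M.trace - Fintype.card ι := by
  rw [log_det_eq_sum hM, trace_eq_sum hM.1]
  calc ∑ i, Real.log (hM.1.eigenvalues i) ≤ ∑ i, (hM.1.eigenvalues i - 1) :=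
        Finset.sum_le_sum fun i _ => Real.log_le_sub_one_of_pos (hM.eigenvalues_pos i)
    _ = _ := by simp

/-- Equality in `log x ≤ x - 1` holds only at `x = 1`, so every eigenvalue is one and the spectral
theorem gives the identity. -/
theorem eq_one_of_log_det_eq {ι : Type*} [Fintype ι] [DecidableEq ι] {M : Matrix ι ι ℝ}
    (hM : M.PosDef) (h : M.trace - Fintype.card ι ≤ Real.log M.det) : M = 1 := by
  have hev : ∀ i, hM.1.eigenvalues i = 1 := by
    by_contra! hne
    obtain ⟨i, hi⟩ := hne
    have : ∑ i, Real.log (hM.1.eigenvalues i) < ∑ i, (hM.1.eigenvalues i - 1) :=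
      Finset.sum_lt_sum
        (fun i _ => Real.log_le_sub_one_of_pos (hM.eigenvalues_pos i))
        ⟨i, Finset.mem_univ i, Real.log_lt_sub_one_of_pos (hM.eigenvalues_pos i) hi⟩
    rw [log_det_eq_sum hM, trace_eq_sum hM.1] at h
    simp at this
    linarith
  have hs := hM.1.spectral_theorem
  have hd : diagonal (RCLike.ofReal ∘ hM.1.eigenvalues : ι → ℝ) = 1 := by
    rw [← diagonal_one]; congr 1; ext i; simp [hev i]
  rw [hd, map_one] at hs
  exact hs

/-- Concavity of `log det` at a positive definite matrix, in tangent form. -/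
theorem log_det_sub_le {ι : Type*} [Fintype ι] [DecidableEq ι] {A B : Matrix ι ι ℝ}
    (hA : A.PosDef) (hB : B.PosDef) :
    Real.log B.det - Real.log A.det ≤ (A⁻¹ * B).trace - Fintype.card ι ∧
      ((A⁻¹ * B).trace - Fintype.card ι ≤ Real.log B.det - Real.log A.det → B = A) := by
  obtain ⟨C, hC⟩ := exists_transpose_mul_self hA.inv.posSemidef
  have hdet : A.det ≠ 0 := hA.det_pos.ne'
  have hAu : IsUnit A.det := isUnit_iff_ne_zero.mpr hdet
  have hCdet : C.det * C.det * A.det = 1 := by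
    have := congrArg det hC
    rw [det_mul, det_transpose, det_nonsing_inv, Ring.inverse_eq_inv'] at this
    rw [← this]; field_simp
  have hC0 : C.det ≠ 0 := by rintro h; simp [h] at hCdet
  have hCu : IsUnit C := (isUnit_iff_isUnit_det C).mpr (isUnit_iff_ne_zero.mpr hC0)
  -- Congruence by `C`, where `A⁻¹ = CᵀC`, reduces the inequality to the tangent at the identity.
  have hM : (C * B * Cᵀ).PosDef := by
    have := hB.mul_mul_conjTranspose_same (B := C) (vecMul_injective_of_isUnit hCu)
    simpa [conjTranspose_eq_transpose_of_trivial] using this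
  have htr : (C * B * Cᵀ).trace = (A⁻¹ * B).trace := by
    rw [hC, trace_mul_comm, ← Matrix.mul_assoc]
  have hlog : Real.log (C * B * Cᵀ).det = Real.log B.det - Real.log A.det := by
    rw [← Real.log_div hB.det_pos.ne' hdet]
    congr 1
    rw [det_mul, det_mul, det_transpose]
    field_simp
    linear_combination B.det * hCdet
  constructor
  · rw [← hlog, ← htr]; exact log_det_le_trace_sub_card hM
  · rw [← hlog, ← htr]
    intro h
    have h1 := eq_one_of_log_det_eq hM h
    have hCi : C * (B * Cᵀ) = 1 := by rw [← Matrix.mul_assoc]; exact h1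
    have h2 : B * Cᵀ * C = 1 := by rw [mul_eq_one_comm]; exact hCi
    rw [Matrix.mul_assoc, ← hC] at h2
    calc B = B * (A⁻¹ * A) := by rw [nonsing_inv_mul _ hAu, Matrix.mul_one]
      _ = A := by rw [← Matrix.mul_assoc, h2, Matrix.one_mul]

/-- Strict monotonicity of inversion. Adding the tangent inequalities at `A` and at `B` bounds this
trace from one side, and its vanishing forces equality in both. -/
theorem eq_of_trace_inv_sub_inv_mul_eq_zero {ι : Type*} [Fintype ι] [DecidableEq ι]
    {A B : Matrix ι ι ℝ} (hA : A.PosDef) (hB : B.PosDef)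
    (h : ((A⁻¹ - B⁻¹) * (A - B)).trace = 0) : A = B := by
  have hAu : IsUnit A.det := isUnit_iff_ne_zero.mpr hA.det_pos.ne'
  have hBu : IsUnit B.det := isUnit_iff_ne_zero.mpr hB.det_pos.ne'
  have h1 := log_det_sub_le hA hB
  have h2 := log_det_sub_le hB hA
  rw [Matrix.sub_mul, Matrix.mul_sub, Matrix.mul_sub, nonsing_inv_mul _ hAu,
    nonsing_inv_mul _ hBu] at h
  simp only [trace_sub, trace_one] at h
  exact h2.2 (by linarith [h1.1])

/-! ### Existence and optimality conditions for the graphical lasso -/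

theorem abs_apply_le_trace {ι : Type*} [Fintype ι] [DecidableEq ι] {N : Matrix ι ι ℝ}
    (hN : N.PosSemidef) (i j : ι) : |N i j| ≤ N.trace := by
  obtain ⟨B, rfl⟩ := exists_transpose_mul_self hN
  have hdiag : ∀ k, (Bᵀ * B) k k ≤ (Bᵀ * B).trace := fun k =>
    Finset.single_le_sum (f := fun k => (Bᵀ * B) k k) (fun l _ => hN.diag_nonneg)
      (Finset.mem_univ k)
  have h : |(Bᵀ * B) i j| ≤ ((Bᵀ * B) i i + (Bᵀ * B) j j) / 2 := by
    simp only [mul_apply, transpose_apply]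
    rw [← Finset.sum_add_distrib, Finset.sum_div]
    refine (Finset.abs_sum_le_sum_abs _ _).trans (Finset.sum_le_sum fun k _ => ?_)
    rw [abs_le]
    constructor <;> nlinarith [sq_nonneg (B k i - B k j), sq_nonneg (B k i + B k j)]
  linarith [hdiag i, hdiag j]

theorem isClosed_posSemidef {ι : Type*} [Fintype ι] :
    IsClosed {N : Matrix ι ι ℝ | N.PosSemidef} := by
  have : {N : Matrix ι ι ℝ | N.PosSemidef} =
      {N | Nᵀ = N} ∩ ⋂ x : ι → ℝ, {N | 0 ≤ x ⬝ᵥ (N *ᵥ x)} := by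
    ext N
    simp only [Set.mem_ofPred_eq, Set.mem_inter_iff, Set.mem_iInter,
      posSemidef_iff_dotProduct_mulVec, IsHermitian, conjTranspose_eq_transpose_of_trivial,
      star_trivial]
  rw [this]
  refine IsClosed.inter (isClosed_eq (by fun_prop) (by fun_prop)) (isClosed_iInter fun x => ?_)
  exact isClosed_le (by fun_prop) (by fun_prop)

theorem isCompact_posSemidef_trace_le {ι : Type*} [Fintype ι] [DecidableEq ι] (b : ℝ) :
    IsCompact {N : Matrix ι ι ℝ | N.PosSemidef ∧ N.trace ≤ b} := by
  have hbox : IsCompact (Set.univ.pi fun _ : ι => Set.univ.pi fun _ : ι => Set.Icc (-b) b) :=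
    isCompact_univ_pi fun _ => isCompact_univ_pi fun _ => isCompact_Icc
  refine IsCompact.of_isClosed_subset hbox ?_ ?_
  · exact isClosed_posSemidef.inter (isClosed_le (f := fun N : Matrix ι ι ℝ => N.trace)
      (by fun_prop) continuous_const)
  · rintro N ⟨hN, hb⟩ i - j -
    exact abs_le.mp ((abs_apply_le_trace hN i j).trans hb)

theorem continuousOn_glassoObjective {p : ℕ} (R : Matrix (Fin p) (Fin p) ℝ) (lam : ℝ) :
    ContinuousOn (glassoObjective R lam) {T | 0 < T.det} := by
  unfold glassoObjective offL1 offPart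
  refine ContinuousOn.add (ContinuousOn.add ?_ (by fun_prop)) (Continuous.continuousOn ?_)
  · exact (ContinuousOn.log (by fun_prop) fun T hT => ne_of_gt hT).neg
  · refine continuous_const.mul
      (continuous_finsetSum _ fun i _ => continuous_finsetSum _ fun j _ => ?_)
    by_cases h : i = j <;> simp only [h, of_apply, if_true, if_false] <;> fun_prop

/-- Coercivity: by `hR` the objective dominates `-log det T + tr(T Sig)`, whose sublevel sets have
bounded trace against `Sig` and determinant bounded away from zero, hence are compact. The closed
constraint set `K` serves for the restriction to a support. -/
theorem exists_isMinOn_glassoObjective {p : ℕ} {Sig R : Matrix (Fin p) (Fin p) ℝ} {lam : ℝ}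
    (hSig : Sig.PosDef)
    (hR : ∀ T : Matrix (Fin p) (Fin p) ℝ, T.PosDef →
      (T * Sig).trace ≤ (T * R).trace + lam * offL1 T)
    {K : Set (Matrix (Fin p) (Fin p) ℝ)} (hK : IsClosed K) (hne : ∃ T ∈ K, T.PosDef) :
    ∃ T ∈ K, T.PosDef ∧
      ∀ T' ∈ K, T'.PosDef → glassoObjective R lam T ≤ glassoObjective R lam T' := by
  obtain ⟨T₀, hT₀K, hT₀⟩ := hne
  obtain ⟨B, hB⟩ := exists_transpose_mul_self hSig.posSemidef
  set f := glassoObjective R lam with hf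
  have hBdet : B.det ≠ 0 := by
    intro h
    have := hSig.det_pos
    rw [hB, det_mul, h] at this
    simp at this
  have hBu : IsUnit B.det := isUnit_iff_ne_zero.mpr hBdet
  have hBtu : IsUnit Bᵀ.det := by rwa [det_transpose]
  have hlow : ∀ T : Matrix (Fin p) (Fin p) ℝ, T.PosDef →
      -Real.log T.det + (T * Sig).trace ≤ f T := fun T hT => by
    have := hR T hT
    simp only [hf, glassoObjective]; linarith
  -- The tangent to `log det` at `2 Sig⁻¹` costs only half of `tr(T Sig)`; the other half remains to
  -- bound `T`.
  set A : Matrix (Fin p) (Fin p) ℝ := (2⁻¹ : ℝ) • Sig with hA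
  have hApd : A.PosDef := hSig.smul (by norm_num)
  have hhalf : ∀ T : Matrix (Fin p) (Fin p) ℝ, T.PosDef →
      Real.log T.det ≤ Real.log (A⁻¹).det + (T * Sig).trace / 2 := fun T hT => by
    have := (log_det_sub_le hApd.inv hT).1
    rw [nonsing_inv_nonsing_inv _ (isUnit_iff_ne_zero.mpr hApd.det_pos.ne'), trace_mul_comm,
      hA, mul_smul_comm, trace_smul, smul_eq_mul] at this
    have hp : (0 : ℝ) ≤ (Fintype.card (Fin p) : ℝ) := by positivity
    rw [hA]
    linarith
  have hconj : ∀ T : Matrix (Fin p) (Fin p) ℝ, (B * T * Bᵀ).trace = (T * Sig).trace := fun T => by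
    rw [hB, Matrix.mul_assoc, trace_mul_comm, Matrix.mul_assoc]
  set b := 2 * (f T₀ + Real.log (A⁻¹).det) with hb
  -- Conjugation by `B` turns `tr(T Sig)` into a plain trace. The lower bound on the determinant
  -- keeps the closed set inside the region where the objective is continuous.
  set D : Set (Matrix (Fin p) (Fin p) ℝ) :=
    (fun N => B⁻¹ * N * (Bᵀ)⁻¹) '' {N | N.PosSemidef ∧ N.trace ≤ b}
      ∩ (K ∩ {T | Real.exp (-f T₀) ≤ T.det}) with hD
  have hDc : IsCompact D := by
    refine IsCompact.inter_right ((isCompact_posSemidef_trace_le b).image (by fun_prop)) ?_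
    exact hK.inter (isClosed_le continuous_const (by fun_prop))
  have hmem : ∀ T ∈ K, T.PosDef → f T ≤ f T₀ → T ∈ D := by
    intro T hTK hT hle
    have h1 := hlow T hT
    have h2 := hhalf T hT
    have hpsd : (B * T * Bᵀ).PosSemidef := by
      simpa [conjTranspose_eq_transpose_of_trivial] using
        hT.posSemidef.mul_mul_conjTranspose_same B
    refine ⟨⟨B * T * Bᵀ, ⟨hpsd, ?_⟩, ?_⟩, hTK, ?_⟩
    · rw [hconj]; rw [hb]; linarith
    · calc B⁻¹ * (B * T * Bᵀ) * (Bᵀ)⁻¹ = (B⁻¹ * B) * T * (Bᵀ * (Bᵀ)⁻¹) := by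
            simp only [Matrix.mul_assoc]
        _ = T := by rw [nonsing_inv_mul _ hBu, mul_nonsing_inv _ hBtu]; simp
    · have h0 : 0 ≤ (T * Sig).trace := by rw [← hconj]; exact hpsd.trace_nonneg
      rw [Set.mem_ofPred_eq, ← Real.le_log_iff_exp_le hT.det_pos]
      linarith
  obtain ⟨T, hTD, hTmin⟩ := hDc.exists_isMinOn ⟨T₀, hmem T₀ hT₀K hT₀ le_rfl⟩
    ((continuousOn_glassoObjective R lam).mono fun T hT =>
      lt_of_lt_of_le (Real.exp_pos _) hT.2.2)
  have hTdet : 0 < T.det := lt_of_lt_of_le (Real.exp_pos _) hTD.2.2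
  have hTpd : T.PosDef := by
    obtain ⟨⟨N, ⟨hN, -⟩, hNT⟩, -⟩ := hTD
    have hps : T.PosSemidef := by
      have := hN.mul_mul_conjTranspose_same B⁻¹
      rw [conjTranspose_eq_transpose_of_trivial, transpose_nonsing_inv] at this
      rw [← hNT]; exact this
    exact (hps.posDef_iff_isUnit).mpr
      ((isUnit_iff_isUnit_det T).mpr (isUnit_iff_ne_zero.mpr hTdet.ne'))
  refine ⟨T, hTD.2.1, hTpd, fun T' hT'K hT' => ?_⟩
  rcases le_or_gt (f T') (f T₀) with h | h
  · exact hTmin (hmem T' hT'K hT' h)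
  · exact (hTmin (hmem T₀ hT₀K hT₀ le_rfl)).trans h.le

/-- First order condition at a minimum for a smooth term plus a weighted absolute value, in a form
that needs only continuity of `G` and no derivative. The two conclusions encode a subgradient: `-G
0` lies in `[-w, w]`, and equals `w · sign a` when `a ≠ 0`. -/
theorem abs_le_and_mul_le_of_eventually_nonneg {G : ℝ → ℝ} (hG : ContinuousAt G 0) {w a : ℝ}
    (hw : 0 ≤ w) (h : ∀ᶠ t in nhds 0, 0 ≤ t * G t + w * (|a + t| - |a|)) :
    |G 0| ≤ w ∧ a * G 0 ≤ -(w * |a|) := by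
  have key : ∀ s : ℝ, ∀ c : ℝ, (∀ᶠ t in nhdsWithin (0 : ℝ) (Set.Ioi 0), |a + t * s| - |a| ≤ t * c) →
      0 ≤ s * G 0 + w * c := by
    intro s c hc
    have ht : Filter.Tendsto (fun t : ℝ => t * s) (nhdsWithin 0 (Set.Ioi 0)) (nhds 0) := by
      have : Filter.Tendsto (fun t : ℝ => t * s) (nhds 0) (nhds (0 * s)) :=
        (continuous_id.mul continuous_const).tendsto 0
      rw [zero_mul] at this
      exact this.mono_left nhdsWithin_le_nhds
    have hlim : Filter.Tendsto (fun t : ℝ => s * G (t * s) + w * c) (nhdsWithin 0 (Set.Ioi 0))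
        (nhds (s * G 0 + w * c)) :=
      ((hG.tendsto.comp ht).const_mul s).add_const _
    refine ge_of_tendsto hlim ?_
    filter_upwards [ht.eventually h, hc, self_mem_nhdsWithin] with t h1 h2 h3
    have h3 : 0 < t := h3
    have h4 := mul_le_mul_of_nonneg_left h2 hw
    have : 0 ≤ t * (s * G (t * s) + w * c) := by nlinarith
    exact nonneg_of_mul_nonneg_right this h3
  have hbase : ∀ s : ℝ, |s| = 1 → ∀ᶠ t in nhdsWithin (0 : ℝ) (Set.Ioi 0),
      |a + t * s| - |a| ≤ t * 1 := by
    intro s hs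
    filter_upwards [self_mem_nhdsWithin] with t ht
    have ht : 0 < t := ht
    have := abs_add_le a (t * s)
    rw [abs_mul, hs, abs_of_pos ht] at this
    linarith
  have h1 := key 1 1 (hbase 1 (by simp))
  have h2 := key (-1) 1 (hbase (-1) (by simp))
  refine ⟨abs_le.mpr ⟨by linarith, by linarith⟩, ?_⟩
  -- Moving from `a` toward zero lowers the penalty at rate exactly `|a|`.
  have h3 := key (-a) (-|a|) (by
    filter_upwards [Ioo_mem_nhdsGT (show (0 : ℝ) < 1 by norm_num)] with t ht
    have : a + t * -a = (1 - t) * a := by ring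
    rw [this, abs_mul, abs_of_nonneg (by linarith [ht.2])]
    linarith)
  linarith

theorem abs_dotProduct_mulVec_le {ι : Type*} [Fintype ι] (M : Matrix ι ι ℝ) (x : ι → ℝ) :
    |x ⬝ᵥ (M *ᵥ x)| ≤ (∑ i, ∑ j, |M i j|) * (x ⬝ᵥ x) := by
  have hx : ∀ i, x i ^ 2 ≤ x ⬝ᵥ x := fun i => by
    rw [dotProduct, sq]
    exact Finset.single_le_sum (f := fun i => x i * x i) (fun _ _ => mul_self_nonneg _)
      (Finset.mem_univ i)
  have hexp : x ⬝ᵥ (M *ᵥ x) = ∑ i, ∑ j, x i * (M i j * x j) := by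
    simp only [dotProduct, mulVec, Finset.mul_sum]
  rw [hexp, Finset.sum_mul]
  refine (Finset.abs_sum_le_sum_abs _ _).trans (Finset.sum_le_sum fun i _ => ?_)
  rw [Finset.sum_mul]
  refine (Finset.abs_sum_le_sum_abs _ _).trans (Finset.sum_le_sum fun j _ => ?_)
  have h : |x i| * |x j| ≤ x ⬝ᵥ x := by
    nlinarith [sq_nonneg (|x i| - |x j|), sq_abs (x i), sq_abs (x j), hx i, hx j]
  rw [abs_mul, abs_mul]
  calc |x i| * (|M i j| * |x j|) = |M i j| * (|x i| * |x j|) := by ring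
    _ ≤ |M i j| * x ⬝ᵥ x := mul_le_mul_of_nonneg_left h (abs_nonneg _)

theorem posDef_one_add_smul {ι : Type*} [Fintype ι] [DecidableEq ι] {M : Matrix ι ι ℝ}
    (hM : M.IsHermitian) {t : ℝ} (ht : |t| * ∑ i, ∑ j, |M i j| < 1) : (1 + t • M).PosDef := by
  refine PosDef.of_dotProduct_mulVec_pos ?_ fun x hx => ?_
  · exact (isHermitian_one).add (hM.smul (by simp [IsSelfAdjoint]))
  · have hxx : 0 < x ⬝ᵥ x := by simpa using dotProduct_self_star_pos_iff.mpr hx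
    have h1 := abs_dotProduct_mulVec_le M x
    have h2 : |t * (x ⬝ᵥ (M *ᵥ x))| ≤ |t| * ((∑ i, ∑ j, |M i j|) * (x ⬝ᵥ x)) := by
      rw [abs_mul]; exact mul_le_mul_of_nonneg_left h1 (abs_nonneg _)
    have h3 := (abs_le.mp h2).1
    rw [star_trivial, add_mulVec, one_mulVec, smul_mulVec, dotProduct_add, dotProduct_smul,
      smul_eq_mul]
    nlinarith

theorem eventually_posDef_add_smul {ι : Type*} [Fintype ι] [DecidableEq ι] {T H : Matrix ι ι ℝ}
    (hT : T.PosDef) (hH : H.IsHermitian) : ∀ᶠ t : ℝ in nhds 0, (T + t • H).PosDef := by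
  obtain ⟨B, hB⟩ := exists_transpose_mul_self hT.posSemidef
  have hBdet : B.det ≠ 0 := by
    intro h
    have := hT.det_pos
    rw [hB, det_mul, h] at this
    simp at this
  have hBu : IsUnit B.det := isUnit_iff_ne_zero.mpr hBdet
  have hBtu : IsUnit Bᵀ.det := by rwa [det_transpose]
  set M := (Bᵀ)⁻¹ * H * B⁻¹ with hM
  have hMh : M.IsHermitian := by
    have := isHermitian_conjTranspose_mul_mul B⁻¹ hH
    rwa [conjTranspose_eq_transpose_of_trivial, transpose_nonsing_inv] at this
  have hfac : ∀ t : ℝ, T + t • H = Bᵀ * (1 + t • M) * B := fun t => by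
    have : Bᵀ * M * B = (Bᵀ * (Bᵀ)⁻¹) * H * (B⁻¹ * B) := by simp only [hM, Matrix.mul_assoc]
    rw [mul_nonsing_inv _ hBtu, nonsing_inv_mul _ hBu, Matrix.one_mul, Matrix.mul_one] at this
    rw [Matrix.mul_add, Matrix.add_mul, Matrix.mul_one, ← hB, mul_smul_comm, smul_mul_assoc, this]
  have hev : ∀ᶠ t : ℝ in nhds 0, |t| * ∑ i, ∑ j, |M i j| < 1 := by
    have : ContinuousAt (fun t : ℝ => |t| * ∑ i, ∑ j, |M i j|) 0 := by fun_prop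
    exact this.eventually_lt continuousAt_const (by simp)
  filter_upwards [hev] with t ht
  rw [hfac]
  have := (posDef_one_add_smul hMh ht).conjTranspose_mul_mul_same (B := B)
    (mulVec_injective_of_isUnit ((isUnit_iff_isUnit_det B).mpr hBu))
  rwa [conjTranspose_eq_transpose_of_trivial] at this

/-- The weight of the entry `(i, j)` in the penalty of the graphical lasso. -/
noncomputable def penaltyWeight {p : ℕ} (lam : ℝ) (i j : Fin p) : ℝ := if i = j then 0 else lam

theorem penaltyWeight_nonneg {p : ℕ} {lam : ℝ} (h : 0 ≤ lam) (i j : Fin p) :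
    0 ≤ penaltyWeight lam i j := by
  unfold penaltyWeight; split_ifs <;> simp [h]

theorem mul_offL1_eq_sum {p : ℕ} (lam : ℝ) (T : Matrix (Fin p) (Fin p) ℝ) :
    lam * offL1 T = ∑ i, ∑ j, penaltyWeight lam i j * |T i j| := by
  simp only [offL1, Finset.mul_sum]
  refine Finset.sum_congr rfl fun i _ => Finset.sum_congr rfl fun j _ => ?_
  by_cases h : i = j <;> simp [offPart, penaltyWeight, h]

/-- Stationarity of a minimizer among the matrices supported in `S`, tested against a symmetric
perturbation of the entries `(i, j)` and `(j, i)`. -/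
theorem stationary_of_isMinOn_support {p : ℕ} {R T : Matrix (Fin p) (Fin p) ℝ} {lam : ℝ}
    (hlam : 0 ≤ lam) (hR : Rᵀ = R) {S : Set (Fin p × Fin p)}
    (hS : ∀ i j, (i, j) ∈ S → (j, i) ∈ S) (hT : T.PosDef) (hTS : ∀ i j, (i, j) ∉ S → T i j = 0)
    (hmin : ∀ T' : Matrix (Fin p) (Fin p) ℝ, (∀ i j, (i, j) ∉ S → T' i j = 0) → T'.PosDef →
      glassoObjective R lam T ≤ glassoObjective R lam T') {i j : Fin p} (hij : (i, j) ∈ S) :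
    |R i j - T⁻¹ i j| ≤ penaltyWeight lam i j ∧
      T i j * (R i j - T⁻¹ i j) ≤ -(penaltyWeight lam i j * |T i j|) := by
  set H : Matrix (Fin p) (Fin p) ℝ := single i j 1 + single j i 1 with hH
  have hHh : H.IsHermitian := by
    simp [IsHermitian, hH, conjTranspose_eq_transpose_of_trivial, add_comm]
  have hTsymm : ∀ k l, T k l = T l k := fun k l => by
    simpa using (hT.1.apply l k)
  have htrace : ∀ N : Matrix (Fin p) (Fin p) ℝ, Nᵀ = N → (N * H).trace = 2 * N i j := fun N hN => by
    have : N j i = N i j := congrFun (congrFun hN i) j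
    rw [hH, Matrix.mul_add, trace_add, trace_mul_single, trace_mul_single]
    simp [this]; ring
  have hcont : ContinuousAt (fun t : ℝ => R i j - (T + t • H)⁻¹ i j) 0 := by
    have h0 : ContinuousAt (fun M : Matrix (Fin p) (Fin p) ℝ => M⁻¹) (T + (0 : ℝ) • H) := by
      refine continuousAt_matrix_inv _ ?_
      rw [zero_smul, add_zero]
      have := NormedRing.inverse_continuousAt (hT.det_pos.ne'.isUnit.unit)
      simpa using this
    have h1 : ContinuousAt (fun t : ℝ => T + t • H) 0 := by fun_prop
    have h2 := ContinuousAt.comp (g := fun M : Matrix (Fin p) (Fin p) ℝ => M⁻¹)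
      (f := fun t : ℝ => T + t • H) h0 h1
    have h3 : Continuous (fun M : Matrix (Fin p) (Fin p) ℝ => M i j) := by fun_prop
    exact continuousAt_const.sub (h3.continuousAt.comp h2)
  have hpen : ∀ t : ℝ, lam * offL1 (T + t • H) - lam * offL1 T
      = 2 * (penaltyWeight lam i j * (|T i j + t| - |T i j|)) := by
    intro t
    rw [mul_offL1_eq_sum, mul_offL1_eq_sum, ← Finset.sum_sub_distrib]
    simp_rw [← Finset.sum_sub_distrib, ← mul_sub]
    by_cases hd : i = j
    · subst hd
      simp only [penaltyWeight, if_true, zero_mul, mul_zero]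
      refine Finset.sum_eq_zero fun k _ => Finset.sum_eq_zero fun l _ => ?_
      by_cases hkl : k = l
      · simp [hkl]
      · have : H k l = 0 := by
          rw [hH, Matrix.add_apply]
          have : ¬ (i = k ∧ i = l) := fun ⟨a, b⟩ => hkl (a.symm.trans b)
          simp [this]
        simp [this]
    · have hterm : ∀ k l, penaltyWeight lam k l * (|(T + t • H) k l| - |T k l|)
          = (if k = i then (if l = j then penaltyWeight lam i j * (|T i j + t| - |T i j|) else 0)
              else 0)
            + (if k = j then (if l = i then penaltyWeight lam i j * (|T i j + t| - |T i j|) else 0)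
              else 0) := by
        intro k l
        have hw : penaltyWeight lam j i = penaltyWeight lam i j := by
          simp [penaltyWeight, hd, Ne.symm hd]
        by_cases h1 : k = i
        · subst h1
          by_cases h2 : l = j
          · subst h2; simp [hH, hd, Ne.symm hd]
          · have : H k l = 0 := by simp [hH, Ne.symm h2, Ne.symm hd]
            simp [h2, hd, this]
        · by_cases h2 : k = j
          · subst h2
            by_cases h3 : l = i
            · subst h3
              simp [hH, h1, hd, hw, hTsymm k l]
            · have : H k l = 0 := by simp [hH, Ne.symm h3, hd]
              simp [h1, h3, this]
          · have : H k l = 0 := by simp [hH, Ne.symm h1, Ne.symm h2]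
            simp [h1, h2, this]
      simp_rw [hterm, Finset.sum_add_distrib]
      simp
      ring
  have hz : (T + (0 : ℝ) • H)⁻¹ = T⁻¹ := by simp
  have := abs_le_and_mul_le_of_eventually_nonneg hcont (penaltyWeight_nonneg hlam i j)
    (a := T i j) (by
    filter_upwards [eventually_posDef_add_smul hT hHh] with t ht
    have hsupp : ∀ k l, (k, l) ∉ S → (T + t • H) k l = 0 := by
      intro k l hkl
      have h1 : ¬ (i = k ∧ j = l) := by rintro ⟨rfl, rfl⟩; exact hkl hij
      have h2 : ¬ (j = k ∧ i = l) := by rintro ⟨rfl, rfl⟩; exact hkl (hS _ _ hij)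
      simp [hTS k l hkl, hH, h1, h2]
    have hle := hmin _ hsupp ht
    -- The tangent is taken at the perturbed matrix, not at `T`. The resulting inequality is exact
    -- in `t`, with the entry of the perturbed inverse in the role of `G t`, so continuity of
    -- inversion replaces differentiation.
    have htan := (log_det_sub_le ht hT).1
    have hu : IsUnit (T + t • H).det := isUnit_iff_ne_zero.mpr ht.det_pos.ne'
    have hNs : ((T + t • H)⁻¹)ᵀ = (T + t • H)⁻¹ := by
      have := ht.inv.1
      rwa [IsHermitian, conjTranspose_eq_transpose_of_trivial] at this
    have hTeq : (T + t • H)⁻¹ * T = 1 - t • ((T + t • H)⁻¹ * H) := by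
      rw [eq_sub_iff_add_eq, ← mul_smul_comm, ← Matrix.mul_add, nonsing_inv_mul _ hu]
    rw [hTeq, trace_sub, trace_one, trace_smul, htrace _ hNs, smul_eq_mul] at htan
    have hp := hpen t
    have hRt : ((T + t • H) * R).trace = (T * R).trace + t * (2 * R i j) := by
      rw [Matrix.add_mul, trace_add, smul_mul_assoc, trace_smul, trace_mul_comm H R, htrace _ hR,
        smul_eq_mul]
    simp only [glassoObjective] at hle
    rw [hRt] at hle
    linarith)
  simpa [hz] using this

/-- The optimality conditions single out the unique graphical lasso estimate. -/
theorem isGraphicalLasso_iff_of_stationary {p : ℕ} {R T : Matrix (Fin p) (Fin p) ℝ} {lam : ℝ}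
    (hR : Rᵀ = R) (hT : T.PosDef)
    (h : ∀ i j, |R i j - T⁻¹ i j| ≤ penaltyWeight lam i j ∧
      T i j * (R i j - T⁻¹ i j) ≤ -(penaltyWeight lam i j * |T i j|))
    (T' : Matrix (Fin p) (Fin p) ℝ) : IsGraphicalLasso R lam T' ↔ T' = T := by
  have key : ∀ T' : Matrix (Fin p) (Fin p) ℝ, T'.PosDef →
      glassoObjective R lam T ≤ glassoObjective R lam T' ∧
      (glassoObjective R lam T' ≤ glassoObjective R lam T → T' = T) := by
    intro T' hT'
    have hTu : IsUnit T.det := isUnit_iff_ne_zero.mpr hT.det_pos.ne'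
    have htan := log_det_sub_le hT hT'
    have hTs : (T⁻¹)ᵀ = T⁻¹ := by
      have := hT.inv.1
      rwa [IsHermitian, conjTranspose_eq_transpose_of_trivial] at this
    have hsum : 0 ≤ (T' * R).trace - (T * R).trace - (T⁻¹ * T').trace + Fintype.card (Fin p)
        + (lam * offL1 T' - lam * offL1 T) := by
      have h1 : (T' * R).trace - (T * R).trace - (T⁻¹ * T').trace + Fintype.card (Fin p)
          = ((T' - T) * (R - T⁻¹)).trace := by
        rw [Matrix.sub_mul, Matrix.mul_sub, Matrix.mul_sub, mul_nonsing_inv _ hTu,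
          trace_mul_comm T⁻¹ T']
        simp only [trace_sub, trace_one]; ring
      have h2 : ((T' - T) * (R - T⁻¹)).trace
          = ∑ i, ∑ j, (T' i j - T i j) * (R i j - T⁻¹ i j) := by
        simp only [trace, diag_apply, mul_apply, Matrix.sub_apply]
        refine Finset.sum_congr rfl fun i _ => Finset.sum_congr rfl fun j _ => ?_
        have e1 : R j i = R i j := congrFun (congrFun hR i) j
        have e2 : T⁻¹ j i = T⁻¹ i j := congrFun (congrFun hTs i) j
        rw [e1, e2]
      rw [h1, h2, mul_offL1_eq_sum, mul_offL1_eq_sum, ← Finset.sum_sub_distrib,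
        ← Finset.sum_add_distrib]
      refine Finset.sum_nonneg fun i _ => ?_
      rw [← Finset.sum_sub_distrib, ← Finset.sum_add_distrib]
      refine Finset.sum_nonneg fun j _ => ?_
      obtain ⟨ha, hb⟩ := h i j
      have hc : |T' i j * (R i j - T⁻¹ i j)| ≤ penaltyWeight lam i j * |T' i j| := by
        rw [abs_mul, mul_comm]
        exact mul_le_mul_of_nonneg_right ha (abs_nonneg _)
      have := (abs_le.mp hc).1
      linarith
    constructor
    · have := htan.1
      simp only [glassoObjective]; linarith
    · intro hle
      refine htan.2 ?_
      simp only [glassoObjective] at hle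
      linarith
  constructor
  · rintro ⟨hT', hmin⟩
    exact (key T' hT').2 (hmin hT)
  · rintro rfl
    exact ⟨hT, fun U hU => (key U hU).1⟩

/-! ### Row sums -/

theorem sum_abs_le_maxRowSum {ι : Type*} [Fintype ι] (M : Matrix ι ι ℝ) (i : ι) :
    ∑ j, |M i j| ≤ maxRowSum M :=
  le_ciSup (f := fun i => ∑ j, |M i j|) (Set.finite_range _).bddAbove i

theorem sum_abs_mul_le {ι : Type*} [Fintype ι] {A B : Matrix ι ι ℝ} {a b : ℝ} (hb : 0 ≤ b)
    (hA : ∀ i, ∑ j, |A i j| ≤ a) (hB : ∀ i, ∑ j, |B i j| ≤ b) (i : ι) :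
    ∑ j, |(A * B) i j| ≤ a * b := by
  calc ∑ j, |(A * B) i j| ≤ ∑ j, ∑ k, |A i k| * |B k j| := by
        refine Finset.sum_le_sum fun j _ => ?_
        rw [mul_apply]
        refine (Finset.abs_sum_le_sum_abs _ _).trans_eq ?_
        exact Finset.sum_congr rfl fun k _ => abs_mul _ _
    _ = ∑ k, |A i k| * ∑ j, |B k j| := by
        rw [Finset.sum_comm]; simp_rw [Finset.mul_sum]
    _ ≤ ∑ k, |A i k| * b :=
        Finset.sum_le_sum fun k _ => mul_le_mul_of_nonneg_left (hB k) (abs_nonneg _)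
    _ ≤ a * b := by rw [← Finset.sum_mul]; exact mul_le_mul_of_nonneg_right (hA i) hb

theorem abs_mul_mul_apply_le {ι : Type*} [Fintype ι] {A H B : Matrix ι ι ℝ} {a b h : ℝ}
    (hh : 0 ≤ h) (ha : 0 ≤ a)
    (hA : ∀ i, ∑ j, |A i j| ≤ a) (hH : ∀ i j, |H i j| ≤ h) (hB : ∀ j, ∑ i, |B i j| ≤ b)
    (i j : ι) : |(A * H * B) i j| ≤ a * h * b := by
  have hAH : ∀ l, |(A * H) i l| ≤ a * h := fun l => by
    rw [mul_apply]
    calc |∑ k, A i k * H k l| ≤ ∑ k, |A i k| * h := by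
          refine (Finset.abs_sum_le_sum_abs _ _).trans (Finset.sum_le_sum fun k _ => ?_)
          rw [abs_mul]; exact mul_le_mul_of_nonneg_left (hH k l) (abs_nonneg _)
      _ ≤ a * h := by rw [← Finset.sum_mul]; exact mul_le_mul_of_nonneg_right (hA i) hh
  rw [mul_apply]
  calc |∑ l, (A * H) i l * B l j| ≤ ∑ l, a * h * |B l j| := by
        refine (Finset.abs_sum_le_sum_abs _ _).trans (Finset.sum_le_sum fun l _ => ?_)
        rw [abs_mul]; exact mul_le_mul_of_nonneg_right (hAH l) (abs_nonneg _)
    _ ≤ a * h * b := by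
        rw [← Finset.mul_sum]; exact mul_le_mul_of_nonneg_left (hB j) (by positivity)

theorem abs_mulVec_le {ι κ : Type*} [Fintype κ] {M : Matrix ι κ ℝ} {a h : ℝ} (hh : 0 ≤ h)
    (hM : ∀ i, ∑ j, |M i j| ≤ a) {x : κ → ℝ} (hx : ∀ j, |x j| ≤ h) (i : ι) :
    |(M *ᵥ x) i| ≤ a * h := by
  calc |∑ k, M i k * x k| ≤ ∑ k, |M i k| * h := by
        refine (Finset.abs_sum_le_sum_abs _ _).trans (Finset.sum_le_sum fun k _ => ?_)
        rw [abs_mul]; exact mul_le_mul_of_nonneg_left (hx k) (abs_nonneg _)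
    _ ≤ a * h := by rw [← Finset.sum_mul]; exact mul_le_mul_of_nonneg_right (hM i) hh

/-- Taking the largest row sum `b` of `N` in the equation gives `b ≤ a + b/3`, and the last term is
absorbed. -/
theorem sum_abs_le_of_eq_sub_mul {ι : Type*} [Fintype ι] {M E N : Matrix ι ι ℝ} {a : ℝ}
    (hN : N = M - E * N) (hM : ∀ i, ∑ j, |M i j| ≤ a) (hE : ∀ i, ∑ j, |E i j| ≤ 1 / 3)
    (i : ι) : ∑ j, |N i j| ≤ 3 / 2 * a := by
  set b := maxRowSum N with hb
  have hrow := sum_abs_le_maxRowSum N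
  have hb0 : 0 ≤ b := (Finset.sum_nonneg fun j _ => abs_nonneg _).trans (hrow i)
  have hle : b ≤ a + 1 / 3 * b := by
    have : Nonempty ι := ⟨i⟩
    refine ciSup_le fun k => ?_
    calc ∑ j, |N k j| = ∑ j, |M k j - (E * N) k j| := by
          conv_lhs => rw [hN]
          rfl
      _ ≤ ∑ j, (|M k j| + |(E * N) k j|) := Finset.sum_le_sum fun j _ => abs_sub _ _
      _ ≤ a + 1 / 3 * b := by
          rw [Finset.sum_add_distrib]
          exact add_le_add (hM k) (sum_abs_mul_le hb0 hE hrow k)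
  linarith [hrow i]

/-- `Sig⁻¹ + D` is congruent to `1 + B D Bᵀ`. An eigenvector `v` of the latter gives the eigenvector
`Bᵀv` of the non-symmetric matrix `Sig * D`, with eigenvalue lowered by one. Row sums bound
eigenvalues in modulus, so those of `1 + B D Bᵀ` are at least `2/3`. -/
theorem posDef_inv_add {ι : Type*} [Fintype ι] [DecidableEq ι] {Sig D : Matrix ι ι ℝ}
    (hSig : Sig.PosDef) (hD : Dᵀ = D) (hE : ∀ i, ∑ j, |(Sig * D) i j| ≤ 1 / 3) :
    (Sig⁻¹ + D).PosDef := by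
  obtain ⟨B, hB⟩ := exists_transpose_mul_self hSig.posSemidef
  have hBdet : B.det ≠ 0 := by
    intro h
    have := hSig.det_pos
    rw [hB, det_mul, h] at this
    simp at this
  have hBu : IsUnit B.det := isUnit_iff_ne_zero.mpr hBdet
  have hBtu : IsUnit Bᵀ.det := by rwa [det_transpose]
  have hMh : (1 + B * D * Bᵀ).IsHermitian := by
    have : D.IsHermitian := by rwa [IsHermitian, conjTranspose_eq_transpose_of_trivial]
    have := isHermitian_mul_mul_conjTranspose B this
    rw [conjTranspose_eq_transpose_of_trivial] at this
    exact isHermitian_one.add this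
  have hpd : (1 + B * D * Bᵀ).PosDef := by
    rw [hMh.posDef_iff_eigenvalues_pos]
    intro i
    set v : ι → ℝ := ⇑(hMh.eigenvectorBasis i) with hv
    set μ := hMh.eigenvalues i with hμ
    have hev : (1 + B * D * Bᵀ) *ᵥ v = μ • v := hMh.mulVec_eigenvectorBasis i
    have hv0 : v ≠ 0 := by
      intro h
      have h1 := hMh.eigenvectorBasis.orthonormal.1 i
      have h2 : hMh.eigenvectorBasis i = 0 := by ext k; exact congrFun h k
      rw [h2] at h1; simp at h1
    have hy0 : Bᵀ *ᵥ v ≠ 0 := by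
      intro h
      apply hv0
      have : (Bᵀ)⁻¹ *ᵥ (Bᵀ *ᵥ v) = v := by
        rw [mulVec_mulVec, nonsing_inv_mul _ hBtu, one_mulVec]
      rw [← this, h, mulVec_zero]
    have hSD : (Sig * D) *ᵥ (Bᵀ *ᵥ v) = (μ - 1) • (Bᵀ *ᵥ v) := by
      have h1 : Bᵀ *ᵥ ((1 + B * D * Bᵀ) *ᵥ v) = Bᵀ *ᵥ v + (Sig * D) *ᵥ (Bᵀ *ᵥ v) := by
        rw [hB, add_mulVec, one_mulVec, mulVec_add]
        simp only [mulVec_mulVec, Matrix.mul_assoc]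
      rw [hev, mulVec_smul] at h1
      rw [sub_smul, one_smul, h1]; abel
    obtain ⟨k, hk⟩ : ∃ k, (Bᵀ *ᵥ v) k ≠ 0 := by
      by_contra! h
      exact hy0 (funext h)
    have : Nonempty ι := ⟨k⟩
    obtain ⟨l, hl⟩ := Finite.exists_max (fun k => |(Bᵀ *ᵥ v) k|)
    have hpos : 0 < |(Bᵀ *ᵥ v) l| := lt_of_lt_of_le (abs_pos.mpr hk) (hl k)
    have h2 := abs_mulVec_le (abs_nonneg _) hE hl l
    rw [hSD, Pi.smul_apply, smul_eq_mul, abs_mul] at h2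
    have h3 := le_of_mul_le_mul_right h2 hpos
    linarith [(abs_le.mp h3).1]
  have hfac : Sig⁻¹ + D = B⁻¹ * (1 + B * D * Bᵀ) * (Bᵀ)⁻¹ := by
    have h1 : Sig⁻¹ = B⁻¹ * (Bᵀ)⁻¹ := by rw [hB, Matrix.mul_inv_rev]
    have h2 : B⁻¹ * (B * D * Bᵀ) * (Bᵀ)⁻¹ = (B⁻¹ * B) * D * (Bᵀ * (Bᵀ)⁻¹) := by
      simp only [Matrix.mul_assoc]
    rw [Matrix.mul_add, Matrix.add_mul, h2, nonsing_inv_mul _ hBu, mul_nonsing_inv _ hBtu, h1]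
    simp
  rw [hfac]
  have hinj : Function.Injective (B⁻¹).vecMul :=
    vecMul_injective_of_isUnit ((isUnit_iff_isUnit_det _).mpr (isUnit_nonsing_inv_det _ hBu))
  have := hpd.mul_mul_conjTranspose_same hinj
  rwa [conjTranspose_eq_transpose_of_trivial, transpose_nonsing_inv] at this

/-! ### The Taylor remainder of the matrix inverse -/

/-- The remainder of the first order expansion of `D ↦ (Sig⁻¹ + D)⁻¹` at zero. -/
noncomputable def invRemainder {ι : Type*} [Fintype ι] [DecidableEq ι] (Sig D : Matrix ι ι ℝ) :
    Matrix ι ι ℝ :=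
  (Sig⁻¹ + D)⁻¹ - Sig + Sig * D * Sig

/-- Symmetric perturbations whose row sums are at most `m`, with `m` small compared with the row
sums of `Sig`. -/
structure IsSmallPerturbation {ι : Type*} [Fintype ι] (Sig : Matrix ι ι ℝ) (k m : ℝ)
    (D : Matrix ι ι ℝ) : Prop where
  symm : Dᵀ = D
  row : ∀ i, ∑ j, |D i j| ≤ m
  rowSig : ∀ i, ∑ j, |Sig i j| ≤ k
  k_nonneg : 0 ≤ k
  m_nonneg : 0 ≤ m
  small : k * m ≤ 1 / 3

namespace IsSmallPerturbation

variable {ι : Type*} [Fintype ι] {Sig D D' : Matrix ι ι ℝ} {k m : ℝ}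

theorem row_mul (h : IsSmallPerturbation Sig k m D) (i : ι) : ∑ j, |(Sig * D) i j| ≤ k * m :=
  sum_abs_mul_le h.m_nonneg h.rowSig h.row i

theorem col_sig (h : IsSmallPerturbation Sig k m D) (hSig : Sig.PosDef) (j : ι) :
    ∑ i, |Sig i j| ≤ k := by
  refine le_of_eq_of_le (Finset.sum_congr rfl fun i _ => ?_) (h.rowSig j)
  rw [← hSig.1.apply j i]; simp

variable [DecidableEq ι]

theorem posDef (h : IsSmallPerturbation Sig k m D) (hSig : Sig.PosDef) : (Sig⁻¹ + D).PosDef :=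
  posDef_inv_add hSig h.symm fun i => (h.row_mul i).trans h.small

theorem inv_eq (h : IsSmallPerturbation Sig k m D) (hSig : Sig.PosDef) :
    (Sig⁻¹ + D)⁻¹ = Sig - Sig * D * (Sig⁻¹ + D)⁻¹ := by
  have hu : IsUnit (Sig⁻¹ + D).det := isUnit_iff_ne_zero.mpr (h.posDef hSig).det_pos.ne'
  have hSu : IsUnit Sig.det := isUnit_iff_ne_zero.mpr hSig.det_pos.ne'
  have h1 : Sig * ((Sig⁻¹ + D) * (Sig⁻¹ + D)⁻¹) = Sig := by
    rw [mul_nonsing_inv _ hu, Matrix.mul_one]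
  rw [Matrix.add_mul, Matrix.mul_add, ← Matrix.mul_assoc, mul_nonsing_inv _ hSu, Matrix.one_mul,
    ← Matrix.mul_assoc] at h1
  exact eq_sub_of_add_eq h1

theorem row_inv (h : IsSmallPerturbation Sig k m D) (hSig : Sig.PosDef) (i : ι) :
    ∑ j, |(Sig⁻¹ + D)⁻¹ i j| ≤ 3 / 2 * k :=
  sum_abs_le_of_eq_sub_mul (h.inv_eq hSig) h.rowSig (fun i => (h.row_mul i).trans h.small) i

theorem inv_symm (h : IsSmallPerturbation Sig k m D) (hSig : Sig.PosDef) :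
    ((Sig⁻¹ + D)⁻¹)ᵀ = (Sig⁻¹ + D)⁻¹ := by
  have := (h.posDef hSig).inv.1
  rwa [IsHermitian, conjTranspose_eq_transpose_of_trivial] at this

theorem row_sub_inv (h : IsSmallPerturbation Sig k m D) (hSig : Sig.PosDef) (i : ι) :
    ∑ j, |(Sig - (Sig⁻¹ + D)⁻¹) i j| ≤ k * m * (3 / 2 * k) := by
  have : Sig - (Sig⁻¹ + D)⁻¹ = Sig * D * (Sig⁻¹ + D)⁻¹ := by
    conv_lhs => rw [h.inv_eq hSig]
    rw [sub_sub_cancel]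
  rw [this]
  exact sum_abs_mul_le (by linarith [h.k_nonneg]) h.row_mul (h.row_inv hSig) i

theorem col_sub_inv (h : IsSmallPerturbation Sig k m D) (hSig : Sig.PosDef) (j : ι) :
    ∑ i, |(Sig - (Sig⁻¹ + D)⁻¹) i j| ≤ k * m * (3 / 2 * k) := by
  refine le_of_eq_of_le (Finset.sum_congr rfl fun i _ => ?_) (h.row_sub_inv hSig j)
  have hs : Sigᵀ = Sig := by
    have := hSig.1
    rwa [IsHermitian, conjTranspose_eq_transpose_of_trivial] at this
  have : (Sig - (Sig⁻¹ + D)⁻¹)ᵀ = Sig - (Sig⁻¹ + D)⁻¹ := by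
    rw [transpose_sub, hs, h.inv_symm hSig]
  rw [← congrFun (congrFun this j) i, transpose_apply]

/-- This form shows that the remainder is quadratic: the last factor is itself of the order of `D`.
-/
theorem invRemainder_eq (h : IsSmallPerturbation Sig k m D) (hSig : Sig.PosDef) :
    invRemainder Sig D = Sig * D * (Sig - (Sig⁻¹ + D)⁻¹) := by
  rw [invRemainder, Matrix.mul_sub]
  conv_lhs => rw [h.inv_eq hSig]
  abel

theorem abs_invRemainder_le (h : IsSmallPerturbation Sig k m D) (hSig : Sig.PosDef) {r : ℝ}
    (hr : 0 ≤ r) (hD : ∀ i j, |D i j| ≤ r) (i j : ι) :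
    |invRemainder Sig D i j| ≤ 3 / 2 * k ^ 3 * m * r := by
  rw [h.invRemainder_eq hSig]
  calc _ ≤ k * r * (k * m * (3 / 2 * k)) :=
        abs_mul_mul_apply_le hr h.k_nonneg h.rowSig hD (h.col_sub_inv hSig) i j
    _ = _ := by ring

theorem abs_invRemainder_sub_le (h : IsSmallPerturbation Sig k m D)
    (h' : IsSmallPerturbation Sig k m D') (hSig : Sig.PosDef) {r : ℝ} (hr : 0 ≤ r)
    (hD : ∀ i j, |D i j - D' i j| ≤ r) (i j : ι) :
    |invRemainder Sig D i j - invRemainder Sig D' i j| ≤ 15 / 4 * k ^ 3 * m * r := by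
  set N := (Sig⁻¹ + D)⁻¹ with hN
  set N' := (Sig⁻¹ + D')⁻¹ with hN'
  have hu : IsUnit (Sig⁻¹ + D).det := isUnit_iff_ne_zero.mpr (h.posDef hSig).det_pos.ne'
  have hu' : IsUnit (Sig⁻¹ + D').det := isUnit_iff_ne_zero.mpr (h'.posDef hSig).det_pos.ne'
  have hdiff : N - N' = -(N * (D - D') * N') := by
    have e1 : N * (Sig⁻¹ + D) = 1 := nonsing_inv_mul _ hu
    have e2 : (Sig⁻¹ + D') * N' = 1 := mul_nonsing_inv _ hu'
    have : N * (D - D') * N' = N * (Sig⁻¹ + D) * N' - N * ((Sig⁻¹ + D') * N') := by noncomm_ring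
    rw [this, e1, e2]; simp
  -- Each summand has one factor `D - D'` and one small factor. Their contributions `3/2` and `9/4`
  -- add up to `15/4`.
  have hEq : invRemainder Sig D - invRemainder Sig D'
      = (Sig - N) * (D - D') * Sig + N * (D - D') * (Sig - N') := by
    have : invRemainder Sig D - invRemainder Sig D' = N - N' + Sig * (D - D') * Sig := by
      rw [invRemainder, invRemainder, ← hN, ← hN']; noncomm_ring
    rw [this, hdiff]; noncomm_ring
  have hk := h.k_nonneg
  have hm := h.m_nonneg
  have b1 := abs_mul_mul_apply_le (H := D - D') hr (by positivity) (h.row_sub_inv hSig) hD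
    (h.col_sig hSig) i j
  have b2 := abs_mul_mul_apply_le (H := D - D') hr (by positivity) (h.row_inv hSig) hD
    (h'.col_sub_inv hSig) i j
  rw [← hN] at b1 b2
  rw [← hN'] at b2
  rw [← Matrix.sub_apply, hEq, Matrix.add_apply]
  calc _ ≤ _ := abs_add_le _ _
    _ ≤ _ := add_le_add b1 b2
    _ = _ := by ring

end IsSmallPerturbation

/-! ### Parameters of the model -/

theorem transpose_eq_of_posDef {ι : Type*} [Fintype ι] {M : Matrix ι ι ℝ} (h : M.PosDef) :
    Mᵀ = M := by
  have := h.1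
  rwa [IsHermitian, conjTranspose_eq_transpose_of_trivial] at this

theorem apply_comm_of_posDef {ι : Type*} [Fintype ι] {M : Matrix ι ι ℝ} (h : M.PosDef)
    (i j : ι) : M i j = M j i := congrFun (congrFun (transpose_eq_of_posDef h) j) i |>.symm ▸ rfl

theorem mem_precSupport_swap {p : ℕ} {Sig : Matrix (Fin p) (Fin p) ℝ} (hSig : Sig.PosDef)
    {i j : Fin p} (h : (i, j) ∈ precSupport Sig) : (j, i) ∈ precSupport Sig := by
  have : Sig⁻¹ j i = Sig⁻¹ i j := apply_comm_of_posDef hSig.inv j i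
  change Sig⁻¹ j i ≠ 0
  rw [this]; exact h

theorem diag_mem_precSupport {p : ℕ} {Sig : Matrix (Fin p) (Fin p) ℝ} (hSig : Sig.PosDef)
    (i : Fin p) : (i, i) ∈ precSupport Sig :=
  (hSig.inv.diag_pos (i := i)).ne'

theorem ncard_row_le_maxDeg {p : ℕ} {Sig : Matrix (Fin p) (Fin p) ℝ} (hSig : Sig.PosDef)
    (i : Fin p) : Set.ncard {j : Fin p | (i, j) ∈ precSupport Sig} ≤ maxDeg Sig := by
  have h : {j : Fin p | (i, j) ∈ precSupport Sig} = {j : Fin p | Sig⁻¹ j i ≠ 0} := by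
    ext j
    exact ⟨fun h => mem_precSupport_swap hSig h, fun h => mem_precSupport_swap hSig h⟩
  rw [h]
  exact le_ciSup (f := fun j : Fin p => Set.ncard {i : Fin p | Sig⁻¹ i j ≠ 0})
    (Set.finite_range _).bddAbove i

theorem one_le_maxDeg {p : ℕ} {Sig : Matrix (Fin p) (Fin p) ℝ} (hSig : Sig.PosDef)
    (i : Fin p) : 1 ≤ maxDeg Sig := by
  refine le_trans ?_ (ncard_row_le_maxDeg hSig i)
  exact Set.ncard_pos (Set.toFinite _) |>.mpr ⟨i, diag_mem_precSupport hSig i⟩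

theorem one_le_kappaSigma {p : ℕ} {Sig : Matrix (Fin p) (Fin p) ℝ} (hdiag : ∀ i, Sig i i = 1)
    (i : Fin p) : 1 ≤ kappaSigma Sig := by
  refine le_trans ?_ (sum_abs_le_maxRowSum Sig i)
  have := Finset.single_le_sum (f := fun j => |Sig i j|) (fun j _ => abs_nonneg _)
    (Finset.mem_univ i)
  simpa [hdiag i] using this

theorem fisherSS_posDef {p : ℕ} {Sig : Matrix (Fin p) (Fin p) ℝ} (hSig : Sig.PosDef) :
    (fisherSS Sig).PosDef :=
  (hSig.kronecker hSig).submatrix Subtype.val_injective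

theorem fisherSSInv_mulVec_fisherSS {p : ℕ} {Sig : Matrix (Fin p) (Fin p) ℝ} (hSig : Sig.PosDef)
    (x : precSupport Sig → ℝ) : fisherSSInv Sig *ᵥ (fisherSS Sig *ᵥ x) = x := by
  classical
  have hu : IsUnit (fisherSS Sig).det := isUnit_iff_ne_zero.mpr (fisherSS_posDef hSig).det_pos.ne'
  rw [mulVec_mulVec]
  have : fisherSSInv Sig * fisherSS Sig = 1 := by
    unfold fisherSSInv
    convert! nonsing_inv_mul (fisherSS Sig) hu
  rw [this, one_mulVec]

theorem fisherSS_mulVec_fisherSSInv {p : ℕ} {Sig : Matrix (Fin p) (Fin p) ℝ} (hSig : Sig.PosDef)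
    (x : precSupport Sig → ℝ) : fisherSS Sig *ᵥ (fisherSSInv Sig *ᵥ x) = x := by
  classical
  have hu : IsUnit (fisherSS Sig).det := isUnit_iff_ne_zero.mpr (fisherSS_posDef hSig).det_pos.ne'
  rw [mulVec_mulVec]
  have : fisherSS Sig * fisherSSInv Sig = 1 := by
    unfold fisherSSInv
    convert! mul_nonsing_inv (fisherSS Sig) hu
  rw [this, one_mulVec]

/-- The inverse of a positive definite matrix with unit diagonal has diagonal entries at least
one, so `κ_Γ ≥ 1`. -/
theorem one_le_kappaGamma {p : ℕ} {Sig : Matrix (Fin p) (Fin p) ℝ} (hSig : Sig.PosDef)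
    (hdiag : ∀ i, Sig i i = 1) (i : Fin p) : 1 ≤ kappaGamma Sig := by
  classical
  set s : precSupport Sig := ⟨(i, i), diag_mem_precSupport hSig i⟩ with hs
  set e : precSupport Sig → ℝ := Pi.single s 1 with he
  set x := fisherSSInv Sig *ᵥ e with hx
  have hMx : fisherSS Sig *ᵥ x = e := fisherSS_mulVec_fisherSSInv hSig e
  -- With `fisherSS Sig *ᵥ x = e` and unit diagonal, the quadratic form at `x - e` equals `x s - 1`.
  have hq := (fisherSS_posDef hSig).posSemidef.dotProduct_mulVec_nonneg (x - e)
  have hMss : fisherSS Sig s s = 1 := by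
    simp [fisherSS, fisher, hs, kroneckerMap_apply, hdiag]
  have hsym : x ⬝ᵥ (fisherSS Sig *ᵥ e) = e ⬝ᵥ (fisherSS Sig *ᵥ x) := by
    rw [dotProduct_mulVec, ← mulVec_transpose, transpose_eq_of_posDef (fisherSS_posDef hSig),
      dotProduct_comm]
  rw [star_trivial, mulVec_sub, sub_dotProduct, dotProduct_sub, dotProduct_sub, hsym, hMx] at hq
  have h1 : x ⬝ᵥ e = x s := by simp [he]
  have h2 : e ⬝ᵥ e = 1 := by simp [he]
  have h3 : e ⬝ᵥ (fisherSS Sig *ᵥ e) = 1 := by simp [he, hMss]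
  rw [h1, h2, h3] at hq
  have h4 : x s = fisherSSInv Sig s s := by simp [hx, he]
  have h5 := Finset.single_le_sum (f := fun t => |fisherSSInv Sig s t|) (fun j _ => abs_nonneg _)
    (Finset.mem_univ s)
  have h6 := sum_abs_le_maxRowSum (fisherSSInv Sig) s
  have h7 := le_abs_self (fisherSSInv Sig s s)
  change 1 ≤ maxRowSum (fisherSSInv Sig)
  linarith

/-! ### Matrices supported in the support of the precision matrix -/

open Classical in
/-- The matrix with the entries of `x` on the support of the precision matrix and zero
elsewhere. -/
noncomputable def extendSupport {p : ℕ} {Sig : Matrix (Fin p) (Fin p) ℝ}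
    (x : precSupport Sig → ℝ) : Matrix (Fin p) (Fin p) ℝ :=
  Matrix.of fun i j => if h : (i, j) ∈ precSupport Sig then x ⟨(i, j), h⟩ else 0

section

variable {p : ℕ} {Sig : Matrix (Fin p) (Fin p) ℝ}

theorem extendSupport_mem (x : precSupport Sig → ℝ) {i j : Fin p} (h : (i, j) ∈ precSupport Sig) :
    extendSupport x i j = x ⟨(i, j), h⟩ := by simp [extendSupport, h]

theorem extendSupport_notMem (x : precSupport Sig → ℝ) {i j : Fin p}
    (h : (i, j) ∉ precSupport Sig) : extendSupport x i j = 0 := by simp [extendSupport, h]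

theorem abs_extendSupport_sub_le {x y : precSupport Sig → ℝ} {r : ℝ} (hr : 0 ≤ r)
    (h : ∀ s, |x s - y s| ≤ r) (i j : Fin p) :
    |extendSupport x i j - extendSupport y i j| ≤ r := by
  by_cases hij : (i, j) ∈ precSupport Sig
  · rw [extendSupport_mem x hij, extendSupport_mem y hij]; exact h _
  · rw [extendSupport_notMem x hij, extendSupport_notMem y hij]; simpa using hr

theorem abs_extendSupport_le {x : precSupport Sig → ℝ} {r : ℝ} (hr : 0 ≤ r)
    (h : ∀ s, |x s| ≤ r) (i j : Fin p) : |extendSupport x i j| ≤ r := by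
  by_cases hij : (i, j) ∈ precSupport Sig
  · rw [extendSupport_mem x hij]; exact h _
  · rw [extendSupport_notMem x hij]; simpa using hr

theorem sum_abs_extendSupport_le (hSig : Sig.PosDef) {x : precSupport Sig → ℝ} {r : ℝ}
    (hr : 0 ≤ r) (h : ∀ s, |x s| ≤ r) (i : Fin p) :
    ∑ j, |extendSupport x i j| ≤ maxDeg Sig * r := by
  classical
  calc ∑ j, |extendSupport x i j|
      ≤ ∑ j, if (i, j) ∈ precSupport Sig then r else 0 := by
        refine Finset.sum_le_sum fun j _ => ?_
        split_ifs with hij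
        · exact abs_extendSupport_le hr h i j
        · rw [extendSupport_notMem x hij, abs_zero]
    _ = (Set.ncard {j : Fin p | (i, j) ∈ precSupport Sig} : ℝ) * r := by
        rw [← Finset.sum_filter, Finset.sum_const, nsmul_eq_mul]
        congr 2
        rw [← Set.ncard_coe_finset]
        congr 1; ext j; simp
    _ ≤ _ := by
        refine mul_le_mul_of_nonneg_right ?_ hr
        exact_mod_cast ncard_row_le_maxDeg hSig i

/-- The identity `(Sig ⊗ Sig) vec Δ = vec (Sig Δ Sig)`, which links `Γ` to the linear part of
inversion. -/
theorem sum_fisher_mul (hSig : Sig.PosDef) (x : precSupport Sig → ℝ) (e : Fin p × Fin p) :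
    ∑ s : precSupport Sig, fisher Sig e s * x s = (Sig * extendSupport x * Sig) e.1 e.2 := by
  classical
  have h1 : ∑ s : precSupport Sig, fisher Sig e s * x s
      = ∑ q : Fin p × Fin p, fisher Sig e q * extendSupport x q.1 q.2 := by
    refine Finset.sum_of_injOn Subtype.val Subtype.val_injective.injOn (fun _ _ => by simp) ?_ ?_
    · intro q _ hq
      have : (q.1, q.2) ∉ precSupport Sig := fun h => hq ⟨⟨q, h⟩, by simp, rfl⟩
      rw [extendSupport_notMem x this, mul_zero]
    · intro s _
      rw [extendSupport_mem x (i := s.1.1) (j := s.1.2) s.2]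
  rw [h1, Fintype.sum_prod_type, mul_apply]
  simp only [mul_apply, Finset.sum_mul]
  rw [Finset.sum_comm]
  refine Finset.sum_congr rfl fun l _ => Finset.sum_congr rfl fun k _ => ?_
  rw [fisher, kroneckerMap_apply, apply_comm_of_posDef hSig e.2 l]
  ring

theorem fisherSS_mulVec_apply (hSig : Sig.PosDef) (x : precSupport Sig → ℝ)
    (s : precSupport Sig) :
    (fisherSS Sig *ᵥ x) s = (Sig * extendSupport x * Sig) s.1.1 s.1.2 :=
  sum_fisher_mul hSig x s.1

theorem extendSupport_symm_iff (hSig : Sig.PosDef) (x : precSupport Sig → ℝ) :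
    (extendSupport x)ᵀ = extendSupport x ↔
      ∀ s : precSupport Sig, x ⟨(s.1.2, s.1.1), mem_precSupport_swap hSig s.2⟩ = x s := by
  constructor
  · rintro h ⟨⟨i, j⟩, hs⟩
    have := congrFun (congrFun h i) j
    rwa [transpose_apply, extendSupport_mem x hs,
      extendSupport_mem x (mem_precSupport_swap hSig hs)] at this
  · intro h
    ext i j
    rw [transpose_apply]
    by_cases hij : (i, j) ∈ precSupport Sig
    · rw [extendSupport_mem x hij, extendSupport_mem x (mem_precSupport_swap hSig hij)]
      exact h ⟨(i, j), hij⟩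
    · rw [extendSupport_notMem x hij,
        extendSupport_notMem x fun h => hij (mem_precSupport_swap hSig h)]

/-- The transpose of the solution solves the same system when `y` is symmetric, and `Γ_SS` is
invertible. -/
theorem extendSupport_fisherSSInv_symm (hSig : Sig.PosDef) {y : precSupport Sig → ℝ}
    (hy : ∀ s : precSupport Sig, y ⟨(s.1.2, s.1.1), mem_precSupport_swap hSig s.2⟩ = y s) :
    (extendSupport (fisherSSInv Sig *ᵥ y))ᵀ = extendSupport (fisherSSInv Sig *ᵥ y) := by
  rw [extendSupport_symm_iff hSig]
  set x := fisherSSInv Sig *ᵥ y with hx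
  set x' : precSupport Sig → ℝ :=
    fun s => x ⟨(s.1.2, s.1.1), mem_precSupport_swap hSig s.2⟩ with hx'
  have hext : extendSupport x' = (extendSupport x)ᵀ := by
    ext i j
    rw [transpose_apply]
    by_cases hij : (i, j) ∈ precSupport Sig
    · rw [extendSupport_mem x' hij, extendSupport_mem x (mem_precSupport_swap hSig hij)]
    · rw [extendSupport_notMem x' hij,
        extendSupport_notMem x fun h => hij (mem_precSupport_swap hSig h)]
  have hSt := transpose_eq_of_posDef hSig
  have h1 : fisherSS Sig *ᵥ x' = y := by
    ext s
    rw [fisherSS_mulVec_apply hSig, hext]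
    have h2 : Sig * (extendSupport x)ᵀ * Sig = (Sig * extendSupport x * Sig)ᵀ := by
      rw [transpose_mul, transpose_mul, hSt, Matrix.mul_assoc]
    rw [h2, transpose_apply, ← hy s]
    have h3 := fisherSS_mulVec_apply hSig x
      ⟨(s.1.2, s.1.1), mem_precSupport_swap hSig s.2⟩
    rw [← h3, hx, fisherSS_mulVec_fisherSSInv hSig]
  have h2 : x' = x := by rw [← fisherSSInv_mulVec_fisherSS hSig x', h1]
  exact fun s => congrFun h2 s

theorem isSmallPerturbation_extendSupport (hSig : Sig.PosDef) {r : ℝ} (hr : 0 ≤ r)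
    (hsmall : kappaSigma Sig * (maxDeg Sig * r) ≤ 1 / 3) (hk : 0 ≤ kappaSigma Sig)
    {x : precSupport Sig → ℝ} (hx : ∀ s, |x s| ≤ r)
    (hsym : (extendSupport x)ᵀ = extendSupport x) :
    IsSmallPerturbation Sig (kappaSigma Sig) (maxDeg Sig * r) (extendSupport x) where
  symm := hsym
  row := sum_abs_extendSupport_le hSig hr hx
  rowSig := sum_abs_le_maxRowSum Sig
  k_nonneg := hk
  m_nonneg := by positivity
  small := hsmall

/-- A small symmetric perturbation supported in `S` makes the inverse agree on `S` with a
prescribed symmetric matrix `Sig + V`. -/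
theorem exists_perturbation_inv_eq (hSig : Sig.PosDef) {r v : ℝ} (hr : 0 ≤ r)
    (hk : 0 ≤ kappaSigma Sig)
    (hsmall : kappaSigma Sig * (maxDeg Sig * r) ≤ 1 / 3)
    (hmaps : kappaGamma Sig * (3 / 2 * kappaSigma Sig ^ 3 * (maxDeg Sig * r) * r + v) ≤ r)
    (hcontr : kappaGamma Sig * (15 / 4 * kappaSigma Sig ^ 3 * (maxDeg Sig * r)) ≤ 1 / 2)
    {V : Matrix (Fin p) (Fin p) ℝ} (hV : Vᵀ = V) (hv : 0 ≤ v)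
    (hVv : ∀ i j, (i, j) ∈ precSupport Sig → |V i j| ≤ v) :
    ∃ x : precSupport Sig → ℝ, (∀ s, |x s| ≤ r) ∧ (extendSupport x)ᵀ = extendSupport x ∧
      x = fisherSSInv Sig *ᵥ
        fun s => invRemainder Sig (extendSupport x) s.1.1 s.1.2 - V s.1.1 s.1.2 := by
  -- A fixed point satisfies `Sig Δ Sig = invRemainder Sig Δ - V` on `S`, which says exactly that
  -- `(Sig⁻¹ + Δ)⁻¹ = Sig + V` there.
  set F : (precSupport Sig → ℝ) → (precSupport Sig → ℝ) := fun x => fisherSSInv Sig *ᵥ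
    fun s => invRemainder Sig (extendSupport x) s.1.1 s.1.2 - V s.1.1 s.1.2 with hF
  -- Symmetry is part of the domain, since positive definiteness of `Sig⁻¹ + Δ` and the remainder
  -- bounds require it. `hmaps` keeps the sup-norm ball invariant and `hcontr` makes `F` a
  -- contraction there.
  set B : Set (precSupport Sig → ℝ) :=
    {x | (∀ s, |x s| ≤ r) ∧
      ∀ s : precSupport Sig, x ⟨(s.1.2, s.1.1), mem_precSupport_swap hSig s.2⟩ = x s} with hB
  have hsp : ∀ x ∈ B,
      IsSmallPerturbation Sig (kappaSigma Sig) (maxDeg Sig * r) (extendSupport x) := fun x hx =>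
    isSmallPerturbation_extendSupport hSig hr hsmall hk hx.1
      ((extendSupport_symm_iff hSig x).mpr hx.2)
  have hBclosed : IsClosed B := by
    rw [hB]
    simp only [Set.ofPred_and, Set.ofPred_forall]
    refine IsClosed.inter (isClosed_iInter fun s => ?_) (isClosed_iInter fun s => ?_)
    · exact isClosed_le (by fun_prop) continuous_const
    · exact isClosed_eq (by fun_prop) (by fun_prop)
  have hmapsTo : Set.MapsTo F B B := by
    intro x hx
    have hp := hsp x hx
    refine ⟨fun s => ?_, ?_⟩
    · refine le_trans (abs_mulVec_le (by positivity) (sum_abs_le_maxRowSum (fisherSSInv Sig))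
        (fun t => ?_) s) hmaps
      refine (abs_sub _ _).trans (add_le_add ?_ (hVv _ _ t.2))
      exact hp.abs_invRemainder_le hSig hr (abs_extendSupport_le hr hx.1) _ _
    · rw [← extendSupport_symm_iff hSig]
      refine extendSupport_fisherSSInv_symm hSig fun s => ?_
      have hVs : V s.1.2 s.1.1 = V s.1.1 s.1.2 := congrFun (congrFun hV s.1.1) s.1.2
      have hRs : (invRemainder Sig (extendSupport x))ᵀ = invRemainder Sig (extendSupport x) := by
        have hSt := transpose_eq_of_posDef hSig
        rw [invRemainder, transpose_add, transpose_sub, hp.inv_symm hSig, transpose_mul,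
          transpose_mul, hSt, hp.symm, Matrix.mul_assoc]
      have hRs' : invRemainder Sig (extendSupport x) s.1.2 s.1.1
          = invRemainder Sig (extendSupport x) s.1.1 s.1.2 :=
        congrFun (congrFun hRs s.1.1) s.1.2
      simp only [hVs, hRs']
  have hlip : ContractingWith (1 / 2) (hmapsTo.restrict F B B) := by
    refine ⟨by norm_num, LipschitzWith.of_dist_le_mul fun x y => ?_⟩
    change dist (F x.1) (F y.1) ≤ _ * dist x.1 y.1
    rw [dist_pi_le_iff (by positivity)]
    intro s
    have hdist : ∀ t, |x.1 t - y.1 t| ≤ dist x.1 y.1 := fun t => by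
      rw [← Real.dist_eq]; exact dist_le_pi_dist x.1 y.1 t
    have hsub : F x.1 s - F y.1 s = (fisherSSInv Sig *ᵥ fun s =>
        invRemainder Sig (extendSupport x.1) s.1.1 s.1.2
          - invRemainder Sig (extendSupport y.1) s.1.1 s.1.2) s := by
      rw [hF, ← Pi.sub_apply, ← mulVec_sub]
      refine congrFun (congrArg _ (funext fun t => ?_)) s
      simp
    rw [Real.dist_eq, hsub]
    have hk3 : 0 ≤ kappaSigma Sig ^ 3 := by positivity
    refine (abs_mulVec_le (by positivity) (sum_abs_le_maxRowSum (fisherSSInv Sig))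
      (fun t => (hsp x.1 x.2).abs_invRemainder_sub_le (hsp y.1 y.2) hSig dist_nonneg
        (abs_extendSupport_sub_le dist_nonneg hdist) _ _) s).trans ?_
    have := mul_le_mul_of_nonneg_right hcontr (dist_nonneg (x := x.1) (y := y.1))
    calc _ = kappaGamma Sig * (15 / 4 * kappaSigma Sig ^ 3 * (maxDeg Sig * r)) * dist x.1 y.1 := by
          unfold kappaGamma; ring
      _ ≤ _ := by simpa using this
  obtain ⟨x, hxB, hfix, -⟩ := hlip.exists_fixedPoint' hBclosed.isComplete hmapsTo (x := 0)
    ⟨fun _ => by simpa using hr, by simp⟩ (edist_ne_top _ _)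
  exact ⟨x, hxB.1, (extendSupport_symm_iff hSig x).mpr hxB.2, hfix.symm⟩

end

/-! ### Recovery of the precision matrix from an entrywise accurate covariance estimate -/

section

variable {p : ℕ} {Sig R : Matrix (Fin p) (Fin p) ℝ}

/-- A penalty at the level of the entrywise error pays for replacing `R` by `Sig`. The diagonal is
unpenalized, so the two matrices must agree on it. -/
theorem trace_mul_le_of_abs_sub_le {lam : ℝ} (hdiag : ∀ i, R i i = Sig i i)
    (hRS : ∀ i j, |R i j - Sig i j| ≤ lam) (T : Matrix (Fin p) (Fin p) ℝ) :
    (T * Sig).trace ≤ (T * R).trace + lam * offL1 T := by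
  rw [mul_offL1_eq_sum]
  simp only [trace, diag_apply, mul_apply]
  rw [← Finset.sum_add_distrib]
  refine Finset.sum_le_sum fun i _ => ?_
  rw [← Finset.sum_add_distrib]
  refine Finset.sum_le_sum fun j _ => ?_
  by_cases h : i = j
  · subst h; simp [penaltyWeight, hdiag i]
  · have h1 : |T i j * (R j i - Sig j i)| ≤ |T i j| * lam := by
      rw [abs_mul]; exact mul_le_mul_of_nonneg_left (hRS j i) (abs_nonneg _)
    have := (abs_le.mp h1).1
    simp only [penaltyWeight, h, if_false]
    linarith

/-- The primal-dual witness argument. Accuracy `τ/2` instead of `τ` leaves room for a strict error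
bound, so signs are recovered even for entries of size exactly `precError Sig θ τ`. -/
theorem exists_glasso_of_abs_sub_le (hSig : Sig.PosDef) (hSdiag : ∀ i, Sig i i = 1)
    (hp : 0 < p) {θ τ : ℝ} (hθ : 0 < θ) (hθ1 : θ ≤ 1) (hτ : 0 < τ) (hirr : Irrepresentable Sig θ)
    (hR : Rᵀ = R) (hdiag : ∀ i, R i i = Sig i i) (hRS : ∀ i j, |R i j - Sig i j| ≤ τ / 2)
    (h1 : precError Sig θ τ ≤ (3 * kappaSigma Sig * maxDeg Sig)⁻¹
      * min 1 (kappaSigma Sig ^ 2 * kappaGamma Sig)⁻¹)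
    (h2 : 3 / 2 * maxDeg Sig * kappaSigma Sig ^ 3 * precError Sig θ τ ^ 2 ≤ τ) :
    ∃ T : Matrix (Fin p) (Fin p) ℝ, (∀ T', IsGraphicalLasso R (8 * τ / θ) T' ↔ T' = T) ∧
      (∀ i j, (i, j) ∉ precSupport Sig → T i j = 0) ∧
      ∀ i j, |T i j - Sig⁻¹ i j| < precError Sig θ τ := by
  have hk : 1 ≤ kappaSigma Sig := one_le_kappaSigma hSdiag ⟨0, hp⟩
  have hg : 1 ≤ kappaGamma Sig := one_le_kappaGamma hSig hSdiag ⟨0, hp⟩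
  have hd : (1 : ℝ) ≤ maxDeg Sig := by exact_mod_cast one_le_maxDeg hSig ⟨0, hp⟩
  set k := kappaSigma Sig with hkdef
  set g := kappaGamma Sig with hgdef
  set D : ℝ := (maxDeg Sig : ℝ) with hDdef
  set r := precError Sig θ τ with hrdef
  set lam := 8 * τ / θ with hlam
  have hlampos : 0 < lam := by positivity
  have hθlam : θ * lam = 8 * τ := by rw [hlam]; field_simp
  have hr : r = 2 * g * (τ + lam) := by
    rw [hrdef, precError, hlam, ← hgdef]; field_simp
  have hrpos : 0 < r := by rw [hr]; positivity
  have hlam8 : 8 * τ ≤ lam := by nlinarith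
  have hsmall : k * (D * r) ≤ 1 / 3 := by
    have : r ≤ (3 * k * D)⁻¹ * 1 :=
      h1.trans (mul_le_mul_of_nonneg_left (min_le_left _ _) (by positivity))
    rw [mul_one, inv_eq_one_div, le_div_iff₀ (by positivity)] at this
    linarith
  -- Multiply `h2` by `18 g`, use `18 g τ ≤ r`, and cancel one factor `r`.
  have hquad : g * (D * k ^ 3 * r) ≤ 1 / 27 := by
    have h3 : 18 * g * τ ≤ r := by rw [hr]; nlinarith
    have h4 : r * (g * (D * k ^ 3 * r) * 27) ≤ r * 1 := by
      have := mul_le_mul_of_nonneg_left h2 (show 0 ≤ 18 * g by positivity)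
      calc r * (g * (D * k ^ 3 * r) * 27) = 18 * g * (3 / 2 * D * k ^ 3 * r ^ 2) := by ring
        _ ≤ _ := by linarith
    linarith [le_of_mul_le_mul_left h4 hrpos]
  -- the minimizer among the matrices supported in the support of the precision matrix
  obtain ⟨T, hTS, hT, hmin⟩ := exists_isMinOn_glassoObjective (R := R) (lam := lam) hSig
    (fun T _ => trace_mul_le_of_abs_sub_le hdiag (fun i j => (hRS i j).trans (by linarith)) T)
    (K := {T | ∀ i j, (i, j) ∉ precSupport Sig → T i j = 0})
    (by
      simp only [Set.ofPred_forall]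
      exact isClosed_iInter fun i => isClosed_iInter fun j => isClosed_iInter fun _ =>
        isClosed_eq (by fun_prop) continuous_const)
    ⟨Sig⁻¹, fun i j h => not_not.mp h, hSig.inv⟩
  have hstat : ∀ i j, (i, j) ∈ precSupport Sig → |R i j - T⁻¹ i j| ≤ penaltyWeight lam i j ∧
      T i j * (R i j - T⁻¹ i j) ≤ -(penaltyWeight lam i j * |T i j|) := fun i j hij =>
    stationary_of_isMinOn_support hlampos.le hR (fun _ _ h => mem_precSupport_swap hSig h) hT hTS
      hmin hij
  have hwle : ∀ i j : Fin p, penaltyWeight lam i j ≤ lam := fun i j => by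
    unfold penaltyWeight; split_ifs <;> linarith
  set V := T⁻¹ - Sig with hVdef
  have hVsym : Vᵀ = V := by
    rw [hVdef, transpose_sub, transpose_eq_of_posDef hT.inv, transpose_eq_of_posDef hSig]
  have hVle : ∀ i j, (i, j) ∈ precSupport Sig → |V i j| ≤ τ / 2 + lam := by
    intro i j hij
    have e : V i j = (R i j - Sig i j) - (R i j - T⁻¹ i j) := by
      rw [hVdef, Matrix.sub_apply]; ring
    rw [e]
    exact (abs_sub _ _).trans (add_le_add (hRS i j) ((hstat i j hij).1.trans (hwle i j)))
  have hrem : 3 / 2 * k ^ 3 * (D * r) * r ≤ τ := by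
    calc _ = 3 / 2 * D * k ^ 3 * r ^ 2 := by ring
      _ ≤ τ := h2
  -- The left side is at most `g (3τ/2 + lam)`, strictly below `r = 2 g (τ + lam)`.
  have hlt : g * (3 / 2 * k ^ 3 * (D * r) * r + (τ / 2 + lam)) < r := by
    calc _ ≤ g * (τ + (τ / 2 + lam)) := by gcongr
      _ < r := by rw [hr]; nlinarith
  obtain ⟨x, hxr, hxsym, hx⟩ := exists_perturbation_inv_eq hSig hrpos.le (by linarith)
    hsmall hlt.le (by rw [← hkdef, ← hgdef]; linarith) hVsym (by linarith) hVle
  have hpert := isSmallPerturbation_extendSupport hSig hrpos.le hsmall (by linarith) hxr hxsym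
  set Δ := extendSupport x with hΔ
  set y : precSupport Sig → ℝ :=
    fun s => invRemainder Sig Δ s.1.1 s.1.2 - V s.1.1 s.1.2 with hy
  have hRem : ∀ i j, |invRemainder Sig Δ i j| ≤ τ := fun i j =>
    (hpert.abs_invRemainder_le hSig hrpos.le (abs_extendSupport_le hrpos.le hxr) i j).trans hrem
  have hyle : ∀ s, |y s| ≤ τ + (τ / 2 + lam) := fun s =>
    (abs_sub _ _).trans (add_le_add (hRem _ _) (hVle _ _ s.2))
  have hGx : fisherSS Sig *ᵥ x = y := by
    rw [hx]; exact fisherSS_mulVec_fisherSSInv hSig y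
  have hxlt : ∀ s, |x s| < r := by
    intro s
    rw [hx]
    refine lt_of_le_of_lt (abs_mulVec_le (by linarith)
      (sum_abs_le_maxRowSum (fisherSSInv Sig)) hyle s) ?_
    change g * (τ + (τ / 2 + lam)) < r
    rw [hr]; nlinarith
  have hinvS : ∀ i j, (i, j) ∈ precSupport Sig → (Sig⁻¹ + Δ)⁻¹ i j = T⁻¹ i j := by
    intro i j hij
    have e1 := congrFun hGx ⟨(i, j), hij⟩
    rw [fisherSS_mulVec_apply hSig] at e1
    simp only [hy, invRemainder, hVdef, Matrix.sub_apply, Matrix.add_apply] at e1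
    linarith
  -- The inverses agree on `S` and the matrices agree (both vanish) off `S`, so the trace pairing of
  -- the two differences is zero.
  have hTeq : Sig⁻¹ + Δ = T := by
    refine eq_of_trace_inv_sub_inv_mul_eq_zero (hpert.posDef hSig) hT ?_
    simp only [trace, diag_apply, mul_apply]
    refine Finset.sum_eq_zero fun i _ => Finset.sum_eq_zero fun j _ => ?_
    by_cases hij : (i, j) ∈ precSupport Sig
    · rw [Matrix.sub_apply, hinvS i j hij, sub_self, zero_mul]
    · have hji : (j, i) ∉ precSupport Sig := fun h => hij (mem_precSupport_swap hSig h)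
      have e1 : Sig⁻¹ j i = 0 := not_not.mp hji
      rw [Matrix.sub_apply (Sig⁻¹ + Δ), Matrix.add_apply, e1, hΔ, extendSupport_notMem x hji,
        hTS j i hji]
      simp
  have hstatAll : ∀ i j, |R i j - T⁻¹ i j| ≤ penaltyWeight lam i j ∧
      T i j * (R i j - T⁻¹ i j) ≤ -(penaltyWeight lam i j * |T i j|) := by
    intro i j
    by_cases hij : (i, j) ∈ precSupport Sig
    · exact hstat i j hij
    · have hne : i ≠ j := by rintro rfl; exact hij (diag_mem_precSupport hSig i)
      refine ⟨?_, by rw [hTS i j hij]; simp⟩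
      have hw : penaltyWeight lam i j = lam := by simp [penaltyWeight, hne]
      have hGe : |(Sig * Δ * Sig) i j| ≤ (1 - θ) * (τ + (τ / 2 + lam)) := by
        have e1 : (Sig * Δ * Sig) i j
            = ((fun s : precSupport Sig => fisher Sig (i, j) s) ᵥ* fisherSSInv Sig) ⬝ᵥ y := by
          rw [← dotProduct_mulVec, ← hx]
          exact (sum_fisher_mul hSig x (i, j)).symm
        rw [e1, dotProduct]
        calc _ ≤ ∑ t, |((fun s : precSupport Sig => fisher Sig (i, j) s) ᵥ* fisherSSInv Sig) t|
                * (τ + (τ / 2 + lam)) := by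
              refine (Finset.abs_sum_le_sum_abs _ _).trans (Finset.sum_le_sum fun t _ => ?_)
              rw [abs_mul]
              exact mul_le_mul_of_nonneg_left (hyle t) (abs_nonneg _)
          _ ≤ _ := by
              rw [← Finset.sum_mul]
              exact mul_le_mul_of_nonneg_right (hirr (i, j) hij) (by linarith)
      have e2 : R i j - T⁻¹ i j
          = (R i j - Sig i j) + (Sig * Δ * Sig) i j - invRemainder Sig Δ i j := by
        rw [invRemainder, hTeq, Matrix.add_apply, Matrix.sub_apply]; ring
      rw [hw, e2]
      have b1 := hRS i j
      have b2 := hRem i j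
      have b3 : |(R i j - Sig i j) + (Sig * Δ * Sig) i j - invRemainder Sig Δ i j|
          ≤ τ / 2 + (1 - θ) * (τ + (τ / 2 + lam)) + τ :=
        (abs_sub _ _).trans (add_le_add ((abs_add_le _ _).trans (add_le_add b1 hGe)) b2)
      -- The sum is `lam + 3τ - (3/2)θτ - θ lam`; since `θ lam = 8τ`, it is below `lam`.
      nlinarith
  refine ⟨T, isGraphicalLasso_iff_of_stationary hR hT hstatAll, hTS, fun i j => ?_⟩
  have : T i j - Sig⁻¹ i j = Δ i j := by rw [← hTeq, Matrix.add_apply]; ring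
  rw [this]
  by_cases hij : (i, j) ∈ precSupport Sig
  · rw [hΔ, extendSupport_mem x hij]; exact hxlt _
  · rw [hΔ, extendSupport_notMem x hij]; simpa using hrpos

end

/-! ### Gaussian concentration -/

section

variable {Ω : Type*} [MeasurableSpace Ω] {P : Measure Ω}

/-- Conditioning on `U` through Fubini: a bound valid for every frozen value of `U` holds for the
joint event. -/
theorem measure_le_of_forall_left {α β : Type*} [MeasurableSpace α] [MeasurableSpace β]
    [IsProbabilityMeasure P] {U : Ω → α} {V : Ω → β} (hU : AEMeasurable U P)
    (hV : AEMeasurable V P) (hUV : IndepFun U V P) {E : Set (α × β)} (hE : MeasurableSet E)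
    {ε : ℝ≥0∞} (h : ∀ u, P {ω | (u, V ω) ∈ E} ≤ ε) : P {ω | (U ω, V ω) ∈ E} ≤ ε := by
  have hmap := (indepFun_iff_map_prod_eq_prod_map_map hU hV).mp hUV
  have hUp : IsProbabilityMeasure (P.map U) := Measure.isProbabilityMeasure_map hU
  have h1 : P {ω | (U ω, V ω) ∈ E} = P.map (fun ω => (U ω, V ω)) E :=
    (Measure.map_apply_of_aemeasurable (hU.prodMk hV) hE).symm
  rw [h1, hmap, Measure.prod_apply hE]
  calc ∫⁻ u, P.map V (Prod.mk u ⁻¹' E) ∂(P.map U) ≤ ∫⁻ _, ε ∂(P.map U) := by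
        refine lintegral_mono fun u => ?_
        rw [Measure.map_apply_of_aemeasurable hV (measurable_prodMk_left hE)]
        exact h u
    _ = ε := by simp

/-- No upper bound on `m` is needed: for `m ≥ 1/2` the integral diverges and has default value zero,
which is also the value of the right side. -/
theorem integral_exp_mul_sq_gaussianReal {v : ℝ≥0} (hv : v ≠ 0) {m : ℝ} :
    ∫ x, Real.exp (m / v * x ^ 2) ∂(gaussianReal 0 v) = Real.sqrt (1 / (1 - 2 * m)) := by
  have hv' : (0 : ℝ) < v := by positivity
  rw [integral_gaussianReal_eq_integral_smul hv]
  have : ∀ x : ℝ, gaussianPDFReal 0 v x • Real.exp (m / v * x ^ 2)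
      = (Real.sqrt (2 * Real.pi * v))⁻¹ * Real.exp (-((1 - 2 * m) / (2 * v)) * x ^ 2) := by
    intro x
    rw [gaussianPDFReal, smul_eq_mul, mul_assoc, ← Real.exp_add]
    congr 2
    field_simp
    ring
  simp_rw [this]
  rw [integral_const_mul, integral_gaussian, ← Real.sqrt_inv, ← Real.sqrt_mul (by positivity)]
  congr 1
  field_simp

theorem sqrt_inv_one_sub_le {m : ℝ} (hm : m ≤ 1 / 4) :
    Real.sqrt (1 / (1 - 2 * m)) ≤ Real.exp (m + 4 * m ^ 2) := by
  have h0 : 0 < 1 - 2 * m := by linarith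
  rw [Real.sqrt_le_left (Real.exp_pos _).le, ← Real.exp_nat_mul,
    ← Real.log_le_iff_le_exp (by positivity), one_div, Real.log_inv]
  have h1 := Real.one_sub_inv_le_log_of_pos h0
  have h2 : (1 - 2 * m)⁻¹ - 1 ≤ 2 * (m + 4 * m ^ 2) := by
    rw [sub_le_iff_le_add, inv_eq_one_div, div_le_iff₀ h0]
    nlinarith [sq_nonneg m, mul_nonneg (sq_nonneg m) (by linarith : 0 ≤ 1 / 4 - m)]
  push_cast
  linarith

/-- Chernoff bound for a scaled chi-square variable. Variance zero is admitted because the lemma is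
applied to conditional variances, which may vanish; the strict inequality makes the event null in
that case. -/
theorem measure_sum_sq_sub_gt_le {ι : Type*} [Fintype ι] [IsProbabilityMeasure P]
    {ξ : ι → Ω → ℝ} {v : ℝ≥0} (hlaw : ∀ i, HasLaw (ξ i) (gaussianReal 0 v) P)
    (hind : iIndepFun ξ P) {δ : ℝ} (hδ0 : 0 ≤ δ) (hδ1 : δ ≤ 1) :
    P {ω | δ * (Fintype.card ι * v) < |∑ i, ξ i ω ^ 2 - Fintype.card ι * v|}
      ≤ ENNReal.ofReal (2 * Real.exp (-(Fintype.card ι * δ ^ 2 / 16))) := by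
  rcases eq_or_ne v 0 with rfl | hv
  · have h0 : ∀ i, ξ i =ᵐ[P] fun _ => 0 := fun i => by
      have := hlaw i
      rw [gaussianReal_zero_var] at this
      exact this.ae_eq_of_dirac
    have hall : ∀ᵐ ω ∂P, ∀ i, ξ i ω = 0 := ae_all_iff.mpr h0
    have : P {ω | δ * (Fintype.card ι * ((0 : ℝ≥0) : ℝ))
        < |∑ i, ξ i ω ^ 2 - Fintype.card ι * ((0 : ℝ≥0) : ℝ)|} = 0 := by
      refine measure_mono_null (fun ω hω => ?_) (ae_iff.mp hall)
      intro hz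
      simp [hz] at hω
    rw [this]; exact zero_le
  have hv' : (0 : ℝ) < v := by positivity
  set N : ℝ := (Fintype.card ι : ℝ) with hN
  set Q : ι → Ω → ℝ := fun i ω => ξ i ω ^ 2 with hQ
  have hQm : ∀ i, AEMeasurable (Q i) P := fun i => (hlaw i).aemeasurable.pow_const 2
  have hQind : iIndepFun Q P := hind.comp (fun _ x => x ^ 2) (fun _ => by fun_prop)
  have hmgf1 : ∀ (m : ℝ) i, mgf (Q i) P (m / v) = Real.sqrt (1 / (1 - 2 * m)) := by
    intro m i
    rw [← integral_exp_mul_sq_gaussianReal hv]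
    exact (hlaw i).integral_comp (f := fun x => Real.exp (m / v * x ^ 2))
      (by fun_prop)
  have hmgf : ∀ m : ℝ, mgf (∑ i, Q i) P (m / v) = Real.sqrt (1 / (1 - 2 * m)) ^ Fintype.card ι := by
    intro m
    rw [hQind.mgf_sum₀ hQm, Finset.prod_congr rfl fun i _ => hmgf1 m i]
    simp
  have hint : ∀ m : ℝ, m ≤ 1 / 4 →
      Integrable (fun ω => Real.exp (m / v * (∑ i, Q i) ω)) P := by
    intro m hm
    -- A non-integrable function would have integral zero, against the positive value just computed.
    by_contra hni
    have h1 := integral_undef hni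
    have h2 := hmgf m
    rw [mgf, h1] at h2
    have : 0 < 1 - 2 * m := by linarith
    have : 0 < Real.sqrt (1 / (1 - 2 * m)) ^ Fintype.card ι := by positivity
    linarith
  have hmgfle : ∀ m : ℝ, m ≤ 1 / 4 →
      mgf (∑ i, Q i) P (m / v) ≤ Real.exp (N * (m + 4 * m ^ 2)) := by
    intro m hm
    rw [hmgf, hN, Real.exp_nat_mul]
    exact pow_le_pow_left₀ (Real.sqrt_nonneg _) (sqrt_inv_one_sub_le hm) _
  have hN0 : 0 ≤ N := by positivity
  -- With parameter `δ/8` the exponent is `N(-(δ/8)(1+δ) + δ/8 + 4(δ/8)²) = -Nδ²/16`; the lower tail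
  -- uses `-δ/8`.
  have hup : P.real {ω | (1 + δ) * (N * v) ≤ (∑ i, Q i) ω}
      ≤ Real.exp (-(N * δ ^ 2 / 16)) := by
    refine (measure_ge_le_exp_mul_mgf _ (t := δ / 8 / v) (by positivity)
      (hint _ (by linarith))).trans ?_
    refine (mul_le_mul_of_nonneg_left (hmgfle _ (by linarith)) (Real.exp_pos _).le).trans ?_
    rw [← Real.exp_add]
    refine Real.exp_le_exp.mpr (le_of_eq ?_)
    field_simp
    ring
  have hlo : P.real {ω | (∑ i, Q i) ω ≤ (1 - δ) * (N * v)}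
      ≤ Real.exp (-(N * δ ^ 2 / 16)) := by
    refine (measure_le_le_exp_mul_mgf _ (t := -(δ / 8) / v)
      (by rw [neg_div]; exact neg_nonpos.mpr (by positivity))
      (hint _ (by linarith))).trans ?_
    refine (mul_le_mul_of_nonneg_left (hmgfle _ (by linarith)) (Real.exp_pos _).le).trans ?_
    rw [← Real.exp_add]
    refine Real.exp_le_exp.mpr (le_of_eq ?_)
    field_simp
    ring
  have hsub : {ω | δ * (N * v) < |∑ i, ξ i ω ^ 2 - N * v|}
      ⊆ {ω | (1 + δ) * (N * v) ≤ (∑ i, Q i) ω} ∪ {ω | (∑ i, Q i) ω ≤ (1 - δ) * (N * v)} := by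
    intro ω hω
    have hs : (∑ i, Q i) ω = ∑ i, ξ i ω ^ 2 := by simp [hQ]
    simp only [Set.mem_union, Set.mem_ofPred_eq, hs]
    rw [Set.mem_ofPred_eq, lt_abs] at hω
    rcases hω with h | h
    · left; linarith
    · right; linarith
  calc P {ω | δ * (N * v) < |∑ i, ξ i ω ^ 2 - N * v|}
      ≤ P {ω | (1 + δ) * (N * v) ≤ (∑ i, Q i) ω} + P {ω | (∑ i, Q i) ω ≤ (1 - δ) * (N * v)} :=
        (measure_mono hsub).trans (measure_union_le _ _)
    _ ≤ ENNReal.ofReal (Real.exp (-(N * δ ^ 2 / 16)))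
        + ENNReal.ofReal (Real.exp (-(N * δ ^ 2 / 16))) := by
        rw [← ofReal_measureReal, ← ofReal_measureReal]
        exact add_le_add (ENNReal.ofReal_le_ofReal hup) (ENNReal.ofReal_le_ofReal hlo)
    _ = _ := by rw [← ENNReal.ofReal_add (Real.exp_pos _).le (Real.exp_pos _).le]; ring_nf

theorem measure_abs_gt_le_of_gaussian [IsProbabilityMeasure P] {Z : Ω → ℝ} {c : ℝ≥0}
    (hZ : HasLaw Z (gaussianReal 0 c) P) {t : ℝ} (ht : 0 ≤ t) :
    P {ω | t * Real.sqrt c < |Z ω|} ≤ ENNReal.ofReal (2 * Real.exp (-(t ^ 2 / 2))) := by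
  rcases eq_or_ne c 0 with rfl | hc
  · have h0 : Z =ᵐ[P] fun _ => 0 := by
      rw [gaussianReal_zero_var] at hZ
      exact hZ.ae_eq_of_dirac
    have : P {ω | t * Real.sqrt ((0 : ℝ≥0) : ℝ) < |Z ω|} = 0 := by
      refine measure_mono_null (fun ω hω => ?_) (ae_iff.mp h0)
      intro hz
      simp [hz] at hω
    rw [this]; exact zero_le
  have hc' : (0 : ℝ) < c := by positivity
  have hs : 0 < Real.sqrt c := Real.sqrt_pos.mpr hc'
  have hss : Real.sqrt c * Real.sqrt c = c := Real.mul_self_sqrt hc'.le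
  have hmgf : ∀ a : ℝ, mgf Z P a = Real.exp (c * a ^ 2 / 2) := fun a => by
    rw [mgf_gaussianReal hZ.map_eq]; simp
  have hint : ∀ a : ℝ, Integrable (fun ω => Real.exp (a * Z ω)) P := by
    intro a
    by_contra hni
    have h1 := integral_undef hni
    have h2 := hmgf a
    rw [mgf, h1] at h2
    linarith [Real.exp_pos (c * a ^ 2 / 2)]
  have key : ∀ a : ℝ, a = t / Real.sqrt c ∨ a = -(t / Real.sqrt c) →
      c * a ^ 2 / 2 = t ^ 2 / 2 := by
    rintro a (rfl | rfl)
    · field_simp; rw [Real.sq_sqrt hc'.le, mul_comm]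
    · field_simp; rw [Real.sq_sqrt hc'.le, mul_comm]
  have hup : P.real {ω | t * Real.sqrt c ≤ Z ω} ≤ Real.exp (-(t ^ 2 / 2)) := by
    refine (measure_ge_le_exp_mul_mgf _ (t := t / Real.sqrt c) (by positivity) (hint _)).trans ?_
    rw [hmgf, key _ (Or.inl rfl), ← Real.exp_add]
    refine Real.exp_le_exp.mpr (le_of_eq ?_)
    field_simp
    ring
  have hlo : P.real {ω | Z ω ≤ -(t * Real.sqrt c)} ≤ Real.exp (-(t ^ 2 / 2)) := by
    refine (measure_le_le_exp_mul_mgf _ (t := -(t / Real.sqrt c))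
      (neg_nonpos.mpr (by positivity)) (hint _)).trans ?_
    rw [hmgf, key _ (Or.inr rfl), ← Real.exp_add]
    refine Real.exp_le_exp.mpr (le_of_eq ?_)
    field_simp
    ring
  have hsub : {ω | t * Real.sqrt c < |Z ω|}
      ⊆ {ω | t * Real.sqrt c ≤ Z ω} ∪ {ω | Z ω ≤ -(t * Real.sqrt c)} := by
    intro ω hω
    simp only [Set.mem_union, Set.mem_ofPred_eq]
    rw [Set.mem_ofPred_eq, lt_abs] at hω
    rcases hω with h | h
    · left; linarith
    · right; linarith
  calc P {ω | t * Real.sqrt c < |Z ω|}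
      ≤ P {ω | t * Real.sqrt c ≤ Z ω} + P {ω | Z ω ≤ -(t * Real.sqrt c)} :=
        (measure_mono hsub).trans (measure_union_le _ _)
    _ ≤ ENNReal.ofReal (Real.exp (-(t ^ 2 / 2))) + ENNReal.ofReal (Real.exp (-(t ^ 2 / 2))) := by
        rw [← ofReal_measureReal, ← ofReal_measureReal]
        exact add_le_add (ENNReal.ofReal_le_ofReal hup) (ENNReal.ofReal_le_ofReal hlo)
    _ = _ := by rw [← ENNReal.ofReal_add (Real.exp_pos _).le (Real.exp_pos _).le]; ring_nf

/-! ### Linear combinations of independent Gaussian variables -/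

section LinearCombination

variable {ι : Type*} [Fintype ι] {g : ι → Ω → ℝ} {v : ℝ≥0}

theorem hasGaussianLaw_linearCombination (hlaw : ∀ i, HasLaw (g i) (gaussianReal 0 v) P)
    (hind : iIndepFun g P) {κ : Type*} [Fintype κ] (F : κ → ι → ℝ) :
    HasGaussianLaw (fun ω k => ∑ i, F k i * g i ω) P := by
  have hg : HasGaussianLaw (fun ω => (g · ω)) P :=
    hind.hasGaussianLaw fun i => (hlaw i).hasGaussianLaw
  have := hg.map_fun (LinearMap.toContinuousLinearMap (Matrix.mulVecLin (Matrix.of F)))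
  exact this

theorem memLp_two_of_gaussianReal {Z : Ω → ℝ} (hZ : HasLaw Z (gaussianReal 0 v) P) :
    MemLp Z 2 P := hZ.hasGaussianLaw.memLp_two

variable [IsProbabilityMeasure P]

theorem covariance_linearCombination (hlaw : ∀ i, HasLaw (g i) (gaussianReal 0 v) P)
    (hind : iIndepFun g P) (F G : ι → ℝ) :
    cov[fun ω => ∑ i, F i * g i ω, fun ω => ∑ i, G i * g i ω; P] = v * ∑ i, F i * G i := by
  classical
  have hL : ∀ i, MemLp (g i) 2 P := fun i => memLp_two_of_gaussianReal (hlaw i)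
  rw [covariance_fun_sum_fun_sum (fun i => (hL i).const_mul (F i))
    (fun i => (hL i).const_mul (G i)), Finset.mul_sum]
  refine Finset.sum_congr rfl fun i _ => ?_
  rw [Finset.sum_eq_single i]
  · rw [covariance_const_mul_left, covariance_const_mul_right,
      covariance_self (hlaw i).aemeasurable, (hlaw i).variance_eq, variance_id_gaussianReal]
    ring
  · intro j _ hji
    rw [covariance_const_mul_left, covariance_const_mul_right,
      (hind.indepFun hji.symm).covariance_eq_zero (hL i) (hL j)]
    ring
  · simp

theorem hasLaw_linearCombination (hlaw : ∀ i, HasLaw (g i) (gaussianReal 0 v) P)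
    (hind : iIndepFun g P) (F : ι → ℝ) :
    HasLaw (fun ω => ∑ i, F i * g i ω) (gaussianReal 0 (v * (∑ i, F i ^ 2).toNNReal)) P := by
  have hG : HasGaussianLaw (fun ω => ∑ i, F i * g i ω) P :=
    (hasGaussianLaw_linearCombination hlaw hind (fun _ : Unit => F)).eval ()
  refine ⟨hG.aemeasurable, ?_⟩
  rw [hG.map_eq_gaussianReal]
  congr 1
  · have hI : ∀ i, Integrable (g i) P := fun i => (hlaw i).hasGaussianLaw.integrable
    rw [integral_finsetSum _ fun i _ => (hI i).const_mul _]
    refine Finset.sum_eq_zero fun i _ => ?_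
    rw [integral_const_mul, (hlaw i).integral_eq, integral_id_gaussianReal, mul_zero]
  · rw [← covariance_self hG.aemeasurable, covariance_linearCombination hlaw hind]
    ext
    have h0 : 0 ≤ ∑ i, F i ^ 2 := Finset.sum_nonneg fun i _ => sq_nonneg _
    simp only [← sq]
    rw [Real.coe_toNNReal _ (by positivity), NNReal.coe_mul, Real.coe_toNNReal _ h0]

/-- The combinations are jointly Gaussian, so orthogonality of the coefficient vectors is enough. -/
theorem iIndepFun_linearCombination (hlaw : ∀ i, HasLaw (g i) (gaussianReal 0 v) P)
    (hind : iIndepFun g P) {κ : Type*} [Fintype κ] (F : κ → ι → ℝ)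
    (hF : ∀ k l, k ≠ l → ∑ i, F k i * F l i = 0) :
    iIndepFun (fun k ω => ∑ i, F k i * g i ω) P := by
  refine (hasGaussianLaw_linearCombination hlaw hind F).iIndepFun_of_covariance_eq_zero
    fun k l hkl => ?_
  rw [covariance_linearCombination hlaw hind, hF k l hkl, mul_zero]

theorem measure_abs_linearCombination_gt_le (hlaw : ∀ i, HasLaw (g i) (gaussianReal 0 v) P)
    (hind : iIndepFun g P) (F : ι → ℝ) {t : ℝ} (ht : 0 ≤ t) :
    P {ω | t * Real.sqrt (v * ∑ i, F i ^ 2) < |∑ i, F i * g i ω|}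
      ≤ ENNReal.ofReal (2 * Real.exp (-(t ^ 2 / 2))) := by
  have h0 : 0 ≤ ∑ i, F i ^ 2 := Finset.sum_nonneg fun i _ => sq_nonneg _
  have := measure_abs_gt_le_of_gaussian (hasLaw_linearCombination hlaw hind F) ht
  rwa [NNReal.coe_mul, Real.coe_toNNReal _ h0] at this

end LinearCombination

/-- A linear form in Gaussian variables whose coefficients depend on independent variables. -/
theorem measure_abs_linear_gt_le {ι κ : Type*} [Fintype ι] [Fintype κ] [IsProbabilityMeasure P]
    {f : κ → Ω → ℝ} {g : ι → Ω → ℝ} {v : ℝ≥0}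
    (hf : ∀ k, AEMeasurable (f k) P)
    (hlaw : ∀ i, HasLaw (g i) (gaussianReal 0 v) P) (hind : iIndepFun g P)
    (hfg : IndepFun (fun ω k => f k ω) (fun ω i => g i ω) P)
    {F : (κ → ℝ) → ι → ℝ} (hF : Measurable F) {t : ℝ} (ht : 0 ≤ t) :
    P {ω | t * Real.sqrt (v * ∑ i, F (fun k => f k ω) i ^ 2)
        < |∑ i, F (fun k => f k ω) i * g i ω|}
      ≤ ENNReal.ofReal (2 * Real.exp (-(t ^ 2 / 2))) := by
  have hFi : ∀ i, Measurable fun x : (κ → ℝ) × (ι → ℝ) => F x.1 i := fun i =>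
    (measurable_pi_apply i).comp (hF.comp measurable_fst)
  refine measure_le_of_forall_left (U := fun ω k => f k ω) (V := fun ω i => g i ω)
    (E := {x | t * Real.sqrt (v * ∑ i, F x.1 i ^ 2) < |∑ i, F x.1 i * x.2 i|})
    (aemeasurable_pi_lambda _ hf) (aemeasurable_pi_lambda _ fun i => (hlaw i).aemeasurable) hfg
    ?_ fun u => measure_abs_linearCombination_gt_le hlaw hind (F u) ht
  refine measurableSet_lt ?_ ?_
  · fun_prop
  · exact (Finset.measurable_sum _ fun i _ => (hFi i).mul (by fun_prop)).abs

end

/-! ### The Gram matrix of a Gaussian matrix -/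

section Gram

/-- A random matrix with `d` rows and i.i.d. `N(0, 1/d)` entries. -/
structure IsGaussianMatrix {Ω : Type*} [MeasurableSpace Ω] {p d : ℕ} (P : Measure Ω)
    (A : Ω → Matrix (Fin d) (Fin p) ℝ) : Prop where
  law : ∀ k j, HasLaw (fun ω => A ω k j) (gaussianReal 0 (d : ℝ≥0)⁻¹) P
  indep : iIndepFun (fun (q : Fin d × Fin p) ω => A ω q.1 q.2) P

variable {Ω : Type*} [MeasurableSpace Ω] {P : Measure Ω} {p d : ℕ}
  {A : Ω → Matrix (Fin d) (Fin p) ℝ}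

theorem transpose_mul_self_apply (B : Matrix (Fin d) (Fin p) ℝ) (i j : Fin p) :
    (Bᵀ * B) i j = ∑ a, B a i * B a j := by simp [mul_apply]

theorem sum_column_coeff (K : Finset (Fin p)) (α : Fin d → ℝ) (x : Fin d × K → ℝ) (k : K) :
    ∑ q : Fin d × K, (if q.2 = k then α q.1 else 0) * x q = ∑ a, α a * x (a, k) := by
  rw [Fintype.sum_prod_type]
  refine Finset.sum_congr rfl fun a _ => ?_
  simp

theorem IsGaussianMatrix.indepFun_columns (hA : IsGaussianMatrix P A) {J K : Finset (Fin p)}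
    (hJK : Disjoint J K) :
    IndepFun (fun ω (q : Fin d × J) => A ω q.1 q.2) (fun ω (q : Fin d × K) => A ω q.1 q.2) P := by
  have h := hA.indep.indepFun_finset₀ (Finset.univ ×ˢ J) (Finset.univ ×ˢ K)
    (Finset.disjoint_product.mpr (Or.inr hJK)) (fun q => (hA.law q.1 q.2).aemeasurable)
  exact h.comp
    (φ := fun x (q : Fin d × J) => x ⟨(q.1, q.2.1), by simp⟩)
    (ψ := fun x (q : Fin d × K) => x ⟨(q.1, q.2.1), by simp⟩)
    (measurable_pi_lambda _ fun q => measurable_pi_apply _)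
    (measurable_pi_lambda _ fun q => measurable_pi_apply _)

theorem IsGaussianMatrix.iIndepFun_columns (hA : IsGaussianMatrix P A)
    (K : Finset (Fin p)) : iIndepFun (fun (q : Fin d × K) ω => A ω q.1 q.2) P :=
  hA.indep.precomp (g := fun q : Fin d × K => (q.1, q.2.1)) (by
    rintro ⟨a, k⟩ ⟨b, l⟩ h
    simp only [Prod.mk.injEq] at h
    exact Prod.ext h.1 (Subtype.ext h.2))

variable [IsProbabilityMeasure P]

theorem measure_gram_diag_le (hA : IsGaussianMatrix P A) (hd : 1 ≤ d) (i : Fin p)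
    {δ : ℝ} (hδ0 : 0 ≤ δ) (hδ1 : δ ≤ 1) :
    P {ω | δ < |((A ω)ᵀ * A ω) i i - 1|}
      ≤ ENNReal.ofReal (2 * Real.exp (-(d * δ ^ 2 / 16))) := by
  have h := measure_sum_sq_sub_gt_le (ξ := fun a ω => A ω a i) (fun a => hA.law a i)
    (hA.indep.precomp (g := fun a : Fin d => (a, i)) (fun a b h => (Prod.mk.inj h).1)) hδ0 hδ1
  have hd' : (d : ℝ) ≠ 0 := by positivity
  simp only [Fintype.card_fin, NNReal.coe_inv, NNReal.coe_natCast, mul_inv_cancel₀ hd',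
    mul_one] at h
  convert h using 4
  rw [transpose_mul_self_apply]
  simp only [sq]

/-- Given column `i`, the sum is linear in the entries of the other columns with coefficients `c k *
A a i`, hence conditionally centered Gaussian. -/
theorem measure_gram_row_le (hA : IsGaussianMatrix P A) (i : Fin p) (c : Fin p → ℝ)
    {t : ℝ} (ht : 0 ≤ t) :
    P {ω | t * Real.sqrt ((d : ℝ)⁻¹ * (((A ω)ᵀ * A ω) i i * ∑ k, c k ^ 2))
        < |∑ k ∈ Finset.univ.erase i, c k * ((A ω)ᵀ * A ω) i k|}
      ≤ ENNReal.ofReal (2 * Real.exp (-(t ^ 2 / 2))) := by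
  set K := Finset.univ.erase i with hK
  have h := measure_abs_linear_gt_le
    (f := fun (q : Fin d × ({i} : Finset (Fin p))) ω => A ω q.1 q.2)
    (g := fun (q : Fin d × K) ω => A ω q.1 q.2)
    (fun q => (hA.law _ _).aemeasurable) (fun q => hA.law _ _) (hA.iIndepFun_columns K)
    (hA.indepFun_columns (by simp [hK]))
    (F := fun u q => c q.2 * u (q.1, ⟨i, by simp⟩))
    (measurable_pi_lambda _ fun q => by fun_prop) ht
  refine (measure_mono fun ω hω => ?_).trans h
  rw [Set.mem_ofPred_eq] at hω ⊢
  have e1 : ∑ q : Fin d × K, c q.2 * A ω q.1 i * A ω q.1 q.2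
      = ∑ k ∈ K, c k * ((A ω)ᵀ * A ω) i k := by
    rw [Fintype.sum_prod_type, Finset.sum_comm, ← Finset.sum_coe_sort K]
    refine Finset.sum_congr rfl fun k _ => ?_
    rw [transpose_mul_self_apply, Finset.mul_sum]
    exact Finset.sum_congr rfl fun a _ => by ring
  have e2 : ∑ q : Fin d × K, (c q.2 * A ω q.1 i) ^ 2
      ≤ ((A ω)ᵀ * A ω) i i * ∑ k, c k ^ 2 := by
    have : ∑ q : Fin d × K, (c q.2 * A ω q.1 i) ^ 2
        = ((A ω)ᵀ * A ω) i i * ∑ k ∈ K, c k ^ 2 := by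
      rw [Fintype.sum_prod_type, transpose_mul_self_apply, Finset.sum_mul]
      refine Finset.sum_congr rfl fun a _ => ?_
      rw [Finset.mul_sum, ← Finset.sum_coe_sort K]
      exact Finset.sum_congr rfl fun k _ => by ring
    rw [this]
    refine mul_le_mul_of_nonneg_left ?_ ?_
    · exact Finset.sum_le_sum_of_subset_of_nonneg (Finset.subset_univ _) fun _ _ _ => sq_nonneg _
    · rw [transpose_mul_self_apply]; exact Finset.sum_nonneg fun _ _ => mul_self_nonneg _
  rw [e1]
  refine lt_of_le_of_lt (mul_le_mul_of_nonneg_left (Real.sqrt_le_sqrt ?_) ht) hω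
  rw [NNReal.coe_inv, NNReal.coe_natCast]
  exact mul_le_mul_of_nonneg_left e2 (by positivity)

theorem sum_sq_column_coeff (K : Finset (Fin p)) (α : Fin d → ℝ) (k : K) :
    ∑ q : Fin d × K, (if q.2 = k then α q.1 else 0) ^ 2 = ∑ a, α a ^ 2 := by
  have := sum_column_coeff K α (fun q => if q.2 = k then α q.1 else 0) k
  simp only [if_true] at this
  simpa only [sq] using this

theorem sum_column_coeff_mul_of_ne (K : Finset (Fin p)) (α β : Fin d → ℝ) {k l : K}
    (hkl : k ≠ l) :
    ∑ q : Fin d × K, (if q.2 = k then α q.1 else 0) * (if q.2 = l then β q.1 else 0) = 0 := by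
  rw [sum_column_coeff K α]
  simp [hkl]

/-- Given column `i`, the entries `G_ik` with `k ≠ i` are i.i.d. centered Gaussian of variance `G_ii
/ d`. The chi-square bound is used with relative deviation one and `p - 1` summands. -/
theorem measure_gram_norm_le (hA : IsGaussianMatrix P A) (i : Fin p) :
    P {ω | 2 * (p * ((d : ℝ)⁻¹ * ((A ω)ᵀ * A ω) i i))
        < ∑ k ∈ Finset.univ.erase i, ((A ω)ᵀ * A ω) i k ^ 2}
      ≤ ENNReal.ofReal (2 * Real.exp (-((p - 1) / 16))) := by
  set K := Finset.univ.erase i with hK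
  have hp : 1 ≤ p := Nat.one_le_of_lt i.2
  have hcard : (Fintype.card K : ℝ) = p - 1 := by
    rw [Fintype.card_coe, hK, Finset.card_erase_of_mem (Finset.mem_univ i)]
    simp [Nat.cast_sub hp]
  have h := measure_le_of_forall_left
    (U := fun ω (q : Fin d × ({i} : Finset (Fin p))) => A ω q.1 q.2)
    (V := fun ω (q : Fin d × K) => A ω q.1 q.2)
    (E := {x | 1 * (Fintype.card K * ((d : ℝ)⁻¹ * ∑ a, x.1 (a, ⟨i, by simp⟩) ^ 2))
      < |∑ k : K, (∑ a, x.1 (a, ⟨i, by simp⟩) * x.2 (a, k)) ^ 2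
        - Fintype.card K * ((d : ℝ)⁻¹ * ∑ a, x.1 (a, ⟨i, by simp⟩) ^ 2)|})
    (ε := ENNReal.ofReal (2 * Real.exp (-((p - 1) / 16))))
    (aemeasurable_pi_lambda _ fun q => (hA.law _ _).aemeasurable)
    (aemeasurable_pi_lambda _ fun q => (hA.law _ _).aemeasurable)
    (hA.indepFun_columns (by simp [hK]))
    (measurableSet_lt (by fun_prop) (by fun_prop)) ?_
  · refine (measure_mono fun ω hω => ?_).trans h
    rw [Set.mem_ofPred_eq] at hω
    simp only [Set.mem_ofPred_eq]
    have e1 : ∑ a, A ω a i ^ 2 = ((A ω)ᵀ * A ω) i i := by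
      rw [transpose_mul_self_apply]; simp only [sq]
    have e2 : ∑ k : K, (∑ a, A ω a i * A ω a k) ^ 2 = ∑ k ∈ K, ((A ω)ᵀ * A ω) i k ^ 2 := by
      rw [← Finset.sum_coe_sort K]
      exact Finset.sum_congr rfl fun k _ => by rw [transpose_mul_self_apply]
    rw [e1, e2, hcard]
    have h0 : 0 ≤ (d : ℝ)⁻¹ * ((A ω)ᵀ * A ω) i i := by
      rw [← e1]; positivity
    refine lt_of_lt_of_le ?_ (le_abs_self _)
    linarith
  · intro u
    set α : Fin d → ℝ := fun a => u (a, ⟨i, by simp⟩) with hα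
    have hl := hasLaw_linearCombination
      (g := fun (q : Fin d × K) ω => A ω q.1 q.2) (fun q => hA.law _ _) (hA.iIndepFun_columns K)
    have h := measure_sum_sq_sub_gt_le
      (ξ := fun (k : K) ω => ∑ q : Fin d × K, (if q.2 = k then α q.1 else 0) * A ω q.1 q.2)
      (v := (d : ℝ≥0)⁻¹ * (∑ a, α a ^ 2).toNNReal)
      (fun k => by rw [← sum_sq_column_coeff K α k]; exact hl _)
      (iIndepFun_linearCombination (g := fun (q : Fin d × K) ω => A ω q.1 q.2)
        (fun q => hA.law _ _) (hA.iIndepFun_columns K) _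
        fun k l hkl => sum_column_coeff_mul_of_ne K α α hkl) zero_le_one le_rfl
    have h0 : 0 ≤ ∑ a, α a ^ 2 := Finset.sum_nonneg fun _ _ => sq_nonneg _
    rw [NNReal.coe_mul, Real.coe_toNNReal _ h0, NNReal.coe_inv, NNReal.coe_natCast, one_pow,
      mul_one, hcard] at h
    simp only [sum_column_coeff K α (fun q => A _ q.1 q.2)] at h
    rw [hcard]
    exact h

/-- Given two columns of `A`, bilinear forms in their inner products with the other columns. The
second column enters through its component orthogonal to the first one. -/
theorem measure_gram_bilinear_le (hA : IsGaussianMatrix P A) (M : Matrix (Fin p) (Fin p) ℝ)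
    (i j : Fin p) {t : ℝ} (ht : 0 ≤ t) :
    P {ω | t * Real.sqrt ((d : ℝ)⁻¹ * (((A ω)ᵀ * A ω) j j * ∑ k ∈ {i, j}ᶜ,
            (∑ l ∈ ({i, j} : Finset (Fin p))ᶜ, M k l * ((A ω)ᵀ * A ω) i l) ^ 2))
        < |∑ k ∈ ({i, j} : Finset (Fin p))ᶜ,
            (∑ l ∈ ({i, j} : Finset (Fin p))ᶜ, M k l * ((A ω)ᵀ * A ω) i l)
            * (((A ω)ᵀ * A ω) j k
              - ((A ω)ᵀ * A ω) i j / ((A ω)ᵀ * A ω) i i * ((A ω)ᵀ * A ω) i k)|}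
      ≤ ENNReal.ofReal (2 * Real.exp (-(t ^ 2 / 2))) := by
  set J : Finset (Fin p) := {i, j} with hJ
  set K := Jᶜ with hK
  have hi : i ∈ J := by simp [hJ]
  have hj : j ∈ J := by simp [hJ]
  set α : (Fin d × J → ℝ) → Fin d → ℝ := fun u a => u (a, ⟨i, hi⟩) with hα
  set β : (Fin d × J → ℝ) → Fin d → ℝ := fun u a => u (a, ⟨j, hj⟩)
    - (∑ b, u (b, ⟨i, hi⟩) * u (b, ⟨j, hj⟩)) / (∑ b, u (b, ⟨i, hi⟩) ^ 2) * u (a, ⟨i, hi⟩) with hβ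
  have horth : ∀ u, ∑ a, α u a * β u a = 0 := by
    intro u
    simp only [hα, hβ, mul_sub, Finset.sum_sub_distrib]
    have e : ∑ a, u (a, ⟨i, hi⟩) * ((∑ b, u (b, ⟨i, hi⟩) * u (b, ⟨j, hj⟩))
        / (∑ b, u (b, ⟨i, hi⟩) ^ 2) * u (a, ⟨i, hi⟩))
        = (∑ b, u (b, ⟨i, hi⟩) * u (b, ⟨j, hj⟩)) / (∑ b, u (b, ⟨i, hi⟩) ^ 2)
          * ∑ a, u (a, ⟨i, hi⟩) ^ 2 := by
      rw [Finset.mul_sum]; exact Finset.sum_congr rfl fun a _ => by ring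
    rw [e]
    -- If column `i` vanishes, division by zero gives the multiplier zero and orthogonality is
    -- trivial.
    by_cases h0 : ∑ b, u (b, ⟨i, hi⟩) ^ 2 = 0
    · have hz : ∀ b, u (b, ⟨i, hi⟩) = 0 := fun b =>
        pow_eq_zero_iff (two_ne_zero) |>.mp
          ((Finset.sum_eq_zero_iff_of_nonneg fun _ _ => sq_nonneg _).mp h0 b (Finset.mem_univ b))
      simp [hz]
    · rw [div_mul_cancel₀ _ h0, sub_self]
  have h := measure_le_of_forall_left
    (U := fun ω (q : Fin d × J) => A ω q.1 q.2)
    (V := fun ω (q : Fin d × K) => A ω q.1 q.2)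
    (E := {x | t * Real.sqrt ((d : ℝ)⁻¹ * (∑ a, β x.1 a ^ 2)
        * ∑ k : K, (∑ l : K, M k l * ∑ a, α x.1 a * x.2 (a, l)) ^ 2)
      < |∑ k : K, (∑ l : K, M k l * ∑ a, α x.1 a * x.2 (a, l)) * ∑ a, β x.1 a * x.2 (a, k)|})
    (ε := ENNReal.ofReal (2 * Real.exp (-(t ^ 2 / 2))))
    (aemeasurable_pi_lambda _ fun q => (hA.law _ _).aemeasurable)
    (aemeasurable_pi_lambda _ fun q => (hA.law _ _).aemeasurable)
    (hA.indepFun_columns disjoint_compl_right)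
    (measurableSet_lt (by fun_prop) (by fun_prop)) ?_
  · refine (measure_mono fun ω hω => ?_).trans h
    rw [Set.mem_ofPred_eq] at hω
    simp only [Set.mem_ofPred_eq]
    set G := (A ω)ᵀ * A ω with hG
    set u : Fin d × J → ℝ := fun q => A ω q.1 q.2 with hu
    have e1 : ∀ l : Fin p, ∑ a, α u a * A ω a l = G i l := fun l => by
      rw [hG, transpose_mul_self_apply]
    have e0 : (∑ b, u (b, ⟨i, hi⟩) * u (b, ⟨j, hj⟩)) / (∑ b, u (b, ⟨i, hi⟩) ^ 2)
        = G i j / G i i := by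
      rw [hG, transpose_mul_self_apply, transpose_mul_self_apply]; simp only [sq, hu]
    have hβu : ∀ a, β u a = A ω a j - G i j / G i i * A ω a i := fun a => by rw [← e0]
    have e2 : ∀ l : Fin p, ∑ a, β u a * A ω a l = G j l - G i j / G i i * G i l := fun l => by
      simp only [hβu, sub_mul, Finset.sum_sub_distrib, mul_assoc, ← Finset.mul_sum]
      rw [hG, transpose_mul_self_apply _ j l, transpose_mul_self_apply _ i l]
    have e3 : ∑ a, β u a ^ 2 ≤ G j j := by
      have h1 : ∑ a, β u a ^ 2 = G j j - G i j / G i i * G i j := by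
        have e : ∑ a, β u a ^ 2
            = ∑ a, β u a * A ω a j - G i j / G i i * ∑ a, α u a * β u a := by
          rw [Finset.mul_sum, ← Finset.sum_sub_distrib]
          refine Finset.sum_congr rfl fun a _ => ?_
          have : α u a = A ω a i := rfl
          rw [this, hβu]; ring
        rw [e, horth u, e2]; ring
      have h2 : 0 ≤ G i j / G i i * G i j := by
        rw [div_mul_eq_mul_div]
        refine div_nonneg (mul_self_nonneg _) ?_
        rw [hG, transpose_mul_self_apply]; exact Finset.sum_nonneg fun _ _ => mul_self_nonneg _
      linarith
    have e4 : ∀ k : Fin p, ∑ l : K, M k l * ∑ a, α u a * A ω a l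
        = ∑ l ∈ K, M k l * G i l := fun k => by
      rw [← Finset.sum_coe_sort K]
      exact Finset.sum_congr rfl fun l _ => by rw [e1]
    simp only [e4, e2]
    rw [Finset.sum_coe_sort K fun k => (∑ l ∈ K, M k l * G i l) ^ 2,
      Finset.sum_coe_sort K fun k => (∑ l ∈ K, M k l * G i l) * (G j k - G i j / G i i * G i k)]
    refine lt_of_le_of_lt (mul_le_mul_of_nonneg_left (Real.sqrt_le_sqrt ?_) ht) hω
    rw [mul_assoc]
    refine mul_le_mul_of_nonneg_left (mul_le_mul_of_nonneg_right e3 ?_) (by positivity)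
    exact Finset.sum_nonneg fun _ _ => sq_nonneg _
  · intro u
    have hKlaw : ∀ q : Fin d × K, HasLaw (fun ω => A ω q.1 q.2) (gaussianReal 0 (d : ℝ≥0)⁻¹) P :=
      fun q => hA.law _ _
    have hKind := hA.iIndepFun_columns K
    -- Projections of the remaining columns onto `α u` and onto `β u`, as one family: distinct
    -- columns are independent, and within a column `horth` makes the two projections independent.
    set F : K ⊕ K → Fin d × K → ℝ := fun s q => Sum.elim
      (fun k => if q.2 = k then α u q.1 else 0) (fun k => if q.2 = k then β u q.1 else 0) s with hF
    have hsame : ∀ k : K, ∑ q : Fin d × K, (if q.2 = k then α u q.1 else 0)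
        * (if q.2 = k then β u q.1 else 0) = 0 := fun k => by
      rw [sum_column_coeff K (α u)]; simpa using horth u
    have hFind := iIndepFun_linearCombination (g := fun (q : Fin d × K) ω => A ω q.1 q.2)
      hKlaw hKind F (by
        rintro (k | k) (l | l) hkl
        · exact sum_column_coeff_mul_of_ne K (α u) (α u) fun h => hkl (congrArg _ h)
        · by_cases h : k = l
          · subst h; exact hsame k
          · exact sum_column_coeff_mul_of_ne K (α u) (β u) h
        · by_cases h : k = l
          · subst h
            refine Eq.trans (Finset.sum_congr rfl fun q _ => ?_) (hsame k)
            exact mul_comm _ _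
          · exact sum_column_coeff_mul_of_ne K (β u) (α u) h
        · exact sum_column_coeff_mul_of_ne K (β u) (β u) fun h => hkl (congrArg _ h))
    have hFm : ∀ s, AEMeasurable (fun ω => ∑ q : Fin d × K, F s q * A ω q.1 q.2) P := fun s =>
      (hasLaw_linearCombination (g := fun (q : Fin d × K) ω => A ω q.1 q.2)
        hKlaw hKind (F s)).aemeasurable
    have hpair := (hFind.indepFun_finset₀ (Finset.univ.map ⟨Sum.inl, Sum.inl_injective⟩)
      (Finset.univ.map ⟨Sum.inr, Sum.inr_injective⟩) (by
        rw [Finset.disjoint_left]; simp) hFm).comp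
      (φ := fun x (k : K) => x ⟨Sum.inl k, by simp⟩) (ψ := fun x (k : K) => x ⟨Sum.inr k, by simp⟩)
      (measurable_pi_lambda _ fun q => measurable_pi_apply _)
      (measurable_pi_lambda _ fun q => measurable_pi_apply _)
    have h := measure_abs_linear_gt_le
      (f := fun (k : K) ω => ∑ q : Fin d × K, F (Sum.inl k) q * A ω q.1 q.2)
      (g := fun (k : K) ω => ∑ q : Fin d × K, F (Sum.inr k) q * A ω q.1 q.2)
      (v := (d : ℝ≥0)⁻¹ * (∑ a, β u a ^ 2).toNNReal)
      (fun k => hFm _)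
      (fun k => by
        rw [← sum_sq_column_coeff K (β u) k]
        exact hasLaw_linearCombination (g := fun (q : Fin d × K) ω => A ω q.1 q.2)
          hKlaw hKind (F (Sum.inr k)))
      (hFind.precomp Sum.inr_injective) hpair
      (F := fun x k => ∑ l : K, M k l * x l) (by fun_prop) ht
    have h0 : 0 ≤ ∑ a, β u a ^ 2 := Finset.sum_nonneg fun _ _ => sq_nonneg _
    rw [NNReal.coe_mul, Real.coe_toNNReal _ h0, NNReal.coe_inv, NNReal.coe_natCast] at h
    simp only [hF, Sum.elim_inl, Sum.elim_inr, sum_column_coeff K _ (fun q => A _ q.1 q.2)] at h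
    exact h

end Gram

/-! ### Empirical second moments of the observations -/

section Sampling

variable {Ω : Type*} [MeasurableSpace Ω] {P : Measure Ω} {p d n : ℕ}
  {Sig : Matrix (Fin p) (Fin p) ℝ} {σ : ℝ≥0}

theorem covariance_multivariateGaussian_form (hSig : Sig.PosSemidef)
    {Z : Ω → EuclideanSpace ℝ (Fin p)} (hZ : HasLaw Z (multivariateGaussian 0 Sig) P)
    (b : Fin p → ℝ) :
    cov[fun ω => ∑ j, b j * Z ω j, fun ω => ∑ j, b j * Z ω j; P] = b ⬝ᵥ (Sig *ᵥ b) := by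
  have h1 : (fun ω => ∑ j, b j * Z ω j)
      = fun ω => inner ℝ (WithLp.toLp 2 b) (Z ω) := by
    ext ω; simp [PiLp.inner_apply, mul_comm]
  rw [h1, hZ.covariance_fun_comp (f := fun x => inner ℝ (WithLp.toLp 2 b) x)
    (g := fun x => inner ℝ (WithLp.toLp 2 b) x) (by fun_prop) (by fun_prop),
    ← covarianceBilin_apply_eq_cov IsGaussian.memLp_two_id,
    covarianceBilin_multivariateGaussian hSig]

theorem integral_multivariateGaussian_form
    {Z : Ω → EuclideanSpace ℝ (Fin p)} (hZ : HasLaw Z (multivariateGaussian 0 Sig) P)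
    (b : Fin p → ℝ) : ∫ ω, ∑ j, b j * Z ω j ∂P = 0 := by
  have h1 : (fun ω => ∑ j, b j * Z ω j)
      = fun ω => innerSL ℝ (WithLp.toLp 2 b) (Z ω) := by
    ext ω; simp [PiLp.inner_apply, mul_comm]
  have hZi : Integrable Z P := hZ.hasGaussianLaw.integrable
  rw [h1, ContinuousLinearMap.integral_comp_comm _ hZi, hZ.integral_eq,
    integral_id_multivariateGaussian, map_zero]

variable {A : Ω → Matrix (Fin d) (Fin p) ℝ} {X : Fin n → Ω → EuclideanSpace ℝ (Fin p)}
  {W : Fin n → Ω → Fin d → ℝ}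

theorem IsSensingModel.isGaussianMatrix (h : IsSensingModel P Sig σ A X W) :
    IsGaussianMatrix P A := ⟨h.law_A, h.indep_A⟩

/-- Joint normality over all samples `s`, so that covariances alone decide both the variances and
the independence across `s`. -/
theorem IsSensingModel.hasGaussianLaw_form (h : IsSensingModel P Sig σ A X W)
    (b : Fin p → ℝ) (w : Fin d → ℝ) :
    HasGaussianLaw (fun ω (s : Fin n) => ∑ j, b j * X s ω j + ∑ k, w k * W s ω k) P := by
  have hX : HasGaussianLaw (fun ω s => X s ω) P :=
    h.indep_X.hasGaussianLaw fun s => (h.law_X s).hasGaussianLaw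
  have hW : HasGaussianLaw (fun ω (q : Fin n × Fin d) => W q.1 ω q.2) P :=
    h.indep_W.hasGaussianLaw fun q => (h.law_W q.1 q.2).hasGaussianLaw
  have hXW := h.indep_X_W.hasGaussianLaw hX hW
  let L : (Fin n → EuclideanSpace ℝ (Fin p)) × (Fin n × Fin d → ℝ) →ₗ[ℝ] (Fin n → ℝ) :=
    { toFun := fun x s => ∑ j, b j * x.1 s j + ∑ k, w k * x.2 (s, k)
      map_add' := fun x y => by
        ext s
        simp only [Prod.fst_add, Prod.snd_add, Pi.add_apply, PiLp.add_apply, mul_add,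
          Finset.sum_add_distrib]
        ring
      map_smul' := fun c x => by
        ext s
        simp only [Prod.smul_fst, Prod.smul_snd, Pi.smul_apply, PiLp.smul_apply, smul_eq_mul,
          RingHom.id_apply, mul_add, Finset.mul_sum]
        congr 1 <;> exact Finset.sum_congr rfl fun _ _ => by ring }
  exact hXW.map_fun (LinearMap.toContinuousLinearMap L)

variable [IsProbabilityMeasure P]

theorem IsSensingModel.covariance_form (h : IsSensingModel P Sig σ A X W) (hSig : Sig.PosSemidef)
    (b : Fin p → ℝ) (w : Fin d → ℝ) (s s' : Fin n) :
    cov[fun ω => ∑ j, b j * X s ω j + ∑ k, w k * W s ω k,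
      fun ω => ∑ j, b j * X s' ω j + ∑ k, w k * W s' ω k; P]
      = if s = s' then b ⬝ᵥ (Sig *ᵥ b) + σ ^ 2 * ∑ k, w k ^ 2 else 0 := by
  classical
  set f : Fin n → Ω → ℝ := fun s ω => ∑ j, b j * X s ω j with hf
  set g : Fin n → Ω → ℝ := fun s ω => ∑ k, w k * W s ω k with hg
  have hfL : ∀ s, MemLp (f s) 2 P := fun s => by
    have h1 : f s = fun ω => innerSL ℝ (WithLp.toLp 2 b) (X s ω) := by
      ext ω; simp [hf, PiLp.inner_apply, mul_comm]
    rw [h1]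
    exact ((h.law_X s).hasGaussianLaw.map_fun (innerSL ℝ (WithLp.toLp 2 b))).memLp_two
  set F : Fin n → Fin n × Fin d → ℝ := fun s q => if q.1 = s then w q.2 else 0 with hF
  have hgF : ∀ s, g s = fun ω => ∑ q : Fin n × Fin d, F s q * W q.1 ω q.2 := fun s => by
    ext ω
    rw [Fintype.sum_prod_type, Finset.sum_eq_single s]
    · simp [hg, hF]
    · intro a _ ha; simp [hF, ha]
    · simp
  have hWlaw : ∀ q : Fin n × Fin d, HasLaw (fun ω => W q.1 ω q.2) (gaussianReal 0 (σ ^ 2)) P :=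
    fun q => h.law_W q.1 q.2
  have hgL : ∀ s, MemLp (g s) 2 P := fun s => by
    rw [hgF]
    exact memLp_two_of_gaussianReal
      (hasLaw_linearCombination (g := fun (q : Fin n × Fin d) ω => W q.1 ω q.2)
        hWlaw h.indep_W (F s))
  have hfg : ∀ s s', cov[f s, g s'; P] = 0 := fun s s' => by
    refine IndepFun.covariance_eq_zero ?_ (hfL s) (hgL s')
    exact h.indep_X_W.comp (φ := fun x => ∑ j, b j * x s j)
      (ψ := fun y => ∑ k, w k * y (s', k)) (by fun_prop) (by fun_prop)
  have hgg : cov[g s, g s'; P] = if s = s' then (σ : ℝ) ^ 2 * ∑ k, w k ^ 2 else 0 := by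
    rw [hgF, hgF, covariance_linearCombination (g := fun (q : Fin n × Fin d) ω => W q.1 ω q.2)
      hWlaw h.indep_W, Fintype.sum_prod_type, Finset.sum_eq_single s]
    · split_ifs with hs
      · subst hs; simp [hF, sq]
      · simp [hF, hs]
    · intro a _ ha; simp [hF, ha]
    · simp
  have hff : cov[f s, f s'; P] = if s = s' then b ⬝ᵥ (Sig *ᵥ b) else 0 := by
    split_ifs with hs
    · subst hs; exact covariance_multivariateGaussian_form hSig (h.law_X s) b
    · refine IndepFun.covariance_eq_zero ?_ (hfL s) (hfL s')
      exact (h.indep_X.indepFun hs).comp (φ := fun x : EuclideanSpace ℝ (Fin p) => ∑ j, b j * x j)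
        (ψ := fun x : EuclideanSpace ℝ (Fin p) => ∑ j, b j * x j) (by fun_prop) (by fun_prop)
  change cov[f s + g s, f s' + g s'; P] = _
  rw [covariance_add_left (hfL s) (hgL s) ((hfL s').add (hgL s')),
    covariance_add_right (hfL s) (hfL s') (hgL s'), covariance_add_right (hgL s) (hfL s') (hgL s'),
    hfg, covariance_comm (g s) (f s'), hfg, hff, hgg]
  split_ifs <;> ring

theorem IsSensingModel.measure_form_le (h : IsSensingModel P Sig σ A X W) (hSig : Sig.PosSemidef)
    (b : Fin p → ℝ) (w : Fin d → ℝ) {δ : ℝ} (hδ0 : 0 ≤ δ) (hδ1 : δ ≤ 1) :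
    P {ω | δ * (n * (b ⬝ᵥ (Sig *ᵥ b) + σ ^ 2 * ∑ k, w k ^ 2))
        < |∑ s, (∑ j, b j * X s ω j + ∑ k, w k * W s ω k) ^ 2
          - n * (b ⬝ᵥ (Sig *ᵥ b) + σ ^ 2 * ∑ k, w k ^ 2)|}
      ≤ ENNReal.ofReal (2 * Real.exp (-(n * δ ^ 2 / 16))) := by
  set V := b ⬝ᵥ (Sig *ᵥ b) + σ ^ 2 * ∑ k, w k ^ 2 with hV
  have hV0 : 0 ≤ V := by
    have : 0 ≤ b ⬝ᵥ (Sig *ᵥ b) := by simpa using hSig.dotProduct_mulVec_nonneg b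
    positivity
  have hG := h.hasGaussianLaw_form b w
  have hlaw : ∀ s, HasLaw (fun ω => ∑ j, b j * X s ω j + ∑ k, w k * W s ω k)
      (gaussianReal 0 V.toNNReal) P := fun s => by
    have hs : HasGaussianLaw (fun ω => ∑ j, b j * X s ω j + ∑ k, w k * W s ω k) P := hG.eval s
    refine ⟨hs.aemeasurable, ?_⟩
    rw [hs.map_eq_gaussianReal]
    congr 1
    · have hWi : ∀ k, Integrable (fun ω => W s ω k) P := fun k =>
        (h.law_W s k).hasGaussianLaw.integrable
      have hi1 : Integrable (fun ω => ∑ j, b j * X s ω j) P := by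
        have h1 : (fun ω => ∑ j, b j * X s ω j)
            = fun ω => innerSL ℝ (WithLp.toLp 2 b) (X s ω) := by
          ext ω; simp [PiLp.inner_apply, mul_comm]
        rw [h1]
        exact ((h.law_X s).hasGaussianLaw.map_fun (innerSL ℝ (WithLp.toLp 2 b))).integrable
      rw [integral_add hi1 (integrable_finsetSum _ fun k _ => (hWi k).const_mul _),
        integral_multivariateGaussian_form (h.law_X s), zero_add,
        integral_finsetSum _ fun k _ => (hWi k).const_mul _]
      refine Finset.sum_eq_zero fun k _ => ?_
      rw [integral_const_mul, (h.law_W s k).integral_eq, integral_id_gaussianReal, mul_zero]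
    · rw [← covariance_self hs.aemeasurable, h.covariance_form hSig, if_pos rfl]
  have hind : iIndepFun (fun (s : Fin n) ω => ∑ j, b j * X s ω j + ∑ k, w k * W s ω k) P :=
    hG.iIndepFun_of_covariance_eq_zero fun s s' hss => by
      rw [h.covariance_form hSig, if_neg hss]
  have := measure_sum_sq_sub_gt_le hlaw hind hδ0 hδ1
  rwa [Real.coe_toNNReal _ hV0, Fintype.card_fin] at this

theorem dotProduct_observe (B : Matrix (Fin d) (Fin p) ℝ) (x : EuclideanSpace ℝ (Fin p))
    (y w : Fin d → ℝ) :
    w ⬝ᵥ observe B x y = ∑ j, (Bᵀ *ᵥ w) j * x j + ∑ k, w k * y k := by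
  rw [observe, dotProduct_add, dotProduct_mulVec, ← mulVec_transpose]
  rfl

/-- Conditionally on `A`, the empirical second moment of the observations in a direction that
depends on `A` is close to its conditional mean. -/
theorem IsSensingModel.measure_observe_le (h : IsSensingModel P Sig σ A X W)
    (hSig : Sig.PosSemidef) (i j : Fin p) (c : ℝ) {δ : ℝ} (hδ0 : 0 ≤ δ) (hδ1 : δ ≤ 1) :
    P {ω | δ * (n * ((((A ω)ᵀ *ᵥ fun k => A ω k i + c * A ω k j) ⬝ᵥ
              (Sig *ᵥ ((A ω)ᵀ *ᵥ fun k => A ω k i + c * A ω k j)))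
            + σ ^ 2 * ∑ k, (A ω k i + c * A ω k j) ^ 2))
        < |∑ s, ((fun k => A ω k i + c * A ω k j) ⬝ᵥ observe (A ω) (X s ω) (W s ω)) ^ 2
          - n * ((((A ω)ᵀ *ᵥ fun k => A ω k i + c * A ω k j) ⬝ᵥ
              (Sig *ᵥ ((A ω)ᵀ *ᵥ fun k => A ω k i + c * A ω k j)))
            + σ ^ 2 * ∑ k, (A ω k i + c * A ω k j) ^ 2)|}
      ≤ ENNReal.ofReal (2 * Real.exp (-(n * δ ^ 2 / 16))) := by
  set b : (Fin d × Fin p → ℝ) → Fin p → ℝ :=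
    fun u l => ∑ k, u (k, l) * (u (k, i) + c * u (k, j)) with hb
  have key := measure_le_of_forall_left
    (U := fun ω (q : Fin d × Fin p) => A ω q.1 q.2)
    (V := fun ω => ((fun s => X s ω), (fun (q : Fin n × Fin d) => W q.1 ω q.2)))
    (E := {x | δ * (n * (b x.1 ⬝ᵥ (Sig *ᵥ b x.1)
            + σ ^ 2 * ∑ k, (x.1 (k, i) + c * x.1 (k, j)) ^ 2))
        < |∑ s, (∑ l, b x.1 l * x.2.1 s l
            + ∑ k, (x.1 (k, i) + c * x.1 (k, j)) * x.2.2 (s, k)) ^ 2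
          - n * (b x.1 ⬝ᵥ (Sig *ᵥ b x.1)
            + σ ^ 2 * ∑ k, (x.1 (k, i) + c * x.1 (k, j)) ^ 2)|})
    (aemeasurable_pi_lambda _ fun q => (h.law_A _ _).aemeasurable)
    ((aemeasurable_pi_lambda _ fun s => (h.law_X s).aemeasurable).prodMk
      (aemeasurable_pi_lambda _ fun q => (h.law_W _ _).aemeasurable))
    h.indep_A_XW
    (by
      simp only [dotProduct, mulVec, hb]
      exact measurableSet_lt (by fun_prop) (by fun_prop))
    (fun u => h.measure_form_le hSig (b u) (fun k => u (k, i) + c * u (k, j)) hδ0 hδ1)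
  simp only [dotProduct_observe]
  exact key

end Sampling

/-! ### The error of the covariance estimator on the concentration event -/

section Deterministic

variable {p : ℕ} {G Sig : Matrix (Fin p) (Fin p) ℝ} {δ ε ν : ℝ}

/-- Linear forms of the off-diagonal part of a Gram matrix whose coefficients are rows of `M` with
one further entry deleted are small. -/
def RowBound (G M : Matrix (Fin p) (Fin p) ℝ) (ε : ℝ) : Prop :=
  ∀ i j a, |∑ k ∈ ({i, j} : Finset (Fin p))ᶜ, M a k * G i k| ≤ 2 * ε * √(∑ k, M a k ^ 2)

/-- The concentration properties of a Gram matrix `G = AᵀA`. -/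
structure IsGoodGram (G Sig B : Matrix (Fin p) (Fin p) ℝ) (δ ε ν : ℝ) : Prop where
  symm : ∀ i j, G i j = G j i
  diag : ∀ i, |G i i - 1| ≤ δ
  row_one : RowBound G 1 ε
  row_sig : RowBound G Sig ε
  row_off : RowBound G (offPart Sig) ε
  row_root : RowBound G B ε
  norm : ∀ i, ∑ k ∈ ({i} : Finset (Fin p))ᶜ, G i k ^ 2 ≤ 4 * ν
  bilinear : ∀ i j, i ≠ j →
    |∑ k ∈ ({i, j} : Finset (Fin p))ᶜ, (∑ l ∈ ({i, j} : Finset (Fin p))ᶜ, Sig k l * G i l)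
        * (G j k - G i j / G i i * G i k)|
      ≤ 2 * ε * √(∑ k ∈ ({i, j} : Finset (Fin p))ᶜ,
          (∑ l ∈ ({i, j} : Finset (Fin p))ᶜ, Sig k l * G i l) ^ 2)

theorem sum_eq_add_add_sum_compl_pair {i j : Fin p} (hij : i ≠ j) (f : Fin p → ℝ) :
    ∑ k, f k = f i + f j + ∑ k ∈ ({i, j} : Finset (Fin p))ᶜ, f k := by
  rw [← Finset.sum_add_sum_compl {i, j} f, Finset.sum_pair hij]

theorem abs_apply_le_one (hSig : Sig.PosDef) (hdiag : ∀ i, Sig i i = 1) (i j : Fin p) :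
    |Sig i j| ≤ 1 := by
  by_cases hij : i = j
  · subst hij; simp [hdiag]
  · obtain ⟨B, hB⟩ := exists_transpose_mul_self hSig.posSemidef
    have h1 : ∀ a b, Sig a b = ∑ k, B k a * B k b := fun a b => by
      rw [hB, Matrix.mul_apply]; simp [Matrix.transpose_apply]
    have h2 := Finset.sum_mul_sq_le_sq_mul_sq Finset.univ (fun k => B k i) (fun k => B k j)
    have h3 : ∑ k, B k i ^ 2 = 1 := by rw [← hdiag i, h1]; simp [sq]
    have h4 : ∑ k, B k j ^ 2 = 1 := by rw [← hdiag j, h1]; simp [sq]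
    rw [← h1, h3, h4] at h2
    exact abs_le_one_iff_mul_self_le_one.2 (by nlinarith)

theorem sqrt_sum_sq_row_le_maxColNorm (hSig : Sig.PosDef) (a : Fin p) :
    √(∑ k, Sig a k ^ 2) ≤ maxColNorm Sig := by
  have : ∑ k, Sig a k ^ 2 = ∑ k, Sig k a ^ 2 :=
    Finset.sum_congr rfl fun k _ => by rw [apply_comm_of_posDef hSig]
  rw [this]
  exact le_ciSup (f := fun j => √(∑ i, Sig i j ^ 2)) (Set.finite_range _).bddAbove a

theorem one_le_maxColNorm (hdiag : ∀ i, Sig i i = 1) (i : Fin p) : 1 ≤ maxColNorm Sig := by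
  refine le_trans ?_ (le_ciSup (f := fun j => √(∑ i, Sig i j ^ 2))
    (Set.finite_range _).bddAbove i)
  rw [Real.one_le_sqrt]
  calc (1 : ℝ) = Sig i i ^ 2 := by simp [hdiag]
    _ ≤ ∑ k, Sig k i ^ 2 :=
      Finset.single_le_sum (f := fun k => Sig k i ^ 2) (fun _ _ => sq_nonneg _) (Finset.mem_univ i)

variable {B : Matrix (Fin p) (Fin p) ℝ}

/-- A single entry is the linear form whose coefficients are a row of the identity. -/
theorem IsGoodGram.abs_apply_le (h : IsGoodGram G Sig B δ ε ν) {i j : Fin p} (hij : i ≠ j) :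
    |G i j| ≤ 2 * ε := by
  have := h.row_one i i j
  simpa [Matrix.one_apply, hij, Ne.symm hij, ite_pow] using this

/-- The bilinear form of the parts of two rows of `G` outside `{i, j}`. -/
theorem IsGoodGram.abs_cross_le (h : IsGoodGram G Sig B δ ε ν) (hdiag : ∀ i, Sig i i = 1)
    (hδ : δ ≤ 1 / 2) (hε : 0 ≤ ε) (hν : 0 ≤ ν) {i j : Fin p} (hij : i ≠ j) :
    |∑ k ∈ ({i, j} : Finset (Fin p))ᶜ, (∑ l ∈ ({i, j} : Finset (Fin p))ᶜ, Sig k l * G i l) * G j k|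
      ≤ 4 * ε * (2 * √ν + 2 * ε * offFrobenius Sig) * (1 + 4 * √ν) := by
  set K : Finset (Fin p) := ({i, j} : Finset (Fin p))ᶜ with hK
  set x : Fin p → ℝ := fun k => ∑ l ∈ K, Sig k l * G i l with hx
  set F := offFrobenius Sig with hF
  have hF0 : 0 ≤ F := Real.sqrt_nonneg _
  set y : Fin p → ℝ := fun k => ∑ l ∈ K, offPart Sig k l * G i l with hy
  -- The unit diagonal of `Sig` splits `x` into the row of `G` itself, of norm at most `2√ν`, and a
  -- part governed by the off-diagonal Frobenius norm.
  have hxy : ∀ k ∈ K, x k = G i k + y k := fun k hk => by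
    have h1 : ∀ l, Sig k l * G i l = (if l = k then G i k else 0) + offPart Sig k l * G i l := by
      intro l
      by_cases hl : l = k
      · subst hl; simp [offPart, hdiag]
      · simp [offPart, hl, Ne.symm hl]
    simp only [hx, hy, h1, Finset.sum_add_distrib, Finset.sum_ite_eq', hk, if_true]
  have hu2 : ∑ k ∈ K, G i k ^ 2 ≤ (2 * √ν) ^ 2 := by
    rw [mul_pow, Real.sq_sqrt hν]
    refine le_trans (Finset.sum_le_sum_of_subset_of_nonneg ?_ fun _ _ _ => sq_nonneg _)
      ((h.norm i).trans_eq (by ring))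
    intro k hk
    simp only [hK, Finset.mem_compl, Finset.mem_insert, Finset.mem_singleton, not_or] at hk ⊢
    exact hk.1
  -- Each coordinate of `y` is a linear form with a row of `offPart Sig`; the squared row norms sum
  -- to the squared Frobenius norm.
  have hy2 : ∑ k ∈ K, y k ^ 2 ≤ (2 * ε * F) ^ 2 := by
    calc ∑ k ∈ K, y k ^ 2 ≤ ∑ k ∈ K, (2 * ε) ^ 2 * ∑ l, offPart Sig k l ^ 2 := by
          refine Finset.sum_le_sum fun k _ => ?_
          have h1 := h.row_off i j k
          calc y k ^ 2 = |y k| ^ 2 := (sq_abs _).symm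
            _ ≤ (2 * ε * √(∑ l, offPart Sig k l ^ 2)) ^ 2 := by gcongr
            _ = _ := by rw [mul_pow, Real.sq_sqrt (Finset.sum_nonneg fun _ _ => sq_nonneg _)]
      _ ≤ ∑ k, (2 * ε) ^ 2 * ∑ l, offPart Sig k l ^ 2 :=
          Finset.sum_le_sum_of_subset_of_nonneg (Finset.subset_univ _) fun k _ _ =>
            mul_nonneg (sq_nonneg _) (Finset.sum_nonneg fun _ _ => sq_nonneg _)
      _ = (2 * ε * F) ^ 2 := by
          rw [← Finset.mul_sum, mul_pow (2 * ε), hF, offFrobenius, Real.sq_sqrt]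
          exact Finset.sum_nonneg fun _ _ => Finset.sum_nonneg fun _ _ => sq_nonneg _
  set U := 2 * √ν with hU
  set Y := 2 * ε * F with hY
  have hU0 : 0 ≤ U := by positivity
  have hY0 : 0 ≤ Y := by positivity
  have hx2 : ∑ k ∈ K, x k ^ 2 ≤ (2 * (U + Y)) ^ 2 := by
    calc ∑ k ∈ K, x k ^ 2 ≤ ∑ k ∈ K, (2 * G i k ^ 2 + 2 * y k ^ 2) := by
          refine Finset.sum_le_sum fun k hk => ?_
          rw [hxy k hk]; nlinarith [sq_nonneg (G i k - y k)]
      _ = 2 * ∑ k ∈ K, G i k ^ 2 + 2 * ∑ k ∈ K, y k ^ 2 := by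
          rw [Finset.sum_add_distrib, Finset.mul_sum, Finset.mul_sum]
      _ ≤ (2 * (U + Y)) ^ 2 := by nlinarith [mul_nonneg hU0 hY0, sq_nonneg U, sq_nonneg Y]
  have hsx : √(∑ k ∈ K, x k ^ 2) ≤ 2 * (U + Y) := Real.sqrt_le_iff.2 ⟨by positivity, hx2⟩
  have hsu : √(∑ k ∈ K, G i k ^ 2) ≤ U := Real.sqrt_le_iff.2 ⟨by positivity, hu2⟩
  have hxu : |∑ k ∈ K, x k * G i k| ≤ 2 * (U + Y) * U := by
    refine (abs_le_of_sq_le_sq (b := √(∑ k ∈ K, x k ^ 2) * √(∑ k ∈ K, G i k ^ 2)) ?_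
      (by positivity)).trans (by gcongr)
    rw [mul_pow, Real.sq_sqrt (Finset.sum_nonneg fun _ _ => sq_nonneg _),
      Real.sq_sqrt (Finset.sum_nonneg fun _ _ => sq_nonneg _)]
    exact Finset.sum_mul_sq_le_sq_mul_sq _ _ _
  have hbil : |∑ k ∈ K, x k * (G j k - G i j / G i i * G i k)| ≤ 2 * ε * (2 * (U + Y)) :=
    (h.bilinear i j hij).trans (by gcongr)
  have hGi : 1 / 2 ≤ G i i := by have := (abs_le.1 (h.diag i)).1; linarith
  have hr : |G i j / G i i| ≤ 4 * ε := by
    rw [abs_div, abs_of_pos (by linarith : (0 : ℝ) < G i i), div_le_iff₀ (by linarith)]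
    have := h.abs_apply_le hij
    nlinarith
  -- Undoing the orthogonalization costs a multiple of row `i`, with a coefficient of order `ε`,
  -- paired with `x` by Cauchy–Schwarz.
  have hsplit : ∑ k ∈ K, x k * G j k = ∑ k ∈ K, x k * (G j k - G i j / G i i * G i k)
      + G i j / G i i * ∑ k ∈ K, x k * G i k := by
    rw [Finset.mul_sum, ← Finset.sum_add_distrib]
    exact Finset.sum_congr rfl fun _ _ => by ring
  rw [hsplit]
  calc |∑ k ∈ K, x k * (G j k - G i j / G i i * G i k) + G i j / G i i * ∑ k ∈ K, x k * G i k|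
      ≤ 2 * ε * (2 * (U + Y)) + 4 * ε * (2 * (U + Y) * U) := by
        refine (abs_add_le _ _).trans (add_le_add hbil ?_)
        rw [abs_mul]; gcongr
    _ = 4 * ε * (U + Y) * (1 + 4 * √ν) := by rw [hU]; ring

/-- The bilinear form of two rows of `G` estimates the entry of `Sig`. -/
theorem IsGoodGram.abs_form_sub_le (h : IsGoodGram G Sig B δ ε ν) (hSig : Sig.PosDef)
    (hdiag : ∀ i, Sig i i = 1) (hδ : δ ≤ 1 / 2) (hε : 0 ≤ ε) (hε1 : ε ≤ 1 / 4) (hν : 0 ≤ ν)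
    {i j : Fin p} (hij : i ≠ j) :
    |G i ⬝ᵥ (Sig *ᵥ G j) - Sig i j| ≤ 3 * δ + 19 * ε * maxColNorm Sig
      + 4 * ε * (2 * √ν + 2 * ε * offFrobenius Sig) * (1 + 4 * √ν) := by
  have hsymS := apply_comm_of_posDef hSig
  set K : Finset (Fin p) := ({i, j} : Finset (Fin p))ᶜ with hK
  have hK' : ({j, i} : Finset (Fin p))ᶜ = K := by rw [hK, Finset.pair_comm]
  set ρ := G i j with hρ
  have hji : G j i = ρ := h.symm j i
  -- Expansion with the indices `i` and `j` separated from `K`: the main term, terms in `ρ = G i j`,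
  -- four linear forms, and the cross form.
  have hexp : G i ⬝ᵥ (Sig *ᵥ G j) = (G i i * G j j + ρ ^ 2) * Sig i j + ρ * (G i i + G j j)
      + G i i * (∑ k ∈ K, Sig i k * G j k) + ρ * (∑ k ∈ K, Sig j k * G j k)
      + G j j * (∑ k ∈ K, Sig j k * G i k) + ρ * (∑ k ∈ K, Sig i k * G i k)
      + ∑ k ∈ K, (∑ l ∈ K, Sig k l * G i l) * G j k := by
    have hcross : ∑ k ∈ K, (∑ l ∈ K, Sig k l * G i l) * G j k
        = ∑ k ∈ K, G i k * ∑ l ∈ K, Sig k l * G j l := by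
      simp_rw [Finset.sum_mul, Finset.mul_sum]
      rw [Finset.sum_comm]
      exact Finset.sum_congr rfl fun k _ => Finset.sum_congr rfl fun l _ => by
        rw [hsymS l k]; ring
    have h1 : ∀ k, (Sig *ᵥ G j) k = Sig k i * ρ + Sig k j * G j j + ∑ l ∈ K, Sig k l * G j l :=
      fun k => by
        rw [Matrix.mulVec, dotProduct, sum_eq_add_add_sum_compl_pair hij, hji]
    have h2 : ∑ k ∈ K, G i k * (Sig *ᵥ G j) k
        = ρ * (∑ k ∈ K, Sig i k * G i k) + G j j * (∑ k ∈ K, Sig j k * G i k)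
          + ∑ k ∈ K, G i k * ∑ l ∈ K, Sig k l * G j l := by
      rw [Finset.mul_sum, Finset.mul_sum, ← Finset.sum_add_distrib, ← Finset.sum_add_distrib]
      exact Finset.sum_congr rfl fun k _ => by rw [h1, hsymS k i, hsymS k j]; ring
    rw [dotProduct, sum_eq_add_add_sum_compl_pair hij, h2, h1, h1, hcross, hdiag, hdiag,
      hsymS j i]
    ring
  set m := maxColNorm Sig with hm
  have hm1 : 1 ≤ m := one_le_maxColNorm hdiag i
  have hrow : ∀ a b c, |∑ k ∈ ({a, b} : Finset (Fin p))ᶜ, Sig c k * G a k| ≤ 2 * ε * m :=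
    fun a b c => (h.row_sig a b c).trans (by
      gcongr; exact sqrt_sum_sq_row_le_maxColNorm hSig c)
  have e1 := hrow j i i
  have e2 := hrow j i j
  have e3 := hrow i j j
  have e4 := hrow i j i
  rw [hK'] at e1 e2
  have e5 := h.abs_cross_le hdiag hδ hε hν hij
  have hρ1 : |ρ| ≤ 2 * ε := h.abs_apply_le hij
  have hS := abs_apply_le_one hSig hdiag i j
  have hi := h.diag i
  have hj := h.diag j
  have hδ0 : 0 ≤ δ := (abs_nonneg _).trans hi
  have hi2 : |G i i| ≤ 3 / 2 := by
    rw [abs_le] at hi ⊢; constructor <;> linarith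
  have hj2 : |G j j| ≤ 3 / 2 := by
    rw [abs_le] at hj ⊢; constructor <;> linarith
  have hprod : |(G i i * G j j - 1) * Sig i j| ≤ 3 * δ := by
    have h3 : G i i * G j j - 1 = (G i i - 1) * G j j + (G j j - 1) := by ring
    rw [abs_mul, h3]
    calc |(G i i - 1) * G j j + (G j j - 1)| * |Sig i j|
        ≤ (|G i i - 1| * |G j j| + |G j j - 1|) * 1 := by
          gcongr; exact (abs_add_le _ _).trans (by rw [abs_mul])
      _ ≤ (δ * (3 / 2) + δ) * 1 := by gcongr
      _ ≤ 3 * δ := by linarith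
  have hsq : |ρ ^ 2 * Sig i j| ≤ ε := by
    rw [abs_mul, abs_pow]
    calc |ρ| ^ 2 * |Sig i j| ≤ (2 * ε) ^ 2 * 1 := by gcongr
      _ ≤ ε := by nlinarith
  have hlin : |ρ * (G i i + G j j)| ≤ 2 * ε * 3 := by
    rw [abs_mul]; gcongr
    exact (abs_add_le _ _).trans (by linarith)
  have hρ2 : |ρ| ≤ 1 / 2 := by linarith
  have f1 : |G i i * (∑ k ∈ K, Sig i k * G j k)| ≤ 3 / 2 * (2 * ε * m) := by
    rw [abs_mul]; gcongr
  have f2 : |ρ * (∑ k ∈ K, Sig j k * G j k)| ≤ 1 / 2 * (2 * ε * m) := by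
    rw [abs_mul]; gcongr
  have f3 : |G j j * (∑ k ∈ K, Sig j k * G i k)| ≤ 3 / 2 * (2 * ε * m) := by
    rw [abs_mul]; gcongr
  have f4 : |ρ * (∑ k ∈ K, Sig i k * G i k)| ≤ 1 / 2 * (2 * ε * m) := by
    rw [abs_mul]; gcongr
  have hεm : ε ≤ ε * m := le_mul_of_one_le_right hε hm1
  rw [hexp, abs_le]
  rw [abs_le] at hprod hsq hlin f1 f2 f3 f4 e5
  constructor <;> linarith [hprod.1, hprod.2]

/-- The quadratic form of a row of `G`. -/
theorem IsGoodGram.form_self_le (h : IsGoodGram G Sig B δ ε ν) (hB : Sig = Bᵀ * B)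
    (hdiag : ∀ i, Sig i i = 1) (hδ : δ ≤ 1 / 2) (i : Fin p) :
    G i ⬝ᵥ (Sig *ᵥ G i) ≤ 8 + 8 * ε ^ 2 * p := by
  have hSB : ∀ a b, Sig a b = ∑ k, B k a * B k b := fun a b => by
    rw [hB, Matrix.mul_apply]; simp [Matrix.transpose_apply]
  have h1 : G i ⬝ᵥ (Sig *ᵥ G i) = ∑ k, (B *ᵥ G i) k ^ 2 := by
    rw [hB, ← Matrix.mulVec_mulVec, Matrix.dotProduct_mulVec, Matrix.vecMul_transpose,
      dotProduct]
    exact Finset.sum_congr rfl fun _ _ => (sq _).symm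
  have hcol : ∀ a, ∑ k, B k a ^ 2 = 1 := fun a => by rw [← hdiag a, hSB]; simp [sq]
  have hi := abs_le.1 (h.diag i)
  -- Summed over `k`, the first part gives `8`, and the second `8 ε² p` because all columns of `B`
  -- are unit vectors.
  have h2 : ∀ k, (B *ᵥ G i) k ^ 2 ≤ 8 * B k i ^ 2 + 8 * ε ^ 2 * ∑ l, B k l ^ 2 := fun k => by
    have h3 : (B *ᵥ G i) k = B k i * G i i + ∑ l ∈ ({i, i} : Finset (Fin p))ᶜ, B k l * G i l := by
      rw [Matrix.mulVec, dotProduct, ← Finset.sum_add_sum_compl {i, i}]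
      simp
    have h4 := h.row_root i i k
    set z := ∑ l ∈ ({i, i} : Finset (Fin p))ᶜ, B k l * G i l
    have h5 : z ^ 2 ≤ 4 * ε ^ 2 * ∑ l, B k l ^ 2 := by
      rw [← sq_abs z]
      calc |z| ^ 2 ≤ (2 * ε * √(∑ l, B k l ^ 2)) ^ 2 := by gcongr
        _ = _ := by
          rw [mul_pow, Real.sq_sqrt (Finset.sum_nonneg fun _ _ => sq_nonneg _)]; ring
    have h6 : G i i ^ 2 ≤ 4 := by nlinarith
    rw [h3]
    nlinarith [sq_nonneg (B k i * G i i - z), mul_nonneg (sq_nonneg (B k i)) (sub_nonneg.2 h6)]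
  rw [h1]
  refine (Finset.sum_le_sum fun k _ => h2 k).trans (le_of_eq ?_)
  rw [Finset.sum_add_distrib, ← Finset.mul_sum, ← Finset.mul_sum, hcol, Finset.sum_comm]
  simp [hcol]

end Deterministic

/-! ### From Gram matrix and sample concentration to the covariance estimator. -/

section Estimator

variable {p d n : ℕ} {Sig B : Matrix (Fin p) (Fin p) ℝ} {δ ε ν δ' σ : ℝ}
  {A : Matrix (Fin d) (Fin p) ℝ} {y : Fin n → Fin d → ℝ}

/-- The conditional variance, given `A`, of the observation in the direction `a_i + c a_j`. -/
noncomputable def directionVariance (Sig : Matrix (Fin p) (Fin p) ℝ) (σ : ℝ)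
    (A : Matrix (Fin d) (Fin p) ℝ) (i j : Fin p) (c : ℝ) : ℝ :=
  ((Aᵀ *ᵥ fun k => A k i + c * A k j) ⬝ᵥ (Sig *ᵥ (Aᵀ *ᵥ fun k => A k i + c * A k j)))
    + σ ^ 2 * ∑ k, (A k i + c * A k j) ^ 2

/-- The empirical second moment in the direction `a_i + c a_j` is close to its conditional mean. -/
def IsGoodSample (Sig : Matrix (Fin p) (Fin p) ℝ) (σ : ℝ) (A : Matrix (Fin d) (Fin p) ℝ)
    (y : Fin n → Fin d → ℝ) (c δ : ℝ) : Prop :=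
  ∀ i j, |∑ s, ((fun k => A k i + c * A k j) ⬝ᵥ y s) ^ 2 - n * directionVariance Sig σ A i j c|
    ≤ δ * (n * directionVariance Sig σ A i j c)

theorem directionVariance_eq (hSig : Sig.PosDef) (i j : Fin p) (c : ℝ) :
    directionVariance Sig σ A i j c
      = (Aᵀ * A) i ⬝ᵥ (Sig *ᵥ (Aᵀ * A) i) + 2 * c * ((Aᵀ * A) i ⬝ᵥ (Sig *ᵥ (Aᵀ * A) j))
        + c ^ 2 * ((Aᵀ * A) j ⬝ᵥ (Sig *ᵥ (Aᵀ * A) j))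
        + σ ^ 2 * ((Aᵀ * A) i i + 2 * c * (Aᵀ * A) i j + c ^ 2 * (Aᵀ * A) j j) := by
  have hb : (Aᵀ *ᵥ fun k => A k i + c * A k j) = (Aᵀ * A) i + c • (Aᵀ * A) j := by
    ext l
    simp only [Matrix.mulVec, dotProduct, Matrix.transpose_apply, Pi.add_apply, Pi.smul_apply,
      smul_eq_mul, transpose_mul_self_apply, Finset.mul_sum, ← Finset.sum_add_distrib]
    exact Finset.sum_congr rfl fun _ _ => by ring
  have hw : ∑ k, (A k i + c * A k j) ^ 2
      = (Aᵀ * A) i i + 2 * c * (Aᵀ * A) i j + c ^ 2 * (Aᵀ * A) j j := by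
    simp only [transpose_mul_self_apply, Finset.mul_sum, ← Finset.sum_add_distrib]
    exact Finset.sum_congr rfl fun _ _ => by ring
  have hs : (Aᵀ * A) j ⬝ᵥ (Sig *ᵥ (Aᵀ * A) i) = (Aᵀ * A) i ⬝ᵥ (Sig *ᵥ (Aᵀ * A) j) := by
    rw [Matrix.dotProduct_mulVec, ← Matrix.mulVec_transpose, transpose_eq_of_posDef hSig,
      dotProduct_comm]
  rw [directionVariance, hb, hw, Matrix.mulVec_add, Matrix.mulVec_smul, add_dotProduct,
    dotProduct_add, dotProduct_add, smul_dotProduct, smul_dotProduct, dotProduct_smul,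
    dotProduct_smul, hs]
  simp only [smul_eq_mul]
  ring

theorem covEstimator_apply_self (i : Fin p) : covEstimator A y i i = 1 := by
  simp [covEstimator, offPart]

theorem covEstimator_apply_of_ne {i j : Fin p} (hij : i ≠ j) :
    covEstimator A y i j = (d : ℝ) / (d + 1)
      * ((n : ℝ)⁻¹ * ∑ s, ((fun k => A k i) ⬝ᵥ y s) * ((fun k => A k j) ⬝ᵥ y s)) := by
  have h1 : (Aᵀ * ((n : ℝ)⁻¹ • ∑ s, vecMulVec (y s) (y s)) * A) i j
      = (n : ℝ)⁻¹ * ∑ s, ((fun k => A k i) ⬝ᵥ y s) * ((fun k => A k j) ⬝ᵥ y s) := by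
    rw [Matrix.mul_smul, Matrix.smul_mul, Matrix.smul_apply, smul_eq_mul, Matrix.mul_sum,
      Matrix.sum_mul, Matrix.sum_apply]
    congr 1
    refine Finset.sum_congr rfl fun s _ => ?_
    rw [Matrix.mul_vecMulVec, Matrix.vecMulVec_mul, Matrix.vecMulVec_apply]
    simp only [Matrix.mulVec, Matrix.vecMul, dotProduct, Matrix.transpose_apply]
    congr 1
    exact Finset.sum_congr rfl fun _ _ => mul_comm _ _
  rw [covEstimator, Matrix.add_apply, Matrix.one_apply_ne hij, zero_add, Matrix.smul_apply,
    smul_eq_mul, offPart, Matrix.of_apply, if_neg hij, h1]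

theorem covEstimator_transpose : (covEstimator A y)ᵀ = covEstimator A y := by
  ext i j
  rw [Matrix.transpose_apply]
  by_cases hij : i = j
  · rw [hij]
  · rw [covEstimator_apply_of_ne hij, covEstimator_apply_of_ne (Ne.symm hij)]
    simp only [mul_comm]

theorem abs_covEstimator_sub_le (hSig : Sig.PosDef) (hB : Sig = Bᵀ * B)
    (hdiag : ∀ i, Sig i i = 1) (hd : 1 ≤ d) (hn : 1 ≤ n)
    (h : IsGoodGram (Aᵀ * A) Sig B δ ε ν)
    (hpos : IsGoodSample Sig σ A y 1 δ') (hneg : IsGoodSample Sig σ A y (-1) δ')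
    (hδ : δ ≤ 1 / 2) (hε : 0 ≤ ε) (hε1 : ε ≤ 1 / 4) (hν : 0 ≤ ν) (hδ' : 0 ≤ δ')
    {i j : Fin p} (hij : i ≠ j) :
    |covEstimator A y i j - Sig i j| ≤ 3 * δ + 19 * ε * maxColNorm Sig
      + 4 * ε * (2 * √ν + 2 * ε * offFrobenius Sig) * (1 + 4 * √ν) + 2 * ε * σ ^ 2
      + δ' * (8 + 8 * ε ^ 2 * p + 2 * σ ^ 2) + 1 / d := by
  have hn0 : (0 : ℝ) < n := by exact_mod_cast hn
  have hd0 : (0 : ℝ) < d := by exact_mod_cast hd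
  set q := (n : ℝ)⁻¹ * ∑ s, ((fun k => A k i) ⬝ᵥ y s) * ((fun k => A k j) ⬝ᵥ y s) with hq
  set Ep := ∑ s, ((fun k => A k i + 1 * A k j) ⬝ᵥ y s) ^ 2 with hEp
  set Em := ∑ s, ((fun k => A k i + -1 * A k j) ⬝ᵥ y s) ^ 2 with hEm
  -- Polarization: products of two projections become squares of Gaussian variables.
  have hpol : 4 * (n * q) = Ep - Em := by
    have hw : ∀ c s, (fun k => A k i + c * A k j) ⬝ᵥ y s
        = (fun k => A k i) ⬝ᵥ y s + c * ((fun k => A k j) ⬝ᵥ y s) := fun c s => by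
      simp only [dotProduct, Finset.mul_sum, ← Finset.sum_add_distrib]
      exact Finset.sum_congr rfl fun _ _ => by ring
    rw [hq, mul_inv_cancel_left₀ hn0.ne', hEp, hEm, ← Finset.sum_sub_distrib, Finset.mul_sum]
    exact Finset.sum_congr rfl fun s _ => by rw [hw, hw]; ring
  have h1 := hpos i j
  have h2 := hneg i j
  rw [directionVariance_eq hSig] at h1 h2
  set G := Aᵀ * A with hG
  set mij := G i ⬝ᵥ (Sig *ᵥ G j) with hmij
  have hmi := h.form_self_le hB hdiag hδ i
  have hmj := h.form_self_le hB hdiag hδ j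
  set mi := G i ⬝ᵥ (Sig *ᵥ G i)
  set mj := G j ⬝ᵥ (Sig *ᵥ G j)
  have hmean := h.abs_form_sub_le hSig hdiag hδ hε hε1 hν hij
  have hρ := h.abs_apply_le hij
  have hi := abs_le.1 (h.diag i)
  have hj := abs_le.1 (h.diag j)
  have hV : mi + mj + σ ^ 2 * (G i i + G j j) ≤ 2 * (8 + 8 * ε ^ 2 * p + 2 * σ ^ 2) := by
    have h3 : σ ^ 2 * (G i i + G j j) ≤ σ ^ 2 * 4 :=
      mul_le_mul_of_nonneg_left (by linarith) (sq_nonneg σ)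
    linarith
  have hdev : |q - (mij + σ ^ 2 * G i j)| ≤ δ' * (8 + 8 * ε ^ 2 * p + 2 * σ ^ 2) := by
    have h3 : |4 * (n * q) - 4 * n * (mij + σ ^ 2 * G i j)|
        ≤ δ' * (n * (2 * (mi + mj + σ ^ 2 * (G i i + G j j)))) := by
      rw [hpol, abs_le]
      rw [abs_le] at h1 h2
      constructor <;> linarith [h1.1, h1.2, h2.1, h2.2]
    have h4 : 4 * (n * q) - 4 * n * (mij + σ ^ 2 * G i j)
        = 4 * n * (q - (mij + σ ^ 2 * G i j)) := by ring
    rw [h4, abs_mul, abs_of_pos (by positivity : (0 : ℝ) < 4 * n)] at h3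
    have h5 : δ' * (n * (2 * (mi + mj + σ ^ 2 * (G i i + G j j))))
        ≤ δ' * (n * (2 * (2 * (8 + 8 * ε ^ 2 * p + 2 * σ ^ 2)))) := by gcongr
    have h6 : 4 * n * |q - (mij + σ ^ 2 * G i j)|
        ≤ 4 * n * (δ' * (8 + 8 * ε ^ 2 * p + 2 * σ ^ 2)) := by linarith
    exact le_of_mul_le_mul_left h6 (by positivity)
  have hσρ : |σ ^ 2 * G i j| ≤ 2 * ε * σ ^ 2 := by
    rw [abs_mul, abs_of_nonneg (sq_nonneg σ)]
    exact (mul_le_mul_of_nonneg_left hρ (sq_nonneg σ)).trans_eq (mul_comm _ _)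
  have hqS : |q - Sig i j| ≤ 3 * δ + 19 * ε * maxColNorm Sig
      + 4 * ε * (2 * √ν + 2 * ε * offFrobenius Sig) * (1 + 4 * √ν) + 2 * ε * σ ^ 2
      + δ' * (8 + 8 * ε ^ 2 * p + 2 * σ ^ 2) := by
    have : q - Sig i j = (q - (mij + σ ^ 2 * G i j)) + (mij - Sig i j) + σ ^ 2 * G i j := by ring
    rw [this]
    refine (abs_add_three _ _ _).trans ?_
    linarith
  rw [covEstimator_apply_of_ne hij]
  -- The factor `d/(d+1)` removes a relative bias of order `1/d`; here it is merely treated as an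
  -- error of size at most `1/d`.
  have hfin : (d : ℝ) / (d + 1) * q - Sig i j
      = (d : ℝ) / (d + 1) * (q - Sig i j) - Sig i j / (d + 1) := by
    field_simp; ring
  have hfrac : (d : ℝ) / (d + 1) ≤ 1 := by rw [div_le_one (by positivity)]; linarith
  rw [hfin]
  refine (abs_sub _ _).trans (add_le_add ?_ ?_)
  · rw [abs_mul, abs_of_nonneg (by positivity : (0 : ℝ) ≤ d / (d + 1))]
    exact (mul_le_of_le_one_left (abs_nonneg _) hfrac).trans hqS
  · rw [abs_div, abs_of_pos (by positivity : (0 : ℝ) < d + 1)]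
    exact div_le_div₀ zero_le_one (abs_apply_le_one hSig hdiag i j) hd0 (by linarith)

/-- The deviations add up to a multiple of the error level. -/
theorem error_le_tauInf (hp : 2 ≤ p) (hd : 1 ≤ d) (hn : 1 ≤ n) (hm : 1 ≤ maxColNorm Sig) :
    3 * (8 * √(Real.log p / d)) + 19 * (3 * √(Real.log p / d)) * maxColNorm Sig
      + 4 * (3 * √(Real.log p / d))
        * (2 * √(p / d) + 2 * (3 * √(Real.log p / d)) * offFrobenius Sig) * (1 + 4 * √(p / d))
      + 2 * (3 * √(Real.log p / d)) * σ ^ 2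
      + 8 * √(Real.log p / n) * (8 + 8 * (3 * √(Real.log p / d)) ^ 2 * p + 2 * σ ^ 2) + 1 / d
      ≤ tauInf 1200 d n Sig σ / 2 := by
  have hn0 : (0 : ℝ) < n := by exact_mod_cast hn
  have hd0 : (0 : ℝ) < d := by exact_mod_cast hd
  have hd1 : (1 : ℝ) ≤ d := by exact_mod_cast hd
  have hp2 : (2 : ℝ) ≤ p := by exact_mod_cast hp
  have hp0 : (0 : ℝ) < p := by linarith
  have hℓ : 1 / 4 ≤ Real.log p := by
    have := Real.log_two_gt_d9
    have := Real.log_le_log (by norm_num) hp2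
    linarith
  have hℓ0 : 0 ≤ Real.log p := by linarith
  rw [tauInf]
  set ℓ := Real.log p with hℓdef
  set F := offFrobenius Sig
  have hF : 0 ≤ F := Real.sqrt_nonneg _
  set m := maxColNorm Sig
  have hsd : 0 < √(d : ℝ) := Real.sqrt_pos.2 hd0
  have hsn : 0 < √(n : ℝ) := Real.sqrt_pos.2 hn0
  have hdd : √(d : ℝ) ^ 2 = d := Real.sq_sqrt hd0.le
  set s := √(ℓ / d) with hs
  set r := √(ℓ / n) with hr
  set v := √((p : ℝ) / d) with hv
  have hs0 : 0 ≤ s := Real.sqrt_nonneg _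
  have hr0 : 0 ≤ r := Real.sqrt_nonneg _
  have hv0 : 0 ≤ v := Real.sqrt_nonneg _
  have hs2 : s ^ 2 = ℓ / d := Real.sq_sqrt (by positivity)
  have hv2 : v ^ 2 = p / d := Real.sq_sqrt (by positivity)
  have hsE : s = √ℓ / √d := Real.sqrt_div hℓ0 _
  have hrE : r = √ℓ / √n := Real.sqrt_div hℓ0 _
  have hvE : v = √p / √d := Real.sqrt_div hp0.le _
  have t4 : (p : ℝ) * √ℓ ^ 3 / (√n * d) = s ^ 2 * p * r := by
    rw [hs2, hrE, pow_succ √ℓ, Real.sq_sqrt hℓ0]; field_simp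
  have t5 : √((p : ℝ) * ℓ) / d = s * v := by
    rw [hsE, hvE, Real.sqrt_mul hp0.le, div_mul_div_comm, ← sq, hdd, mul_comm]
  have t6 : (p : ℝ) * √ℓ / √d ^ 3 = s * v ^ 2 := by
    rw [hv2, hsE, pow_succ √(d : ℝ), hdd]; field_simp
  have t8 : s * √((d : ℝ) / n) = r := by
    rw [hsE, hrE, Real.sqrt_div hd0.le]; field_simp
  -- The correction `1/d` is absorbed into the first term of the error level, since `log p ≥ 1/4`.
  have hds : 1 / (d : ℝ) ≤ 2 * s := by
    have : (1 / (2 * d) : ℝ) ≤ s := by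
      refine Real.le_sqrt_of_sq_le ?_
      rw [div_pow, div_le_div_iff₀ (by positivity) hd0]
      nlinarith
    calc 1 / (d : ℝ) = 2 * (1 / (2 * d)) := by field_simp
      _ ≤ 2 * s := by linarith
  rw [t4, t5, t6, ← hv2, ← hs2]
  have b1 : s ≤ s * m := le_mul_of_one_le_right hs0 hm
  have b2 : s ^ 2 * F * (1 + 4 * v) ≤ 3 * (s ^ 2 * (1 + v ^ 2) * F) := by
    have : 1 + 4 * v ≤ 3 * (1 + v ^ 2) := by nlinarith [sq_nonneg (v - 1), sq_nonneg (3 * v - 2)]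
    calc s ^ 2 * F * (1 + 4 * v) ≤ s ^ 2 * F * (3 * (1 + v ^ 2)) := by gcongr
      _ = _ := by ring
  have b3 : 0 ≤ √(p : ℝ) * ℓ / √((n : ℝ) * d) := by positivity
  have b4 : s ^ 2 * p * r ≤ s ^ 2 * p * r * (1 + v ^ 2) :=
    le_mul_of_one_le_right (by positivity) (by nlinarith [sq_nonneg v])
  have b8 : σ ^ 2 * s + σ ^ 2 * r
      ≤ σ ^ 2 * (1 + s) * s * (1 + max √((d : ℝ) / n) ((d : ℝ) / n)) := by
    calc σ ^ 2 * s + σ ^ 2 * r = σ ^ 2 * 1 * s * (1 + √((d : ℝ) / n)) := by rw [← t8]; ring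
      _ ≤ _ := by
        gcongr
        · linarith
        · exact le_max_left _ _
  have b9 : 0 ≤ σ ^ 2 * s := by positivity
  have b10 : 0 ≤ σ ^ 2 * r := by positivity
  have b11 : 0 ≤ s * v := by positivity
  have b12 : 0 ≤ s * v ^ 2 := by positivity
  have b13 : 0 ≤ s ^ 2 * p * r := by positivity
  have b14 : 0 ≤ s ^ 2 * (1 + v ^ 2) * F := by positivity
  -- After `b1`, `b2` and `hds`, the largest coefficient is `576` (from `8 · 8 · 3²`), below `1200/2
  -- = 600`.
  have hexp : 3 * (8 * s) + 19 * (3 * s) * m + 4 * (3 * s) * (2 * v + 2 * (3 * s) * F) * (1 + 4 * v)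
      + 2 * (3 * s) * σ ^ 2 + 8 * r * (8 + 8 * (3 * s) ^ 2 * p + 2 * σ ^ 2) + 1 / d
      = 24 * s + 57 * (s * m) + 24 * (s * v) + 96 * (s * v ^ 2)
        + 72 * (s ^ 2 * F * (1 + 4 * v)) + 6 * (σ ^ 2 * s) + 64 * r + 576 * (s ^ 2 * p * r)
        + 16 * (σ ^ 2 * r) + 1 / d := by ring
  rw [hexp]
  linarith

end Estimator

/-! ### Probability of the concentration event -/

section Concentration

theorem measure_iUnion_le_ofReal {Ω ι : Type*} [MeasurableSpace Ω] {P : Measure Ω} [Fintype ι]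
    {E : ι → Set Ω} {b : ℝ} (h : ∀ i, P (E i) ≤ ENNReal.ofReal b) :
    P (⋃ i, E i) ≤ ENNReal.ofReal (Fintype.card ι * b) := by
  refine (measure_iUnion_fintype_le P E).trans ((Finset.sum_le_sum fun i _ => h i).trans ?_)
  rw [Finset.sum_const, Finset.card_univ, nsmul_eq_mul,
    ENNReal.ofReal_mul (Nat.cast_nonneg _), ENNReal.ofReal_natCast]

/-- Deleting the index `j` amounts to zeroing its coefficient, so sums over the complement of `{i,
j}` are covered by `measure_gram_row_le`. -/
theorem sum_erase_update_mul {p : ℕ} (i j : Fin p) (c g : Fin p → ℝ) :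
    ∑ k ∈ Finset.univ.erase i, Function.update c j 0 k * g k
      = ∑ k ∈ ({i, j} : Finset (Fin p))ᶜ, c k * g k := by
  have hsub : ({i, j} : Finset (Fin p))ᶜ ⊆ Finset.univ.erase i := fun k hk => by
    simp only [Finset.mem_compl, Finset.mem_insert, Finset.mem_singleton, not_or] at hk
    simp [hk.1]
  rw [← Finset.sum_subset hsub fun k hk hk' => ?_]
  · refine Finset.sum_congr rfl fun k hk => ?_
    simp only [Finset.mem_compl, Finset.mem_insert, Finset.mem_singleton, not_or] at hk
    rw [Function.update_of_ne hk.2]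
  · simp only [Finset.mem_compl, Finset.mem_insert, Finset.mem_singleton, not_not,
      Finset.mem_erase, Finset.mem_univ, and_true] at hk hk'
    rw [hk'.resolve_left hk, Function.update_self, zero_mul]

theorem sum_update_zero_sq_le {p : ℕ} (j : Fin p) (c : Fin p → ℝ) :
    ∑ k, Function.update c j 0 k ^ 2 ≤ ∑ k, c k ^ 2 := by
  refine Finset.sum_le_sum fun k _ => ?_
  by_cases hk : k = j
  · subst hk; simp [sq_nonneg]
  · rw [Function.update_of_ne hk]

variable {Ω : Type*} [MeasurableSpace Ω] {P : Measure Ω} [IsProbabilityMeasure P] {p d n : ℕ}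
  {Sig : Matrix (Fin p) (Fin p) ℝ} {σ : ℝ≥0}
  {A : Ω → Matrix (Fin d) (Fin p) ℝ} {X : Fin n → Ω → EuclideanSpace ℝ (Fin p)}
  {W : Fin n → Ω → Fin d → ℝ}

theorem sqrt_inv_mul_le {d x S t : ℝ} (hd : 0 < d) (ht : 0 ≤ t) (hx : x ≤ 4) (hS : 0 ≤ S) :
    t * √(d⁻¹ * (x * S)) ≤ 2 * (t / √d) * √S := by
  have h1 : √(d⁻¹ * (x * S)) ≤ √(d⁻¹ * (2 ^ 2 * S)) :=
    Real.sqrt_le_sqrt (by have := inv_pos.2 hd; gcongr; linarith)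
  rw [Real.sqrt_mul (inv_nonneg.2 hd.le) (2 ^ 2 * S), Real.sqrt_mul (sq_nonneg 2) S,
    Real.sqrt_sq zero_le_two, Real.sqrt_inv] at h1
  calc t * √(d⁻¹ * (x * S)) ≤ t * ((√d)⁻¹ * (2 * √S)) := by gcongr
    _ = _ := by rw [div_eq_mul_inv]; ring

theorem measure_rowBound_compl_le (hA : IsGaussianMatrix P A) (hd : 1 ≤ d)
    (M : Matrix (Fin p) (Fin p) ℝ) {t : ℝ} (ht : 0 ≤ t) :
    P {ω | (∀ i, ((A ω)ᵀ * A ω) i i ≤ 4) ∧ ¬ RowBound ((A ω)ᵀ * A ω) M (t / √d)}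
      ≤ ENNReal.ofReal (p ^ 3 * (2 * Real.exp (-(t ^ 2 / 2)))) := by
  have hd0 : (0 : ℝ) < d := by exact_mod_cast hd
  have hU := measure_iUnion_le_ofReal (P := P) (ι := Fin p × Fin p × Fin p)
    fun q => measure_gram_row_le hA q.1 (Function.update (M q.2.2) q.2.1 0) ht
  simp only [Fintype.card_prod, Fintype.card_fin] at hU
  have hc : ((p * (p * p) : ℕ) : ℝ) = (p : ℝ) ^ 3 := by push_cast; ring
  rw [hc] at hU
  refine (measure_mono ?_).trans hU
  rintro ω ⟨hω4, hω⟩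
  by_contra hcon
  refine hω fun i j a => ?_
  rw [Set.mem_iUnion, not_exists] at hcon
  have h1 := hcon (i, j, a)
  rw [Set.mem_ofPred_eq, not_lt] at h1
  simp only [sum_erase_update_mul] at h1
  refine h1.trans ((sqrt_inv_mul_le hd0 ht (hω4 i) (Finset.sum_nonneg fun _ _ => sq_nonneg _)).trans
    (mul_le_mul_of_nonneg_left (Real.sqrt_le_sqrt (sum_update_zero_sq_le j (M a))) (by positivity)))

theorem measure_isGoodSample_compl_le (h : IsSensingModel P Sig σ A X W)
    (hSig : Sig.PosSemidef) (c : ℝ) {δ : ℝ} (hδ0 : 0 ≤ δ) (hδ1 : δ ≤ 1) :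
    P {ω | ¬ IsGoodSample Sig σ (A ω) (fun s => observe (A ω) (X s ω) (W s ω)) c δ}
      ≤ ENNReal.ofReal (p ^ 2 * (2 * Real.exp (-(n * δ ^ 2 / 16)))) := by
  have hU := measure_iUnion_le_ofReal (P := P) (ι := Fin p × Fin p)
    fun q => h.measure_observe_le hSig q.1 q.2 c hδ0 hδ1
  simp only [Fintype.card_prod, Fintype.card_fin] at hU
  have hc : ((p * p : ℕ) : ℝ) = (p : ℝ) ^ 2 := by push_cast; ring
  rw [hc] at hU
  refine (measure_mono ?_).trans hU
  intro ω hω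
  by_contra hcon
  refine hω fun i j => ?_
  rw [Set.mem_iUnion, not_exists] at hcon
  exact not_lt.1 (hcon (i, j))

theorem measure_gram_diag_compl_le (hA : IsGaussianMatrix P A) (hd : 1 ≤ d) {δ : ℝ}
    (hδ0 : 0 ≤ δ) (hδ1 : δ ≤ 1) :
    P {ω | ¬ ∀ i, |((A ω)ᵀ * A ω) i i - 1| ≤ δ}
      ≤ ENNReal.ofReal (p * (2 * Real.exp (-(d * δ ^ 2 / 16)))) := by
  have hU := measure_iUnion_le_ofReal (P := P) fun i => measure_gram_diag_le hA hd i hδ0 hδ1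
  rw [Fintype.card_fin] at hU
  refine (measure_mono ?_).trans hU
  intro ω hω
  by_contra hcon
  refine hω fun i => ?_
  rw [Set.mem_iUnion, not_exists] at hcon
  exact not_lt.1 (hcon i)

theorem measure_gram_norm_compl_le (hA : IsGaussianMatrix P A) :
    P {ω | (∀ i, ((A ω)ᵀ * A ω) i i ≤ 2) ∧
        ¬ ∀ i, ∑ k ∈ ({i} : Finset (Fin p))ᶜ, ((A ω)ᵀ * A ω) i k ^ 2 ≤ 4 * ((p : ℝ) / d)}
      ≤ ENNReal.ofReal (p * (2 * Real.exp (-((p - 1) / 16)))) := by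
  have hU := measure_iUnion_le_ofReal (P := P) fun i => measure_gram_norm_le hA i
  rw [Fintype.card_fin] at hU
  refine (measure_mono ?_).trans hU
  rintro ω ⟨hω2, hω⟩
  by_contra hcon
  refine hω fun i => ?_
  rw [Set.mem_iUnion, not_exists] at hcon
  have h1 := hcon i
  rw [Set.mem_ofPred_eq, not_lt] at h1
  have he : ({i} : Finset (Fin p))ᶜ = Finset.univ.erase i := by ext; simp
  rw [he]
  refine h1.trans ?_
  calc 2 * ((p : ℝ) * ((d : ℝ)⁻¹ * ((A ω)ᵀ * A ω) i i)) ≤ 2 * ((p : ℝ) * ((d : ℝ)⁻¹ * 2)) := by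
        gcongr; exact hω2 i
    _ = _ := by rw [div_eq_mul_inv]; ring

theorem measure_gram_bilinear_compl_le (hA : IsGaussianMatrix P A) (hd : 1 ≤ d)
    (M : Matrix (Fin p) (Fin p) ℝ) {t : ℝ} (ht : 0 ≤ t) :
    P {ω | (∀ i, ((A ω)ᵀ * A ω) i i ≤ 4) ∧ ¬ ∀ i j,
        |∑ k ∈ ({i, j} : Finset (Fin p))ᶜ,
            (∑ l ∈ ({i, j} : Finset (Fin p))ᶜ, M k l * ((A ω)ᵀ * A ω) i l)
            * (((A ω)ᵀ * A ω) j k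
              - ((A ω)ᵀ * A ω) i j / ((A ω)ᵀ * A ω) i i * ((A ω)ᵀ * A ω) i k)|
          ≤ 2 * (t / √d) * √(∑ k ∈ ({i, j} : Finset (Fin p))ᶜ,
              (∑ l ∈ ({i, j} : Finset (Fin p))ᶜ, M k l * ((A ω)ᵀ * A ω) i l) ^ 2)}
      ≤ ENNReal.ofReal (p ^ 2 * (2 * Real.exp (-(t ^ 2 / 2)))) := by
  have hd0 : (0 : ℝ) < d := by exact_mod_cast hd
  have hU := measure_iUnion_le_ofReal (P := P) (ι := Fin p × Fin p)
    fun q => measure_gram_bilinear_le hA M q.1 q.2 ht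
  simp only [Fintype.card_prod, Fintype.card_fin] at hU
  have hc : ((p * p : ℕ) : ℝ) = (p : ℝ) ^ 2 := by push_cast; ring
  rw [hc] at hU
  refine (measure_mono ?_).trans hU
  rintro ω ⟨hω4, hω⟩
  by_contra hcon
  refine hω fun i j => ?_
  rw [Set.mem_iUnion, not_exists] at hcon
  exact (not_lt.1 (hcon (i, j))).trans
    (sqrt_inv_mul_le hd0 ht (hω4 j) (Finset.sum_nonneg fun _ _ => sq_nonneg _))

/-- Off an event of small probability, the covariance estimator is within half the error level. -/
theorem IsSensingModel.measure_covEstimator_error_le (h : IsSensingModel P Sig σ A X W)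
    (hSig : Sig.PosDef) (hdiag : ∀ i, Sig i i = 1) (hp : 2 ≤ p) (hd : 1 ≤ d) (hn : 1 ≤ n)
    (hsd : √(Real.log p / d) ≤ 1 / 16) (hsn : √(Real.log p / n) ≤ 1 / 8) :
    P {ω | ¬ ∀ i j, |covEstimator (A ω) (fun s => observe (A ω) (X s ω) (W s ω)) i j - Sig i j|
          ≤ tauInf 1200 d n Sig σ / 2}
      ≤ ENNReal.ofReal (failureBound 16 1 1 4 (1 / 16) p d) := by
  have hA := h.isGaussianMatrix
  obtain ⟨B, hB⟩ := exists_transpose_mul_self hSig.posSemidef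
  have hn0 : (0 : ℝ) < n := by exact_mod_cast hn
  have hd0 : (0 : ℝ) < d := by exact_mod_cast hd
  have hp2 : (2 : ℝ) ≤ p := by exact_mod_cast hp
  have hp0 : (0 : ℝ) < p := by linarith
  have hℓ0 : 0 ≤ Real.log p := Real.log_nonneg (by linarith)
  -- Then `exp(-t²/2) = p^{-9/2}`, which beats a union over `p³` forms and leaves `1/p`. The
  -- deviations `8 s` and `8 r` likewise give exactly `p^{-4}`.
  set t := 3 * √(Real.log p) with ht
  have ht0 : 0 ≤ t := by positivity
  have htε : t / √d = 3 * √(Real.log p / d) := by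
    rw [ht, Real.sqrt_div hℓ0, mul_div_assoc]
  set s := √(Real.log p / d) with hs
  set r := √(Real.log p / n) with hr
  have hs0 : 0 ≤ s := Real.sqrt_nonneg _
  have hr0 : 0 ≤ r := Real.sqrt_nonneg _
  set e : ℝ := ((p : ℝ) ^ 4)⁻¹ with he
  have he4 : Real.exp (-(4 * Real.log p)) = e := by
    rw [Real.exp_neg, he, mul_comm, Real.exp_mul, Real.exp_log hp0]
    norm_cast
  have hed : Real.exp (-(d * (8 * s) ^ 2 / 16)) = e := by
    rw [← he4, mul_pow, hs, Real.sq_sqrt (by positivity)]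
    congr 1; field_simp; ring
  have hen : Real.exp (-(n * (8 * r) ^ 2 / 16)) = e := by
    rw [← he4, mul_pow, hr, Real.sq_sqrt (by positivity)]
    congr 1; field_simp; ring
  have het : Real.exp (-(t ^ 2 / 2)) ≤ e := by
    rw [← he4, ht, mul_pow, Real.sq_sqrt hℓ0]
    exact Real.exp_le_exp.2 (by linarith)
  have b1 := measure_gram_diag_compl_le hA hd (δ := 8 * s) (by positivity) (by linarith)
  -- Four families of linear forms: the identity for single entries of `G`, `Sig` for the linear
  -- terms, `offPart Sig` for the norm in the cross form, and the root `B` for the quadratic form of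
  -- a row.
  have b2 := measure_rowBound_compl_le hA hd 1 ht0
  have b3 := measure_rowBound_compl_le hA hd Sig ht0
  have b4 := measure_rowBound_compl_le hA hd (offPart Sig) ht0
  have b5 := measure_rowBound_compl_le hA hd B ht0
  have b6 := measure_gram_norm_compl_le hA
  have b7 := measure_gram_bilinear_compl_le hA hd Sig ht0
  have b8 := measure_isGoodSample_compl_le h hSig.posSemidef 1 (δ := 8 * r) (by positivity)
    (by linarith)
  have b9 := measure_isGoodSample_compl_le h hSig.posSemidef (-1) (δ := 8 * r) (by positivity)
    (by linarith)
  rw [hed] at b1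
  rw [hen] at b8 b9
  have hsum := (measure_union_le _ _).trans (add_le_add b1 <| (measure_union_le _ _).trans
    (add_le_add b2 <| (measure_union_le _ _).trans (add_le_add b3 <| (measure_union_le _ _).trans
    (add_le_add b4 <| (measure_union_le _ _).trans (add_le_add b5 <| (measure_union_le _ _).trans
    (add_le_add b6 <| (measure_union_le _ _).trans (add_le_add b7 <| (measure_union_le _ _).trans
    (add_le_add b8 b9))))))))
  refine (measure_mono ?_).trans (hsum.trans ?_)
  · intro ω hω
    by_contra hcon
    simp only [Set.mem_union, not_or, Set.mem_ofPred_eq, not_and_or, not_not] at hcon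
    obtain ⟨c1, c2, c3, c4, c5, c6, c7, c8, c9⟩ := hcon
    have hG2 : ∀ i, ((A ω)ᵀ * A ω) i i ≤ 2 := fun i => by
      have := (abs_le.1 (c1 i)).2; linarith
    have hG4 : ∀ i, ((A ω)ᵀ * A ω) i i ≤ 4 := fun i => (hG2 i).trans (by norm_num)
    rw [htε] at c2 c3 c4 c5 c7
    have hgood : IsGoodGram ((A ω)ᵀ * A ω) Sig B (8 * s) (3 * s) ((p : ℝ) / d) :=
      { symm := fun i j => by
          rw [transpose_mul_self_apply, transpose_mul_self_apply]
          exact Finset.sum_congr rfl fun _ _ => mul_comm _ _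
        diag := c1
        row_one := c2.resolve_left (not_not.2 hG4)
        row_sig := c3.resolve_left (not_not.2 hG4)
        row_off := c4.resolve_left (not_not.2 hG4)
        row_root := c5.resolve_left (not_not.2 hG4)
        norm := c6.resolve_left (not_not.2 hG2)
        bilinear := fun i j _ => c7.resolve_left (not_not.2 hG4) i j }
    refine hω fun i j => ?_
    have hle := error_le_tauInf (σ := (σ : ℝ)) hp hd hn (one_le_maxColNorm hdiag i)
    by_cases hij : i = j
    · subst hij
      rw [covEstimator_apply_self, hdiag, sub_self, abs_zero]
      refine le_trans ?_ hle
      have : 0 ≤ maxColNorm Sig := zero_le_one.trans (one_le_maxColNorm hdiag i)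
      have : 0 ≤ offFrobenius Sig := Real.sqrt_nonneg _
      positivity
    · exact (abs_covEstimator_sub_le hSig hB hdiag hd hn hgood c8 c9 (by linarith) (by positivity)
        (by linarith) (by positivity) (by positivity) hij).trans hle
  · rw [← ENNReal.ofReal_add (by positivity) (by positivity),
      ← ENNReal.ofReal_add (by positivity) (by positivity),
      ← ENNReal.ofReal_add (by positivity) (by positivity),
      ← ENNReal.ofReal_add (by positivity) (by positivity),
      ← ENNReal.ofReal_add (by positivity) (by positivity),
      ← ENNReal.ofReal_add (by positivity) (by positivity),
      ← ENNReal.ofReal_add (by positivity) (by positivity),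
      ← ENNReal.ofReal_add (by positivity) (by positivity)]
    refine ENNReal.ofReal_le_ofReal ?_
    have hp3 : (p : ℝ) ^ 3 * e = 1 / p := by rw [he]; field_simp
    have he0 : 0 ≤ e := by positivity
    have hp1 : (1 : ℝ) ≤ p := by linarith
    have k3 : (p : ℝ) ^ 3 * (2 * Real.exp (-(t ^ 2 / 2))) ≤ 2 * (1 / p) := by
      rw [← hp3]
      calc (p : ℝ) ^ 3 * (2 * Real.exp (-(t ^ 2 / 2))) ≤ (p : ℝ) ^ 3 * (2 * e) := by gcongr
        _ = _ := by ring
    have k2' : (p : ℝ) ^ 2 * (2 * Real.exp (-(t ^ 2 / 2))) ≤ 2 * (1 / p) :=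
      le_trans (by gcongr; norm_num) k3
    have k2 : (p : ℝ) ^ 2 * (2 * e) ≤ 2 * (1 / p) := by
      rw [← hp3]
      calc (p : ℝ) ^ 2 * (2 * e) ≤ (p : ℝ) ^ 3 * (2 * e) := by gcongr; norm_num
        _ = _ := by ring
    have k1 : (p : ℝ) * (2 * e) ≤ 2 * (1 / p) := by
      refine le_trans ?_ k2
      gcongr
      nlinarith
    have k6 : (p : ℝ) * (2 * Real.exp (-((p - 1) / 16)))
        ≤ 4 * (p : ℝ) ^ 2 * Real.exp (-(1 / 16) * p) := by
      have h1 : -(((p : ℝ) - 1) / 16) = 1 / 16 + -(1 / 16) * p := by ring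
      have h2 : Real.exp (1 / 16) ≤ 2 := by
        have h3 : Real.exp (1 / 16) ≤ Real.exp (Real.log 2) :=
          Real.exp_le_exp.2 (by have := Real.log_two_gt_d9; linarith)
        rwa [Real.exp_log (by norm_num)] at h3
      rw [h1, Real.exp_add]
      calc (p : ℝ) * (2 * (Real.exp (1 / 16) * Real.exp (-(1 / 16) * p)))
          ≤ (p : ℝ) * (2 * (2 * Real.exp (-(1 / 16) * p))) := by gcongr
        _ = 4 * p * Real.exp (-(1 / 16) * p) := by ring
        _ ≤ 4 * (p : ℝ) ^ 2 * Real.exp (-(1 / 16) * p) := by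
            gcongr
            nlinarith
    -- The eight events other than `b6` contribute `16/p` in all, and `b6` the term in `exp(-p/16)`.
    -- Deviations at scale `√(log p / d)` already control the diagonal, so the `exp(-d)` term only
    -- adds slack.
    have kd : 0 ≤ 1 * (p : ℝ) ^ 2 * Real.exp (-1 * d) := by positivity
    rw [failureBound]
    have : (16 : ℝ) / p = 16 * (1 / p) := by ring
    rw [this]
    linarith

end Concentration

/-! ### Recovery of the precision matrix -/

section Recovery

variable {p d n : ℕ} {Sig : Matrix (Fin p) (Fin p) ℝ} {θ τ : ℝ}

theorem sqrt_log_div_le_tauInf {C : ℝ} (hC : 0 ≤ C) (hm : 1 ≤ maxColNorm Sig) (σ : ℝ) :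
    C * √(Real.log p / d) ≤ tauInf C d n Sig σ ∧ C * √(Real.log p / n) ≤ tauInf C d n Sig σ := by
  have hℓ : 0 ≤ Real.log p := Real.log_natCast_nonneg p
  have hF : 0 ≤ offFrobenius Sig := Real.sqrt_nonneg _
  have h1 : √(Real.log p / d) ≤ √(Real.log p / d) * maxColNorm Sig :=
    le_mul_of_one_le_right (Real.sqrt_nonneg _) hm
  have h0 : 0 ≤ √(Real.log p / d) := Real.sqrt_nonneg _
  have h2 : 0 ≤ Real.log p / d * (1 + (p : ℝ) / d) * offFrobenius Sig := by positivity
  have h3 : 0 ≤ √(p : ℝ) * Real.log p / √((n : ℝ) * d) := by positivity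
  have h4 : 0 ≤ (p : ℝ) * √(Real.log p) ^ 3 / (√n * d) * (1 + (p : ℝ) / d) := by positivity
  have h5 : 0 ≤ √((p : ℝ) * Real.log p) / d := by positivity
  have h6 : 0 ≤ (p : ℝ) * √(Real.log p) / √d ^ 3 := by positivity
  have h7 : 0 ≤ √(Real.log p / n) := Real.sqrt_nonneg _
  have h8 : 0 ≤ σ ^ 2 * (1 + √(Real.log p / d)) * √(Real.log p / d)
      * (1 + max √((d : ℝ) / n) ((d : ℝ) / n)) := by
    have : 0 ≤ max √((d : ℝ) / n) ((d : ℝ) / n) := le_max_of_le_left (Real.sqrt_nonneg _)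
    positivity
  rw [tauInf]
  exact ⟨mul_le_mul_of_nonneg_left (by linarith) hC, mul_le_mul_of_nonneg_left (by linarith) hC⟩

theorem eighteen_mul_le_precError (hG : 1 ≤ kappaGamma Sig) (hθ : 0 < θ) (hθ1 : θ ≤ 1)
    (hτ : 0 ≤ τ) : 18 * τ ≤ precError Sig θ τ := by
  rw [precError]
  have h1 : 8 ≤ 8 / θ := by rw [le_div_iff₀ hθ]; linarith
  have h2 : 18 ≤ 2 * kappaGamma Sig * (1 + 8 / θ) := by nlinarith
  exact mul_le_mul_of_nonneg_right h2 hτ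

theorem sign_eq_sign_of_abs_sub_lt {x y : ℝ} (h : |x - y| < |y|) :
    SignType.sign x = SignType.sign y := by
  rcases lt_trichotomy y 0 with hy | rfl | hy
  · rw [abs_of_neg hy, abs_lt] at h
    rw [sign_neg hy, sign_neg (by linarith [h.2])]
  · rw [abs_zero] at h; exact absurd h (not_lt.2 (abs_nonneg _))
  · rw [abs_of_pos hy, abs_lt] at h
    rw [sign_pos hy, sign_pos (by linarith [h.1])]

/-- For `p = 1` the error level is zero because `log p = 0`; the claim then holds because the
failure bound exceeds one. -/
theorem one_le_failureBound_one (d : ℕ) : 1 ≤ failureBound 16 1 1 4 (1 / 16) 1 d := by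
  rw [failureBound]
  have e1 := Real.exp_pos (-1 * (d : ℝ))
  have e2 := Real.exp_pos (-(1 / 16) * ((1 : ℕ) : ℝ))
  push_cast at e2 ⊢
  linarith

variable {Ω : Type u} [MeasurableSpace Ω] {P : Measure Ω} [IsProbabilityMeasure P]
  {σ : ℝ≥0} {A : Ω → Matrix (Fin d) (Fin p) ℝ} {X : Fin n → Ω → EuclideanSpace ℝ (Fin p)}
  {W : Fin n → Ω → Fin d → ℝ}

theorem IsSensingModel.measure_not_recovery_le (h : IsSensingModel P Sig σ A X W)
    (hp : 1 ≤ p) (hd : 1 ≤ d) (hn : 1 ≤ n)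
    (hSig : Sig.PosDef) (hdiag : ∀ i, Sig i i = 1) (hθ : 0 < θ) (hθ1 : θ ≤ 1)
    (hirr : Irrepresentable Sig θ)
    (h1 : precError Sig θ (tauInf 1200 d n Sig σ)
      ≤ (3 * kappaSigma Sig * maxDeg Sig)⁻¹ * min 1 (kappaSigma Sig ^ 2 * kappaGamma Sig)⁻¹)
    (h2 : 3 / 2 * maxDeg Sig * kappaSigma Sig ^ 3 * precError Sig θ (tauInf 1200 d n Sig σ) ^ 2
      ≤ tauInf 1200 d n Sig σ) :
    P {ω | ¬ ∃ T : Matrix (Fin p) (Fin p) ℝ,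
        (∀ T', IsGraphicalLasso
          (covEstimator (A ω) fun s => observe (A ω) (X s ω) (W s ω))
          (8 * tauInf 1200 d n Sig σ / θ) T' ↔ T' = T) ∧
        (∀ i j, (i, j) ∉ precSupport Sig → T i j = 0) ∧
        entryMax (T - Sig⁻¹) ≤ precError Sig θ (tauInf 1200 d n Sig σ) ∧
        ((∀ i j, i ≠ j → (i, j) ∈ precSupport Sig →
            precError Sig θ (tauInf 1200 d n Sig σ) ≤ |Sig⁻¹ i j|) →
          ∀ i j, SignType.sign (T i j) = SignType.sign (Sig⁻¹ i j))}
      ≤ ENNReal.ofReal (failureBound 16 1 1 4 (1 / 16) p d) := by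
  rcases hp.eq_or_lt with hp1 | hp2
  · subst hp1
    exact prob_le_one.trans (ENNReal.one_le_ofReal.2 (one_le_failureBound_one d))
  have hp0 : 0 < p := by omega
  set i₀ : Fin p := ⟨0, hp0⟩
  have : Nonempty (Fin p) := ⟨i₀⟩
  have hm := one_le_maxColNorm hdiag i₀
  have hk := one_le_kappaSigma hdiag i₀
  have hG := one_le_kappaGamma hSig hdiag i₀
  have hD : (1 : ℝ) ≤ maxDeg Sig := by exact_mod_cast one_le_maxDeg hSig i₀
  obtain ⟨ts, tr⟩ := sqrt_log_div_le_tauInf (d := d) (n := n) (by norm_num : (0 : ℝ) ≤ 1200) hm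
    (σ : ℝ)
  set τ := tauInf 1200 d n Sig σ with hτ
  have hτ0 : 0 < τ := by
    refine lt_of_lt_of_le ?_ ts
    have : 0 < Real.log p := Real.log_pos (by exact_mod_cast hp2)
    positivity
  -- The right side of `h1` is at most one. As `τ` dominates `1200 √(log p / d)` and `1200 √(log p /
  -- n)`, this makes both square roots small enough for the concentration bound.
  have hτ1 : 18 * τ ≤ 1 := by
    refine (eighteen_mul_le_precError hG hθ hθ1 hτ0.le).trans (h1.trans ?_)
    refine mul_le_one₀ (inv_le_one_of_one_le₀ ?_) (by positivity) (min_le_left _ _)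
    nlinarith
  refine (measure_mono ?_).trans (h.measure_covEstimator_error_le hSig hdiag hp2 hd hn
    (by linarith) (by linarith))
  intro ω hω hcon
  refine hω ?_
  obtain ⟨T, hT, hT0, hTe⟩ := exists_glasso_of_abs_sub_le hSig hdiag hp0 hθ hθ1 hτ0 hirr
    covEstimator_transpose (fun i => by rw [covEstimator_apply_self, hdiag]) hcon h1 h2
  refine ⟨T, hT, hT0, ?_, fun hmin i j => ?_⟩
  · exact ciSup_le fun q => by rw [Matrix.sub_apply]; exact (hTe q.1 q.2).le
  · have hTpos : T.PosDef := ((hT T).2 rfl).1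
    by_cases hij : i = j
    · subst hij
      rw [sign_pos hTpos.diag_pos, sign_pos hSig.inv.diag_pos]
    · by_cases hS : (i, j) ∈ precSupport Sig
      · exact sign_eq_sign_of_abs_sub_lt ((hTe i j).trans_le (hmin i j hij hS))
      · have : Sig⁻¹ i j = 0 := not_not.1 hS
        rw [hT0 i j hS, this]

end Recovery

/-! ### Sufficient orders of the dimensions -/

section Orders

variable {p d n : ℕ} {Sig : Matrix (Fin p) (Fin p) ℝ} {κ : ℝ}

theorem sum_sq_row_le (hκ : kappaSigma Sig ≤ κ) (i : Fin p) : ∑ j, Sig i j ^ 2 ≤ κ ^ 2 := by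
  have h1 : ∑ j, |Sig i j| ≤ κ := (sum_abs_le_maxRowSum Sig i).trans hκ
  calc ∑ j, Sig i j ^ 2 = ∑ j, |Sig i j| ^ 2 := by simp
    _ ≤ (∑ j, |Sig i j|) ^ 2 := Finset.sum_sq_le_sq_sum_of_nonneg fun _ _ => abs_nonneg _
    _ ≤ κ ^ 2 := by
      have : 0 ≤ ∑ j, |Sig i j| := Finset.sum_nonneg fun _ _ => abs_nonneg _
      gcongr

theorem maxColNorm_le [Nonempty (Fin p)] (hSig : Sig.PosDef) (hκ : kappaSigma Sig ≤ κ)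
    (hκ0 : 0 ≤ κ) : maxColNorm Sig ≤ κ := by
  refine ciSup_le fun j => Real.sqrt_le_iff.2 ⟨hκ0, ?_⟩
  refine le_trans (le_of_eq ?_) (sum_sq_row_le hκ j)
  exact Finset.sum_congr rfl fun i _ => by rw [apply_comm_of_posDef hSig]

theorem offFrobenius_le (hκ : kappaSigma Sig ≤ κ) (hκ0 : 0 ≤ κ) : offFrobenius Sig ≤ √p * κ := by
  refine Real.sqrt_le_iff.2 ⟨by positivity, ?_⟩
  rw [mul_pow, Real.sq_sqrt (Nat.cast_nonneg p)]
  calc ∑ i, ∑ j, offPart Sig i j ^ 2 ≤ ∑ _i : Fin p, κ ^ 2 := by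
        refine Finset.sum_le_sum fun i _ => le_trans (Finset.sum_le_sum fun j _ => ?_)
          (sum_sq_row_le hκ i)
        by_cases hij : i = j
        · simp [offPart, hij, sq_nonneg]
        · simp [offPart, hij]
    _ = p * κ ^ 2 := by simp

theorem sample_order_le {q z ℓ D N L : ℝ} (hL : 1 ≤ L) (hz1 : 1 ≤ z) (hz10 : q = z ^ 10)
    (hℓ : 1 / 2 ≤ ℓ) (hd : L ^ 2 * z ^ 8 ≤ D) (hn : L ^ 2 * z ^ 8 * ℓ ^ 3 ≤ N) :
    √q * ℓ / √(N * D) ≤ 2 / L := by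
  have hL0 : 0 < L := by linarith
  have hz0 : 0 < z := by linarith
  have hzk : ∀ k : ℕ, 1 ≤ z ^ k := fun k => one_le_pow₀ hz1
  have hℓ0 : 0 < ℓ := by linarith
  have hD0 : 0 < D := lt_of_lt_of_le (by positivity) hd
  have hN0 : 0 < N := lt_of_lt_of_le (by positivity) hn
  have hp0 : 0 < q := by rw [hz10]; positivity
  rw [← Real.sqrt_sq hℓ0.le, ← Real.sqrt_mul hp0.le, ← Real.sqrt_div (by positivity)]
  refine Real.sqrt_le_iff.2 ⟨by positivity, ?_⟩
  rw [div_pow, div_le_div_iff₀ (by positivity) (by positivity), hz10]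
  have h1 : (L ^ 2 * z ^ 8 * ℓ ^ 3) * (L ^ 2 * z ^ 8) ≤ N * D := by gcongr
  have h2 : 1 ≤ 4 * ℓ * (L ^ 2 * z ^ 6) := one_le_mul_of_one_le_of_one_le (by linarith)
    (one_le_mul_of_one_le_of_one_le (one_le_pow₀ hL) (hzk 6))
  calc z ^ 10 * ℓ ^ 2 * L ^ 2 = 1 * (z ^ 10 * ℓ ^ 2 * L ^ 2) := by ring
    _ ≤ 4 * ℓ * (L ^ 2 * z ^ 6) * (z ^ 10 * ℓ ^ 2 * L ^ 2) := by gcongr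
    _ = 2 ^ 2 * ((L ^ 2 * z ^ 8 * ℓ ^ 3) * (L ^ 2 * z ^ 8)) := by ring
    _ ≤ 2 ^ 2 * (N * D) := by gcongr

/-- The powers balance: `p · p/d` is at most `z¹² / L²`-scale against `√n d ≥ L³ z¹² (log p)^{3/2}`.
This term accounts for the cube of the logarithm in the order of `n`. -/
theorem sample_order_mul_le {q z ℓ D N L : ℝ} (hL : 1 ≤ L) (hz1 : 1 ≤ z) (hz10 : q = z ^ 10)
    (hℓ : 1 / 2 ≤ ℓ) (hd : L ^ 2 * z ^ 8 ≤ D) (hn : L ^ 2 * z ^ 8 * ℓ ^ 3 ≤ N)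
    (hqD : q / D ≤ z ^ 2) :
    q * √ℓ ^ 3 / (√N * D) * (1 + q / D) ≤ 2 / L := by
  have hL0 : 0 < L := by linarith
  have hz0 : 0 < z := by linarith
  have hzk : ∀ k : ℕ, 1 ≤ z ^ k := fun k => one_le_pow₀ hz1
  have hℓ0 : 0 < ℓ := by linarith
  have hD0 : 0 < D := lt_of_lt_of_le (by positivity) hd
  have hN0 : 0 < N := lt_of_lt_of_le (by positivity) hn
  have hp0 : 0 < q := by rw [hz10]; positivity
  have h1 : L * z ^ 4 * √ℓ ^ 3 ≤ √N := by
    refine Real.le_sqrt_of_sq_le (le_trans (le_of_eq ?_) hn)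
    rw [mul_pow, ← pow_mul, mul_comm 3 2, pow_mul, Real.sq_sqrt hℓ0.le]; ring
  have hsℓ : 0 < √ℓ := Real.sqrt_pos.2 hℓ0
  have h2 : q * √ℓ ^ 3 / (√N * D) ≤ 1 / (L ^ 3 * z ^ 2) := by
    rw [div_le_div_iff₀ (by positivity) (by positivity), hz10]
    calc z ^ 10 * √ℓ ^ 3 * (L ^ 3 * z ^ 2) = (L * z ^ 4 * √ℓ ^ 3) * (L ^ 2 * z ^ 8) := by ring
      _ ≤ √N * D := by gcongr
      _ = 1 * (√N * D) := by ring
  calc q * √ℓ ^ 3 / (√N * D) * (1 + q / D) ≤ 1 / (L ^ 3 * z ^ 2) * (2 * z ^ 2) := by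
        gcongr
        linarith [hzk 2]
    _ = 2 / L ^ 3 := by field_simp
    _ ≤ 2 / L := by gcongr; exact le_self_pow₀ hL (by norm_num)

theorem sensing_order_le {q z ℓ D L : ℝ} (hL : 1 ≤ L) (hz1 : 1 ≤ z) (hz10 : q = z ^ 10)
    (hℓz : ℓ ≤ 10 * z) (hd : L ^ 2 * z ^ 8 ≤ D) :
    √(q * ℓ) / D ≤ 4 / L := by
  have hL0 : 0 < L := by linarith
  have hz0 : 0 < z := by linarith
  have hzk : ∀ k : ℕ, 1 ≤ z ^ k := fun k => one_le_pow₀ hz1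
  have hD0 : 0 < D := lt_of_lt_of_le (by positivity) hd
  have hL2 : L ≤ L ^ 2 := by nlinarith
  rw [div_le_div_iff₀ hD0 hL0]
  have h1 : √(q * ℓ) ≤ 4 * z ^ 6 := by
    refine Real.sqrt_le_iff.2 ⟨by positivity, ?_⟩
    rw [hz10]
    calc z ^ 10 * ℓ ≤ z ^ 10 * (10 * z) := by gcongr
      _ = 10 * z ^ 11 * 1 := by ring
      _ ≤ 10 * z ^ 11 * z := by gcongr
      _ ≤ (4 * z ^ 6) ^ 2 := by nlinarith [hzk 12]
  calc √(q * ℓ) * L ≤ 4 * z ^ 6 * L ^ 2 := by gcongr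
    _ ≤ 4 * z ^ 8 * L ^ 2 := by gcongr; norm_num
    _ = 4 * (L ^ 2 * z ^ 8) := by ring
    _ ≤ 4 * D := by gcongr

theorem sensing_order_mul_le {q z ℓ D L : ℝ} (hL : 1 ≤ L) (hz1 : 1 ≤ z) (hz10 : q = z ^ 10)
    (hℓz : ℓ ≤ 10 * z) (hd : L ^ 2 * z ^ 8 ≤ D) :
    q * √ℓ / √D ^ 3 ≤ 4 / L := by
  have hL0 : 0 < L := by linarith
  have hz0 : 0 < z := by linarith
  have hD0 : 0 < D := lt_of_lt_of_le (by positivity) hd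
  have hsD : L * z ^ 4 ≤ √D := Real.le_sqrt_of_sq_le (le_trans (le_of_eq (by ring)) hd)
  have h1 : √ℓ ≤ 4 * z := by
    refine Real.sqrt_le_iff.2 ⟨by positivity, ?_⟩
    nlinarith
  rw [div_le_div_iff₀ (by positivity) hL0, hz10]
  calc z ^ 10 * √ℓ * L ≤ z ^ 10 * (4 * z) * L := by gcongr
    _ = 4 * (z ^ 11 * L) := by ring
    _ ≤ 4 * (z ^ 12 * L ^ 3) := by
        gcongr
        · norm_num
        · exact le_self_pow₀ hL (by norm_num)
    _ = 4 * (L * z ^ 4) ^ 3 := by ring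
    _ ≤ 4 * √D ^ 3 := by gcongr

/-- The part `√(log p / d) · d/n = √(d log p)/n` grows with `d`, so an upper bound on `d` is needed:
either `d ≤ n`, or `d ≤ p` and the order of `n` suffices. -/
theorem noise_order_le {q z ℓ D N L σ σ₀ : ℝ} (hL : 1 ≤ L) (hσ0 : 0 ≤ σ) (hσ : σ ≤ σ₀)
    (hz1 : 1 ≤ z) (hℓ0 : 0 < ℓ) (hℓ : 1 / 2 ≤ ℓ) (hD0 : 0 < D) (hN0 : 0 < N) (hz10 : q = z ^ 10)
    (hdn' : D ≤ q ∨ D ≤ N) (hn : L ^ 2 * z ^ 8 * ℓ ^ 3 ≤ N)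
    (hs : √(ℓ / D) ≤ 4 / L) (hr : √(ℓ / N) ≤ 2 / L) :
    σ ^ 2 * (1 + √(ℓ / D)) * √(ℓ / D) * (1 + max √(D / N) (D / N)) ≤ 80 * σ₀ ^ 2 / L := by
  have hL0 : 0 < L := by linarith
  have hz0 : 0 < z := by linarith
  have hL2 : L ≤ L ^ 2 := by nlinarith
  have hs0 : 0 ≤ √(ℓ / D) := Real.sqrt_nonneg _
  have h1 : √(ℓ / D) * √(D / N) ≤ 2 / L := by
    rw [← Real.sqrt_mul (by positivity)]
    convert hr using 2
    field_simp
  have h2 : √(ℓ / D) * (D / N) ≤ 12 / L := by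
    rcases hdn' with h | h
    · have h3 : √(ℓ / D) * (D / N) = √(ℓ * D) / N := by
        have hDD : D = √D * √D := (Real.mul_self_sqrt hD0.le).symm
        have : 0 < √D := Real.sqrt_pos.2 hD0
        rw [Real.sqrt_div hℓ0.le, Real.sqrt_mul hℓ0.le]
        nth_rewrite 2 [hDD]
        field_simp
      rw [h3, div_le_div_iff₀ hN0 hL0]
      have h4 : √(ℓ * D) ≤ 12 * ℓ ^ 3 * z ^ 8 := by
        refine Real.sqrt_le_iff.2 ⟨by positivity, ?_⟩
        have h5 : 1 ≤ 32 * ℓ ^ 5 := by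
          have := pow_le_pow_left₀ (by norm_num) hℓ 5
          linarith
        calc ℓ * D ≤ ℓ * z ^ 10 := by rw [← hz10]; gcongr
          _ = 1 * (ℓ * z ^ 10) := by ring
          _ ≤ 32 * ℓ ^ 5 * (ℓ * z ^ 16) := by
              gcongr
              norm_num
          _ ≤ (12 * ℓ ^ 3 * z ^ 8) ^ 2 := by
              have : 0 ≤ ℓ ^ 6 * z ^ 16 := by positivity
              nlinarith
      calc √(ℓ * D) * L ≤ 12 * ℓ ^ 3 * z ^ 8 * L ^ 2 := by gcongr
        _ = 12 * (L ^ 2 * z ^ 8 * ℓ ^ 3) := by ring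
        _ ≤ 12 * N := by gcongr
    · have h3 : D / N ≤ 1 := (div_le_one hN0).2 h
      calc √(ℓ / D) * (D / N) ≤ 4 / L * 1 := by gcongr
        _ ≤ 12 / L := by rw [mul_one]; gcongr; norm_num
  have h3 : √(ℓ / D) * (1 + max √(D / N) (D / N)) ≤ 16 / L := by
    rw [mul_add, mul_one, mul_max_of_nonneg _ _ hs0]
    have h4 : max (√(ℓ / D) * √(D / N)) (√(ℓ / D) * (D / N)) ≤ 12 / L :=
      max_le (h1.trans (by gcongr; norm_num)) h2
    have h5 : 4 / L + 12 / L = 16 / L := by ring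
    linarith
  have h6 : √(ℓ / D) ≤ 4 := hs.trans (div_le_self (by norm_num) hL)
  have h7 : 0 ≤ √(ℓ / D) * (1 + max √(D / N) (D / N)) :=
    mul_nonneg hs0 (add_nonneg zero_le_one (le_max_of_le_left (Real.sqrt_nonneg _)))
  calc σ ^ 2 * (1 + √(ℓ / D)) * √(ℓ / D) * (1 + max √(D / N) (D / N))
      = σ ^ 2 * (1 + √(ℓ / D)) * (√(ℓ / D) * (1 + max √(D / N) (D / N))) := by ring
    _ ≤ σ₀ ^ 2 * (1 + 4) * (16 / L) := by gcongr
    _ = 80 * σ₀ ^ 2 / L := by ring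

/-- The scalar estimates behind the sufficient orders, in terms of `z = p^{1/10}`. -/
theorem tauInf_le_of_orders [Nonempty (Fin p)] (hp : 2 ≤ p) {L σ σ₀ : ℝ} (hL : 1 ≤ L)
    (hSig : Sig.PosDef) (hκ : kappaSigma Sig ≤ κ) (hκ1 : 1 ≤ κ) (hσ0 : 0 ≤ σ) (hσ : σ ≤ σ₀)
    (hd : L ^ 2 * (p : ℝ) ^ (0.8 : ℝ) ≤ d) (hdn : d ≤ max p n)
    (hn : L ^ 2 * (p : ℝ) ^ (0.8 : ℝ) * Real.log p ^ 3 ≤ n) :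
    tauInf 1200 d n Sig σ ≤ 1200 * ((24 * κ + 14 + 80 * σ₀ ^ 2) / L) := by
  have hp2 : (2 : ℝ) ≤ p := by exact_mod_cast hp
  have hp0 : (0 : ℝ) < p := by linarith
  have hL0 : 0 < L := by linarith
  set z : ℝ := (p : ℝ) ^ (1 / 10 : ℝ) with hz
  have hz1 : 1 ≤ z := Real.one_le_rpow (by linarith) (by norm_num)
  have hz0 : 0 < z := by linarith
  have hz10 : (p : ℝ) = z ^ 10 := by
    rw [hz, ← Real.rpow_natCast, ← Real.rpow_mul hp0.le]; norm_num
  have hz8 : (p : ℝ) ^ (0.8 : ℝ) = z ^ 8 := by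
    rw [hz, ← Real.rpow_natCast, ← Real.rpow_mul hp0.le]; norm_num
  have hℓz : Real.log p ≤ 10 * z := by
    have := Real.log_le_rpow_div hp0.le (by norm_num : (0 : ℝ) < 1 / 10)
    rw [← hz] at this
    linarith
  have hℓ : 1 / 2 ≤ Real.log p := by
    have := Real.log_two_gt_d9
    have := Real.log_le_log (by norm_num) hp2
    linarith
  have hdn' : (d : ℝ) ≤ p ∨ (d : ℝ) ≤ n := by
    rcases le_max_iff.1 hdn with h | h
    · exact Or.inl (by exact_mod_cast h)
    · exact Or.inr (by exact_mod_cast h)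
  have hm := maxColNorm_le hSig hκ (by linarith)
  have hF := offFrobenius_le hκ (by linarith)
  have hm0 : 0 ≤ maxColNorm Sig := Real.iSup_nonneg fun _ => Real.sqrt_nonneg _
  have hF0 : 0 ≤ offFrobenius Sig := Real.sqrt_nonneg _
  rw [tauInf]
  refine mul_le_mul_of_nonneg_left ?_ (by norm_num)
  rw [hz8] at hd hn
  set ℓ := Real.log p
  set D : ℝ := (d : ℝ) with hD
  set N : ℝ := (n : ℝ) with hN
  set q : ℝ := (p : ℝ) with hq
  clear_value ℓ D N z q
  have hℓ0 : 0 < ℓ := by linarith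
  have hD0 : 0 < D := lt_of_lt_of_le (by positivity) hd
  have hN0 : 0 < N := lt_of_lt_of_le (by positivity) hn
  have hzk : ∀ k : ℕ, 1 ≤ z ^ k := fun k => one_le_pow₀ hz1
  have hL2 : L ≤ L ^ 2 := by nlinarith
  have hsq : √q = z ^ 5 := by
    rw [hz10, show z ^ 10 = (z ^ 5) ^ 2 by ring, Real.sqrt_sq (by positivity)]
  have hqD : q / D ≤ z ^ 2 := by
    rw [div_le_iff₀ hD0, hz10]
    calc z ^ 10 = z ^ 2 * (1 * z ^ 8) := by ring
      _ ≤ z ^ 2 * (L ^ 2 * z ^ 8) := by gcongr; nlinarith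
      _ ≤ z ^ 2 * D := by gcongr
  have hℓD : ℓ / D ≤ 10 / (L ^ 2 * z ^ 7) := by
    rw [div_le_div_iff₀ hD0 (by positivity)]
    calc ℓ * (L ^ 2 * z ^ 7) ≤ 10 * z * (L ^ 2 * z ^ 7) := by gcongr
      _ = 10 * (L ^ 2 * z ^ 8) := by ring
      _ ≤ 10 * D := by gcongr
  have hs : √(ℓ / D) ≤ 4 / L := by
    refine Real.sqrt_le_iff.2 ⟨by positivity, hℓD.trans ?_⟩
    rw [div_pow, div_le_div_iff₀ (by positivity) (by positivity)]
    nlinarith [hzk 7, sq_nonneg L]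
  have hr : √(ℓ / N) ≤ 2 / L := by
    refine Real.sqrt_le_iff.2 ⟨by positivity, ?_⟩
    rw [div_pow, div_le_div_iff₀ hN0 (by positivity)]
    have h1 : L ^ 2 * 1 * ℓ ^ 3 ≤ N := le_trans (by gcongr; exact hzk 8) hn
    have h2 : ℓ ≤ 4 * ℓ ^ 3 := by nlinarith [mul_nonneg hℓ0.le (by nlinarith : 0 ≤ 4 * ℓ ^ 2 - 1)]
    calc ℓ * L ^ 2 ≤ 4 * ℓ ^ 3 * L ^ 2 := by gcongr
      _ ≤ 2 ^ 2 * N := by linarith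
  have t1 : √(ℓ / D) * maxColNorm Sig ≤ 4 * κ / L := by
    calc √(ℓ / D) * maxColNorm Sig ≤ 4 / L * κ := by gcongr
      _ = 4 * κ / L := by ring
  -- The exponent `0.8` balances here: the term has order `p^{3/2} log p / d²`, with `p^{3/2} =
  -- z¹⁵`, `log p ≤ 10 z` and `d² ≥ L⁴ z¹⁶`.
  have t2 : ℓ / D * (1 + q / D) * offFrobenius Sig ≤ 20 * κ / L := by
    calc ℓ / D * (1 + q / D) * offFrobenius Sig
        ≤ 10 / (L ^ 2 * z ^ 7) * (2 * z ^ 2) * (z ^ 5 * κ) := by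
          rw [hsq] at hF
          gcongr
          linarith [hzk 2]
      _ = 20 * κ / L ^ 2 := by field_simp; ring
      _ ≤ 20 * κ / L := by gcongr
  have t3 := sample_order_le hL hz1 hz10 hℓ hd hn
  have t4 := sample_order_mul_le hL hz1 hz10 hℓ hd hn hqD
  have t5 := sensing_order_le hL hz1 hz10 hℓz hd
  have t6 := sensing_order_mul_le hL hz1 hz10 hℓz hd
  have t8 := noise_order_le (q := q) hL hσ0 hσ hz1 hℓ0 hℓ hD0 hN0 hz10 hdn' hn hs hr
  have hfin : (24 * κ + 14 + 80 * σ₀ ^ 2) / L = 4 * κ / L + 20 * κ / L + 2 / L + 2 / L + 4 / L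
      + 4 / L + 2 / L + 80 * σ₀ ^ 2 / L := by ring
  rw [hfin]
  linarith

end Orders

/-! ### Choice of the constant in the orders of `d` and `n`. -/

section Orders

/-- All conditions are monotone in the parameters. The quadratic one holds for small `τ` because its
left side is of order `τ²`. -/
theorem precError_conditions_of_le {p : ℕ} {Sig : Matrix (Fin p) (Fin p) ℝ}
    {θ κ₁ κ₂ b τ c : ℝ} {D : ℕ} (hτ : 0 ≤ τ) (hc : c = 2 * κ₂ * (1 + 8 / θ)) (hθ : 0 < θ)
    (hκ : 1 ≤ kappaSigma Sig) (hG : 1 ≤ kappaGamma Sig) (hdeg : 1 ≤ maxDeg Sig)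
    (hκ₁ : kappaSigma Sig ≤ κ₁) (hκ₂ : kappaGamma Sig ≤ κ₂) (hD : maxDeg Sig ≤ D)
    (hτ1 : c * τ ≤ (3 * κ₁ * D)⁻¹ * (κ₁ ^ 2 * κ₂)⁻¹)
    (hτ2 : 3 / 2 * D * κ₁ ^ 3 * c ^ 2 * τ ≤ 1) (hτ3 : c * τ ≤ b) :
    precError Sig θ τ ≤ (3 * kappaSigma Sig * maxDeg Sig)⁻¹
        * min 1 (kappaSigma Sig ^ 2 * kappaGamma Sig)⁻¹ ∧
      3 / 2 * maxDeg Sig * kappaSigma Sig ^ 3 * precError Sig θ τ ^ 2 ≤ τ ∧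
      precError Sig θ τ ≤ b := by
  have hdeg' : (1 : ℝ) ≤ maxDeg Sig := by exact_mod_cast hdeg
  have hD' : (maxDeg Sig : ℝ) ≤ D := by exact_mod_cast hD
  have hr : precError Sig θ τ ≤ c * τ := by
    rw [precError, hc]; gcongr
  have hr0 : 0 ≤ precError Sig θ τ := by rw [precError]; positivity
  have hκpos : 0 < kappaSigma Sig := by linarith
  have hGpos : 0 < kappaGamma Sig := by linarith
  have hdpos : (0 : ℝ) < maxDeg Sig := by linarith
  have hκ₁pos : 0 < κ₁ := by linarith
  have hκ₂pos : 0 < κ₂ := by linarith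
  refine ⟨hr.trans (hτ1.trans ?_), ?_, hr.trans hτ3⟩
  · have h1 : 1 ≤ kappaSigma Sig ^ 2 * kappaGamma Sig :=
      one_le_mul_of_one_le_of_one_le (one_le_pow₀ hκ) hG
    rw [min_eq_right (inv_le_one_of_one_le₀ h1)]
    gcongr
  · calc 3 / 2 * maxDeg Sig * kappaSigma Sig ^ 3 * precError Sig θ τ ^ 2
        ≤ 3 / 2 * D * κ₁ ^ 3 * (c * τ) ^ 2 := by gcongr
      _ = (3 / 2 * D * κ₁ ^ 3 * c ^ 2 * τ) * τ := by ring
      _ ≤ 1 * τ := by gcongr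
      _ = τ := one_mul τ

/-- With all other parameters bounded, large enough orders of `d` and `n` make the error level
small enough for the recovery guarantee and for a lower bound `b` on the signal. -/
theorem exists_order_constant {θ b : ℝ} (κ₁ κ₂ σ₀ : ℝ) (D : ℕ) (hθ : 0 < θ) (hb : 0 < b) :
    ∃ K : ℝ, 0 < K ∧ ∀ (p d n : ℕ), 2 ≤ p →
      K * (p : ℝ) ^ (0.8 : ℝ) ≤ d → d ≤ max p n →
      K * (p : ℝ) ^ (0.8 : ℝ) * Real.log p ^ 3 ≤ n →
      ∀ (Sig : Matrix (Fin p) (Fin p) ℝ) (σ : ℝ≥0), Sig.PosDef → (∀ i, Sig i i = 1) →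
      kappaSigma Sig ≤ κ₁ → kappaGamma Sig ≤ κ₂ → maxDeg Sig ≤ D → σ ≤ σ₀ →
      precError Sig θ (tauInf 1200 d n Sig σ) ≤ (3 * kappaSigma Sig * maxDeg Sig)⁻¹
          * min 1 (kappaSigma Sig ^ 2 * kappaGamma Sig)⁻¹ ∧
        3 / 2 * maxDeg Sig * kappaSigma Sig ^ 3 * precError Sig θ (tauInf 1200 d n Sig σ) ^ 2
          ≤ tauInf 1200 d n Sig σ ∧
        precError Sig θ (tauInf 1200 d n Sig σ) ≤ b := by
  -- If some bound is below one, no `Sig` satisfies the hypotheses and any `K` works.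
  by_cases hpar : 1 ≤ κ₁ ∧ 1 ≤ κ₂ ∧ 1 ≤ D
  swap
  · refine ⟨1, one_pos, fun p d n hp _ _ _ Sig σ hSig hdiag hκ₁ hκ₂ hD _ => absurd ?_ hpar⟩
    set i₀ : Fin p := ⟨0, by omega⟩
    exact ⟨(one_le_kappaSigma hdiag i₀).trans hκ₁, (one_le_kappaGamma hSig hdiag i₀).trans hκ₂,
      (one_le_maxDeg hSig i₀).trans hD⟩
  obtain ⟨hκ₁1, hκ₂1, hD1⟩ := hpar
  have hD1' : (1 : ℝ) ≤ D := by exact_mod_cast hD1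
  obtain ⟨c, hc⟩ : ∃ c, c = 2 * κ₂ * (1 + 8 / θ) := ⟨_, rfl⟩
  have hc0 : 0 < c := by rw [hc]; positivity
  obtain ⟨τ₀, hτ₀⟩ : ∃ τ₀, τ₀ = min (min ((3 * κ₁ * D)⁻¹ * (κ₁ ^ 2 * κ₂)⁻¹ / c)
    (1 / (3 / 2 * D * κ₁ ^ 3 * c ^ 2))) (b / c) := ⟨_, rfl⟩
  have hτ₀0 : 0 < τ₀ := by
    rw [hτ₀]
    exact lt_min (lt_min (by positivity) (by positivity)) (by positivity)
  obtain ⟨R, hR⟩ : ∃ R, R = 1200 * (24 * κ₁ + 14 + 80 * σ₀ ^ 2) := ⟨_, rfl⟩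
  have hR0 : 0 < R := by rw [hR]; positivity
  -- The error level is at most `R / L`, hence at most the threshold `τ₀`; the constant is `K = L²`.
  obtain ⟨L, hL⟩ : ∃ L, L = max 1 (R / τ₀) := ⟨_, rfl⟩
  have hL1 : 1 ≤ L := hL ▸ le_max_left _ _
  refine ⟨L ^ 2, by positivity, fun p d n hp hd hdn hn Sig σ hSig hdiag hκ₁ hκ₂ hD hσ => ?_⟩
  set i₀ : Fin p := ⟨0, by omega⟩
  have : Nonempty (Fin p) := ⟨i₀⟩
  have hτ : tauInf 1200 d n Sig σ ≤ τ₀ := by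
    refine (tauInf_le_of_orders hp hL1 hSig hκ₁ hκ₁1 σ.2 hσ hd hdn hn).trans ?_
    rw [← mul_div_assoc, ← hR, div_le_iff₀ (by linarith)]
    have := hL ▸ le_max_right 1 (R / τ₀)
    rw [div_le_iff₀ hτ₀0] at this
    linarith
  have hτ0 : 0 ≤ tauInf 1200 d n Sig σ :=
    le_trans (by positivity) (sqrt_log_div_le_tauInf (d := d) (n := n)
      (by norm_num : (0 : ℝ) ≤ 1200) (one_le_maxColNorm hdiag i₀) (σ : ℝ)).1
  have hτ1 := hτ.trans (hτ₀.le.trans ((min_le_left _ _).trans (min_le_left _ _)))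
  have hτ2 := hτ.trans (hτ₀.le.trans ((min_le_left _ _).trans (min_le_right _ _)))
  have hτ3 := hτ.trans (hτ₀.le.trans (min_le_right _ _))
  refine precError_conditions_of_le hτ0 hc hθ (one_le_kappaSigma hdiag i₀)
    (one_le_kappaGamma hSig hdiag i₀) (one_le_maxDeg hSig i₀) hκ₁ hκ₂ hD ?_ ?_ ?_
  · rw [le_div_iff₀ hc0] at hτ1; linarith
  · rw [le_div_iff₀ (by positivity)] at hτ2; linarith
  · rw [le_div_iff₀ hc0] at hτ3; linarith

end Orders

end IndirectGGM

/-! ### The main theorem. -/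

open IndirectGGM in
theorem mainTheorem1 :
    ∃ C a₀ a₁ a₂ a₃ a₄ : ℝ, 0 < C ∧ 0 < a₀ ∧ 0 < a₁ ∧ 0 < a₂ ∧ 0 < a₃ ∧ 0 < a₄ ∧
      -- the non-asymptotic guarantee
      (∀ (p d n : ℕ), 1 ≤ p → 1 ≤ d → 1 ≤ n →
        ∀ (Sig : Matrix (Fin p) (Fin p) ℝ) (θ : ℝ) (σ : ℝ≥0),
        Sig.PosDef → (∀ i, Sig i i = 1) →
        0 < θ → θ ≤ 1 → Irrepresentable Sig θ →
        precError Sig θ (tauInf C d n Sig σ)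
          ≤ (3 * kappaSigma Sig * maxDeg Sig)⁻¹
            * min 1 (kappaSigma Sig ^ 2 * kappaGamma Sig)⁻¹ →
        3 / 2 * maxDeg Sig * kappaSigma Sig ^ 3 * precError Sig θ (tauInf C d n Sig σ) ^ 2
          ≤ tauInf C d n Sig σ →
        ∀ (Ω : Type u) [MeasurableSpace Ω] (P : Measure Ω) [IsProbabilityMeasure P]
          (A : Ω → Matrix (Fin d) (Fin p) ℝ) (X : Fin n → Ω → EuclideanSpace ℝ (Fin p))
          (W : Fin n → Ω → Fin d → ℝ),
        IsSensingModel P Sig σ A X W →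
        P {ω | ¬ ∃ T : Matrix (Fin p) (Fin p) ℝ,
              (∀ T', IsGraphicalLasso
                (covEstimator (A ω) fun s => observe (A ω) (X s ω) (W s ω))
                (8 * tauInf C d n Sig σ / θ) T' ↔ T' = T) ∧
              (∀ i j, (i, j) ∉ precSupport Sig → T i j = 0) ∧
              entryMax (T - Sig⁻¹) ≤ precError Sig θ (tauInf C d n Sig σ) ∧
              ((∀ i j, i ≠ j → (i, j) ∈ precSupport Sig →
                  precError Sig θ (tauInf C d n Sig σ) ≤ |Sig⁻¹ i j|) →
                ∀ i j, SignType.sign (T i j) = SignType.sign (Sig⁻¹ i j))}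
          ≤ ENNReal.ofReal (failureBound a₀ a₁ a₂ a₃ a₄ p d)) ∧
      -- sufficient orders of `d` and `n` when all other parameters are bounded
      (∀ (θ κ₁ κ₂ σ₀ b : ℝ) (D : ℕ), 0 < θ → θ ≤ 1 → 0 < b →
        ∃ K : ℝ, 0 < K ∧
        ∀ (p d n : ℕ), 1 ≤ p → 1 ≤ d → 1 ≤ n →
        K * (p : ℝ) ^ (0.8 : ℝ) ≤ d → d ≤ max p n →
        K * (p : ℝ) ^ (0.8 : ℝ) * Real.log p ^ 3 ≤ n →
        ∀ (Sig : Matrix (Fin p) (Fin p) ℝ) (σ : ℝ≥0),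
        Sig.PosDef → (∀ i, Sig i i = 1) → Irrepresentable Sig θ →
        kappaSigma Sig ≤ κ₁ → kappaGamma Sig ≤ κ₂ → maxDeg Sig ≤ D → σ ≤ σ₀ →
        (∀ i j, i ≠ j → (i, j) ∈ precSupport Sig → b ≤ |Sig⁻¹ i j|) →
        ∀ (Ω : Type u) [MeasurableSpace Ω] (P : Measure Ω) [IsProbabilityMeasure P]
          (A : Ω → Matrix (Fin d) (Fin p) ℝ) (X : Fin n → Ω → EuclideanSpace ℝ (Fin p))
          (W : Fin n → Ω → Fin d → ℝ),
        IsSensingModel P Sig σ A X W →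
        P {ω | ¬ ∃ T : Matrix (Fin p) (Fin p) ℝ,
              (∀ T', IsGraphicalLasso
                (covEstimator (A ω) fun s => observe (A ω) (X s ω) (W s ω))
                (8 * tauInf C d n Sig σ / θ) T' ↔ T' = T) ∧
              ∀ i j, SignType.sign (T i j) = SignType.sign (Sig⁻¹ i j)}
          ≤ ENNReal.ofReal (failureBound a₀ a₁ a₂ a₃ a₄ p d)) := by
  refine ⟨1200, 16, 1, 1, 4, 1 / 16, by norm_num, by norm_num, by norm_num, by norm_num,
    by norm_num, by norm_num, ?_, ?_⟩
  · intro p d n hp hd hn Sig θ σ hSig hdiag hθ hθ1 hirr h1 h2 Ω _ P _ A X W h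
    exact h.measure_not_recovery_le hp hd hn hSig hdiag hθ hθ1 hirr h1 h2
  · intro θ κ₁ κ₂ σ₀ b D hθ hθ1 hb
    obtain ⟨K, hK, hK'⟩ := exists_order_constant κ₁ κ₂ σ₀ D hθ hb
    refine ⟨K, hK, ?_⟩
    intro p d n hp hd hn hdK hdn hnK Sig σ hSig hdiag hirr hκ₁ hκ₂ hD hσ hmin Ω _ P _ A X W h
    rcases hp.eq_or_lt with rfl | hp2
    · exact prob_le_one.trans (ENNReal.one_le_ofReal.2 (one_le_failureBound_one d))
    obtain ⟨h1, h2, h3⟩ := hK' p d n hp2 hdK hdn hnK Sig σ hSig hdiag hκ₁ hκ₂ hD hσ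
    refine (measure_mono ?_).trans
      (h.measure_not_recovery_le hp hd hn hSig hdiag hθ hθ1 hirr h1 h2)
    rintro ω hω ⟨T, hT, -, -, hsign⟩
    exact hω ⟨T, hT, hsign fun i j hij hS => h3.trans (hmin i j hij hS)⟩
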